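/- **Setting.** Let $d_0\ge 2$ be an integer and let $0<\delta<\tfrac12$, $0<\delta'<\tfrac{\delta}{8}$, $\gamma>\tfrac12$, $a>0$. Let $G$ be a finite connected (simple) graph with $|G|\ge 2$ vertices, all of degree at most $d_0$, and let $E=G\times\mathbb Z$ be the discrete cylinder with base $G$ (its edges join $(g,u)$ to $(g',u)$ with $g'\sim g$ and to $(g,u\pm1)$). Denote by $P_x$ the law of the discrete-time simple random walk $X$ on $E$ started at $x$, by $P^G_g$ the law of the discrete-time simple random walk $Y$ on $G$ started at $g$, and by $H_U=\inf\{n\ge0: \text{the walk is in }U\}$ and $T_U=H_{U^c}$ the entrance time in and the exit time from a set $U$. Let $[\cdot]$ be the integer part, and set $$\lambda_G=\inf_{f\ \text{nonconstant}}\frac{\frac1{2|G|}\sum_{g\sim g'}(f(g')-f(g))^2}{\operatorname{var}(f)},\qquad t_G=\lambda_G^{-1}\log(2|G|),\qquad h=2\big(\big[\sqrt{t_G}\,(\log|G|)^2\big]+1\big),$$ where the sum is over ordered pairs of neighbors and the variance is with respect to the uniform distribution on $G$. The class $\mathcal G_1=\mathcal G_1(d_0,\delta,\delta',\gamma,a)$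 consists of the graphs $G$ as above such that $\lambda_G>|G|^{-2(1-\delta)}(\log|G|)^{-1}$ and there exist sets $V\subseteq A\subseteq G$ with $V$ connected, such that $$|A|\ge\lambda_G^{-1/2}|G|^{15\delta/16},\qquad |G|^{\delta/8}\ge|V|\ge\tfrac1{d_0}|G|^{\delta'},$$ $$P^G_g[Y_n=g,\ n<T_A]\le\frac a{n^\gamma}\quad\text{for all } g\in A,\ n\ge1,$$ $$\frac{|G|^{1-\delta/8}}{h'}\sup_{x\in A^c\times\mathbb Z}P_x\big[H_{C(0)}<T_{\widetilde B'(0)}\big]\le1,$$ where $h'=\big[(\sqrt{|A|}\,|G|^{-\delta/8})^{1/\gamma}\big]\wedge h$, and, for $u\in\mathbb Z$, $$C(u)=V\times(u+[-v,v]),\qquad \widetilde B'(u)=G\times(u+[-(2h'-1),2h'-1]),$$ with $v=|V|\wedge w$, where $w\in\{\lfloor h'/2\rfloor,\lceil h'/2\rceil\}$ (either rounding is allowed). For $u\in\mathbb Z$ let $\widetilde R^u_1\le\widetilde D^u_1\le\widetilde R^u_2\le\cdots$ be the successive returns of $X$ to $C(u)$ and departures from $\widetilde B'(u)$: with $\widetilde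 D^u_0=0$, for $k\ge 0$ the time $\widetilde R^u_{k+1}$ is the first time $n\ge\widetilde D^u_k$ with $X_n\in C(u)$, and $\widetilde D^u_{k+1}$ is the first time $n\ge\widetilde R^u_{k+1}$ with $X_n\notin\widetilde B'(u)$ (a time is $\infty$ if there is no such $n$). **Proposition 3.2.** There is a positive constant $K_0$, depending only on $d_0,\delta,\delta',\gamma,a$, such that $$\lim_{|G|\to\infty,\ G\in\mathcal G_1}\ \sup_{x\in E}\ P_x\Big[\sup_{u\in\mathbb Z}\ \sum_{k\ge1}1\big\{\widetilde R^u_k<|G|^{2(1-\delta)}\big\}>K_0\Big]=0,$$ uniformly over the choice of $A$, $V$, $v$ as in the definition of $\mathcal G_1$. That is, for every $\varepsilon>0$ there is an $N$, depending only on $\varepsilon$ and $d_0,\delta,\delta',\gamma,a$, such that the supremum over $x$ is at most $\varepsilon$ whenever $G\in\mathcal G_1$, $|G|\ge N$ and $(A,V,v)$ is any admissible choice for $G$. -/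

import Mathlib

open MeasureTheory ProbabilityTheory

namespace CylinderWalk

noncomputable section

/-! ### Simple random walk on a graph and its canonical law -/

open Classical in
/-- One step of the simple random walk on the graph `Γ`: a uniformly chosen neighbor of `x`.
(By convention the walk stays put at a vertex which has no neighbor or infinitely many; this never
happens on the graphs considered below.) -/
def stepPMF {α : Type*} (Γ : SimpleGraph α) (x : α) : PMF α :=
  if h : ∃ hf : (Γ.neighborSet x).Finite, hf.toFinset.Nonempty then
    PMF.uniformOfFinset h.choose.toFinset h.choose_spec
  else PMF.pure x

/-- The transition kernel of the simple random walk on `Γ`. -/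
def stepKernel {α : Type*} [MeasurableSpace α] [Countable α] [MeasurableSingletonClass α]
    (Γ : SimpleGraph α) : Kernel α α :=
  Kernel.ofFunOfCountable fun x => (stepPMF Γ x).toMeasure

instance {α : Type*} [MeasurableSpace α] [Countable α] [MeasurableSingletonClass α]
    (Γ : SimpleGraph α) : IsMarkovKernel (stepKernel Γ) :=
  ⟨fun x => by
    change IsProbabilityMeasure (stepPMF Γ x).toMeasure
    infer_instance⟩

/-- `P_x`: the law, on the space of trajectories `ℕ → α`, of the discrete-time simple random walk
on `Γ` started at `x` (at every step the next position is drawn from `stepKernel Γ` applied to the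
current position). -/
def walkLaw {α : Type*} [MeasurableSpace α] [Countable α] [MeasurableSingletonClass α]
    (Γ : SimpleGraph α) (x : α) : Measure (ℕ → α) :=
  Kernel.trajMeasure (X := fun _ => α) (Measure.dirac x) fun n =>
    (stepKernel Γ).comap (fun y : (Π _ : Finset.Iic n, α) => y ⟨n, Finset.mem_Iic.2 le_rfl⟩)
      (measurable_pi_apply _)

/-! ### Entrance and exit times -/

/-- The first time `n ≥ σ` at which the trajectory `ω` is in `U` (`⊤` if there is none). This is
`H_U ∘ θ_σ + σ`, with `θ` the shift; in particular it is `⊤` if `σ = ⊤`. -/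
def entranceAfter {α : Type*} (U : Set α) (σ : ℕ∞) (ω : ℕ → α) : ℕ∞ :=
  sInf {t : ℕ∞ | ∃ n : ℕ, t = n ∧ σ ≤ n ∧ ω n ∈ U}

/-- The entrance time `H_U` in `U`. -/
def entranceTime {α : Type*} (U : Set α) (ω : ℕ → α) : ℕ∞ := entranceAfter U 0 ω

/-- The exit time `T_U` from `U`. -/
def exitTime {α : Type*} (U : Set α) (ω : ℕ → α) : ℕ∞ := entranceAfter Uᶜ 0 ω

/-- `D_k`, the `k`-th departure from `B` after returns to `C`, with the convention `D_0 = 0`: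
`D_{k+1}` is the first exit from `B` at or after the return time
`R_{k+1}`, itself the first entrance in `C` at or after `D_k`. -/
def departureTime {α : Type*} (C B : Set α) (ω : ℕ → α) : ℕ → ℕ∞
  | 0 => 0
  | k + 1 => entranceAfter Bᶜ (entranceAfter C (departureTime C B ω k) ω) ω

/-- `R_{k+1}`, for `k = 0, 1, …`: the `(k+1)`-st return to `C`, that is, the first entrance in `C`
at or after `D_k` (so `R_1 = H_C`). -/
def returnTime {α : Type*} (C B : Set α) (ω : ℕ → α) (k : ℕ) : ℕ∞ :=
  entranceAfter C (departureTime C B ω k) ω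

/-- The number of `k ≥ 1` such that the return time `R_k` is strictly smaller than `t`. -/
def numExcursions {α : Type*} (C B : Set α) (t : ℝ) (ω : ℕ → α) : ℕ∞ :=
  Set.encard {k : ℕ | ∃ n : ℕ, returnTime C B ω k = n ∧ (n : ℝ) < t}

/-! ### The cylinder and the geometric quantities -/

/-- The discrete cylinder `E = G × ℤ`, where `ℤ` has its nearest-neighbor graph structure. -/
def cylinderGraph {S : Type*} (G : SimpleGraph S) : SimpleGraph (S × ℤ) :=
  G.boxProd (SimpleGraph.hasse ℤ)

section Finite

variable {S : Type*} [Fintype S]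

/-- The mean of `f` under the uniform distribution on `G`. -/
def uniformMean (f : S → ℝ) : ℝ := (∑ g, f g) / Fintype.card S

/-- The variance of `f` under the uniform distribution on `G`. -/
def uniformVar (f : S → ℝ) : ℝ := uniformMean fun g => (f g - uniformMean f) ^ 2

open Classical in
/-- The Dirichlet form of the continuous-time walk with unit jump rate along each edge. -/
def dirichletForm (G : SimpleGraph S) (f : S → ℝ) : ℝ :=
  (1 / (2 * Fintype.card S)) * ∑ g, ∑ g', if G.Adj g g' then (f g' - f g) ^ 2 else 0

/-- The spectral gap `λ_G`, defined by the variational formula. -/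
def spectralGap (G : SimpleGraph S) : ℝ :=
  sInf {r : ℝ | ∃ f : S → ℝ, (¬ ∃ c, ∀ g, f g = c) ∧ r = dirichletForm G f / uniformVar f}

/-- `t_G = λ_G⁻¹ log (2 |G|)`. -/
def relaxTime (G : SimpleGraph S) : ℝ := (spectralGap G)⁻¹ * Real.log (2 * Fintype.card S)

/-- `h = 2 ([√t_G (log |G|)²] + 1)`. -/
def height (G : SimpleGraph S) : ℕ :=
  2 * (⌊√(relaxTime G) * Real.log (Fintype.card S) ^ 2⌋₊ + 1)

/-- `h' = [(√|A| |G|^{-δ/8})^{1/γ}] ∧ h`. -/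
def height' (δ γ : ℝ) (G : SimpleGraph S) (A : Finset S) : ℕ :=
  min ⌊(√(A.card : ℝ) * (Fintype.card S : ℝ) ^ (-(δ / 8))) ^ (1 / γ)⌋₊ (height G)

/-- The box `C(u) = V × (u + [-v, v])`. -/
def box (V : Finset S) (v : ℕ) (u : ℤ) : Set (S × ℤ) :=
  {x | x.1 ∈ V ∧ |x.2 - u| ≤ (v : ℤ)}

/-- The slab `B̃'(u) = G × (u + [-(2h'-1), 2h'-1])`. -/
def slab (S : Type*) (h' : ℕ) (u : ℤ) : Set (S × ℤ) :=
  {x | |x.2 - u| ≤ 2 * (h' : ℤ) - 1}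

/-- The standing assumptions on the base: a finite connected graph with at least two vertices, all
of degree at most `d₀`. -/
structure IsBase (d₀ : ℕ) (G : SimpleGraph S) : Prop where
  connected : G.Connected
  two_le_card : 2 ≤ Fintype.card S
  degree_le : ∀ g, (G.neighborSet g).ncard ≤ d₀

/-- The low spectral gap condition `λ_G ≤ |G|^{-2(1-δ)} (log |G|)⁻¹`. -/
def LowGap (δ : ℝ) (G : SimpleGraph S) : Prop :=
  spectralGap G ≤ (Fintype.card S : ℝ) ^ (-2 * (1 - δ)) * (Real.log (Fintype.card S))⁻¹

/-- `G` belongs to the class `𝒢₁(d₀, δ, δ', γ, a)` (pocket case), and this is witnessed by the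
pocket `A`, the connected set `V ⊆ A`, and the half-height `v` of the box `C = V × [-v, v]`.
The half-height is `v = |V| ∧ (h'/2)`, where `h'/2` is rounded to an integer, down or up. -/
structure IsPocket (d₀ : ℕ) (δ δ' γ a : ℝ) [MeasurableSpace S] [MeasurableSingletonClass S]
    (G : SimpleGraph S) (A V : Finset S) (v : ℕ) : Prop where
  base : IsBase d₀ G
  not_lowGap : ¬ LowGap δ G
  subset : V ⊆ A
  connected : (G.induce (V : Set S)).Connected
  card_pocket : (spectralGap G) ^ (-(1 / 2) : ℝ) * (Fintype.card S : ℝ) ^ (15 * δ / 16) ≤ A.card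
  card_le : (V.card : ℝ) ≤ (Fintype.card S : ℝ) ^ (δ / 8)
  le_card : 1 / (d₀ : ℝ) * (Fintype.card S : ℝ) ^ δ' ≤ V.card
  /-- on-diagonal decay of the heat kernel of the walk on `G` killed when exiting `A` -/
  heat_kernel : ∀ g ∈ A, ∀ n : ℕ, 1 ≤ n →
    (walkLaw G g).real {ω | ω n = g ∧ (n : ℕ∞) < exitTime (A : Set S) ω} ≤ a / (n : ℝ) ^ γ
  half_height : v = min V.card ⌊(height' δ γ G A : ℝ) / 2⌋₊ ∨
    v = min V.card ⌈(height' δ γ G A : ℝ) / 2⌉₊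
  /-- the walk on `E` starting outside `A × ℤ` rarely enters `C` before exiting the slab -/
  localization : ∀ x : S × ℤ, x.1 ∉ A →
    (Fintype.card S : ℝ) ^ (1 - δ / 8) / (height' δ γ G A : ℝ) *
      (walkLaw (cylinderGraph G) x).real
        {ω | entranceTime (box V v 0) ω < exitTime (slab S (height' δ γ G A) 0) ω} ≤ 1

end Finite

end

end CylinderWalk

/-! Write n for |G|. The core is a uniform estimate: from any point outside the slab around level u,
the walk reaches the box C(u) before time n^(2(1-δ)) with probability at most p = n^(-δ/4). Each
return after the first needs such a visit, so the Markov property at departures bounds the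
probability of more than K returns by p^K (`walkLaw_returnTime_lt_le`). Only about n^2 levels are
within reach, and K ≥ 12/δ gives p^K ≤ n^(-3) (`walkLaw_lt_iSup_numExcursions_le`, `levels_mul_le`).

The estimate is a comparison with supersolutions (`walkLaw_hit_le`). These are potentials of the
lazy walk that crosses each edge with probability 1/M and is killed at rate ε^2, with 1/ε of order
n^(1-δ), in place of a finite horizon. Under this walk the height moves autonomously and functions
of mean zero on the levels contract at the rate of the spectral gap λ. Hence the potential of a
charge on one level splits at the mixing time n₀, of order λ^(-1) log n
(`levelFun_potential_partial_le`). Before n₀ it is at most the supremum of the charge times 1/ε₀, of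
order n₀^(1/2), with geometric decay in the vertical distance; after n₀ it is at most the mean of
the charge times 1/ε, up to a negligible error.

If h' = h, the box is so far from the starting point that the part before mixing is negligible, and
what is left is |V|(2v+1) n^(-1) n^(1-δ) (`Scales.hit_le_of_height`).

If h' is the integer part of the radius attached to A, let q be the probability of entering the box
before leaving the slab. Outside the slab, hitting the box is controlled by the potential of a
charge on the levels ±2h', equal to q/M at the adjacent level of the slab
(`MixingData.walkLaw_hit_box_le_of_slabProb`). Its total mass is bounded by the capacity of the box
(`sum_slabProb_end_le`), its supremum by F/h', up to the factor 1/M, where F bounds q at height h'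
(`slabProb_end_le`). To find F, paths leaving A × ℤ are handled by the localization hypothesis, the
others by the Green function of the walk killed outside A × ℤ. That function is a series over the
moves of the base component, with terms of order k^(-γ) k^(-1/2), summable because γ > 1/2
(`PocketData.slabProb_le`). Reaching the box from height h' takes about h'^2 moves, so up to the
size of the box and small powers of n, F/h' is of order h'^(-2γ), hence of order 1/|A|. The factor
1/ε₀, of order λ^(-1/2), is then beaten by |A| ≥ λ^(-1/2) n^(15δ/16) (`Scales.hit_le_of_radius`). -/

namespace CylinderWalk

set_option linter.unusedSectionVars false

/-! ### One-step decomposition of the law of the walk -/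

/-- The trajectory which starts at `x` and then follows `ω`. -/
def consPath {α : Type*} (x : α) (ω : ℕ → α) : ℕ → α
  | 0 => x
  | n + 1 => ω n

@[simp] lemma consPath_zero {α : Type*} (x : α) (ω : ℕ → α) : consPath x ω 0 = x := rfl

@[simp] lemma consPath_succ {α : Type*} (x : α) (ω : ℕ → α) (n : ℕ) :
    consPath x ω (n + 1) = ω n := rfl

section Law

variable {α : Type*} [MeasurableSpace α] [Countable α] [MeasurableSingletonClass α]

lemma measurable_consPath (x : α) : Measurable (consPath x) := by
  refine measurable_pi_lambda _ fun n => ?_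
  cases n with
  | zero => exact measurable_const
  | succ n => exact measurable_pi_apply n

instance (Γ : SimpleGraph α) (x : α) : IsProbabilityMeasure (walkLaw Γ x) := by
  unfold walkLaw
  infer_instance

/-- The trajectories which agree with `f` up to time `n`. -/
def pathCylinder (n : ℕ) (f : ℕ → α) : Set (ℕ → α) := {ω | ∀ i ≤ n, ω i = f i}

lemma measurableSet_pathCylinder (n : ℕ) (f : ℕ → α) : MeasurableSet (pathCylinder n f) := by
  have : pathCylinder n f = ⋂ i, ⋂ (_ : i ≤ n), (fun ω : ℕ → α => ω i) ⁻¹' {f i} := by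
    ext ω; simp [pathCylinder]
  rw [this]
  exact MeasurableSet.iInter fun i => MeasurableSet.iInter fun _ =>
    measurable_pi_apply i (measurableSet_singleton _)

/-- Measures on trajectories are determined by their values on cylinders. -/
lemma ext_of_pathCylinder {μ ν : Measure (ℕ → α)} [IsProbabilityMeasure μ]
    [IsProbabilityMeasure ν] (h : ∀ n f, μ (pathCylinder n f) = ν (pathCylinder n f)) :
    μ = ν := by
  classical
  have hmap : ∀ n, μ.map (Preorder.frestrictLe (π := fun _ => α) n)
      = ν.map (Preorder.frestrictLe (π := fun _ => α) n) := by
    intro n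
    refine Measure.ext_of_singleton fun p => ?_
    rw [Measure.map_apply (by fun_prop) (measurableSet_singleton _),
      Measure.map_apply (by fun_prop) (measurableSet_singleton _)]
    have : (Preorder.frestrictLe (π := fun _ => α) n) ⁻¹' {p}
        = pathCylinder n (fun i => if hi : i ≤ n then p ⟨i, Finset.mem_Iic.2 hi⟩ else
          p ⟨0, Finset.mem_Iic.2 (Nat.zero_le _)⟩) := by
      ext ω
      simp only [Set.mem_preimage, Set.mem_singleton_iff, pathCylinder, Set.mem_ofPred_eq]
      constructor
      · rintro rfl i hi
        simp [hi]
      · intro h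
        ext ⟨i, hi⟩
        have := h i (Finset.mem_Iic.1 hi)
        simpa [Finset.mem_Iic.1 hi] using this
    rw [this, h]
  have h2 : ∀ I : Finset ℕ, μ.map (Finset.restrict (π := fun _ => α) I)
      = ν.map (Finset.restrict (π := fun _ => α) I) := by
    intro I
    have hI : I ⊆ Finset.Iic (I.sup id) := I.subset_Iic_sup_id
    rw [← Finset.restrict₂_comp_restrict hI, ← Measure.map_map, ← Measure.map_map]
    · have := hmap (I.sup id)
      unfold Preorder.frestrictLe at this
      rw [this]
    all_goals fun_prop
  exact IsProjectiveLimit.unique (P := fun I => ν.map (Finset.restrict (π := fun _ => α) I))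
    (fun I => h2 I) (fun I => rfl)

lemma walkLaw_map_frestrictLe_zero (Γ : SimpleGraph α) (x : α) :
    (walkLaw Γ x).map (fun ω => ω 0) = Measure.dirac x := by
  have h0 : (fun ω : ℕ → α => ω 0) = (fun p : (Π _ : Finset.Iic 0, α) =>
      p ⟨0, Finset.mem_Iic.2 le_rfl⟩) ∘ Preorder.frestrictLe (π := fun _ => α) 0 := rfl
  rw [h0, ← Measure.map_map (by fun_prop) (by fun_prop), walkLaw, Kernel.trajMeasure,
    Measure.map_comp _ _ (by fun_prop), Kernel.traj_map_frestrictLe, Kernel.partialTraj_self,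
    Measure.id_comp, Measure.map_map (by fun_prop) (by fun_prop)]
  exact Measure.map_id

lemma walkLaw_pathCylinder_zero (Γ : SimpleGraph α) (x : α) (f : ℕ → α) :
    walkLaw Γ x (pathCylinder 0 f) = Measure.dirac x {f 0} := by
  rw [← walkLaw_map_frestrictLe_zero Γ x,
    Measure.map_apply (measurable_pi_apply 0) (measurableSet_singleton _)]
  congr 1
  ext ω
  simp [pathCylinder]

lemma walkLaw_pathCylinder_succ (Γ : SimpleGraph α) (x : α) (n : ℕ) (f : ℕ → α) :
    walkLaw Γ x (pathCylinder (n + 1) f)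
      = walkLaw Γ x (pathCylinder n f) * stepKernel Γ (f n) {f (n + 1)} := by
  have h := Kernel.map_frestrictLe_trajMeasure_compProd_eq_map_trajMeasure (X := fun _ => α)
    (μ₀ := Measure.dirac x) (κ := fun n =>
    (stepKernel Γ).comap (fun y : (Π _ : Finset.Iic n, α) => y ⟨n, Finset.mem_Iic.2 le_rfl⟩)
      (measurable_pi_apply _)) (a := n)
  change (walkLaw Γ x).map _ ⊗ₘ _ = (walkLaw Γ x).map _ at h
  have h2 := congrArg (fun μ => μ ({Preorder.frestrictLe n f} ×ˢ {f (n + 1)})) h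
  beta_reduce at h2
  rw [Measure.map_apply (by fun_prop) (by measurability),
    Measure.compProd_apply_prod (by measurability) (by measurability)] at h2
  rw [lintegral_singleton, Measure.map_apply (by fun_prop) (by measurability),
    Kernel.comap_apply] at h2
  have e1 : (fun ω : ℕ → α => (Preorder.frestrictLe (π := fun _ => α) n ω, ω (n + 1))) ⁻¹'
      ({Preorder.frestrictLe (π := fun _ => α) n f} ×ˢ {f (n + 1)}) = pathCylinder (n + 1) f := by
    ext ω
    simp only [Set.mem_preimage, Set.mem_prod, Set.mem_singleton_iff, pathCylinder,
      Set.mem_ofPred_eq, funext_iff, Preorder.frestrictLe_apply, Subtype.forall, Finset.mem_Iic,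
      Nat.le_succ_iff_eq_or_le]
    grind
  have e2 : (Preorder.frestrictLe (π := fun _ => α) n) ⁻¹'
      {Preorder.frestrictLe (π := fun _ => α) n f} = pathCylinder n f := by
    ext ω
    simp [pathCylinder, funext_iff]
  rw [e1, e2] at h2
  rw [← h2, mul_comm]
  rfl

/-- The law is built by appending a last step, while the recursions below remove the first one. On
cylinders the two descriptions agree by induction on the length: peel off the last step on both
sides. -/
lemma walkLaw_eq_bind (Γ : SimpleGraph α) (x : α) :
    walkLaw Γ x = (stepKernel Γ x).bind fun y => (walkLaw Γ y).map (consPath x) := by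
  have hm : ∀ x, Measurable fun y => (walkLaw Γ y).map (consPath x) :=
    fun x => Measurable.of_discrete
  have hp : ∀ x y, IsProbabilityMeasure ((walkLaw Γ y).map (consPath x)) :=
    fun x y => Measure.isProbabilityMeasure_map (measurable_consPath x).aemeasurable
  have hp2 : ∀ x, IsProbabilityMeasure
      ((stepKernel Γ x).bind fun y => (walkLaw Γ y).map (consPath x)) := fun x =>
    ⟨by rw [Measure.bind_apply .univ (hm x).aemeasurable]; simp⟩
  have key : ∀ n x f, ((stepKernel Γ x).bind fun y => (walkLaw Γ y).map (consPath x))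
      (pathCylinder (n + 1) f) = Measure.dirac x {f 0} * (stepKernel Γ x).bind (walkLaw Γ)
        (pathCylinder n fun i => f (i + 1)) := by
    intro n x f
    rw [Measure.bind_apply (measurableSet_pathCylinder _ _) (hm x).aemeasurable,
      Measure.bind_apply (measurableSet_pathCylinder _ _) Measurable.of_discrete.aemeasurable,
      ← lintegral_const_mul _ Measurable.of_discrete]
    refine lintegral_congr fun y => ?_
    rw [Measure.map_apply (measurable_consPath x) (measurableSet_pathCylinder _ _)]
    by_cases hx : x = f 0
    · subst hx
      simp only [Measure.dirac_apply' _ (measurableSet_singleton _), Set.mem_singleton_iff,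
        Set.indicator_of_mem, Pi.one_apply, one_mul]
      congr 1
      ext ω
      simp only [pathCylinder, Set.mem_preimage, Set.mem_ofPred_eq]
      exact ⟨fun h i hi => h (i + 1) (by omega), fun h i hi => by
        cases i with
        | zero => rfl
        | succ i => exact h i (by omega)⟩
    · rw [Measure.dirac_apply' _ (measurableSet_singleton _), Set.indicator_of_notMem (by simpa),
        zero_mul]
      convert measure_empty (μ := walkLaw Γ y)
      ext ω
      simp only [pathCylinder, Set.mem_preimage, Set.mem_ofPred_eq, Set.mem_empty_iff_false,
        iff_false]
      exact fun h => hx (h 0 (by omega))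
  have key2 : ∀ n x f, walkLaw Γ x (pathCylinder (n + 1) f) = Measure.dirac x {f 0} *
      (stepKernel Γ x).bind (walkLaw Γ) (pathCylinder n fun i => f (i + 1)) := by
    intro n
    induction n with
    | zero =>
      intro x f
      rw [walkLaw_pathCylinder_succ, walkLaw_pathCylinder_zero,
        Measure.bind_apply (measurableSet_pathCylinder _ _) Measurable.of_discrete.aemeasurable]
      simp_rw [walkLaw_pathCylinder_zero]
      by_cases hx : x = f 0
      · subst hx
        congr 1
        simp only [Measure.dirac_apply' _ (measurableSet_singleton _)]
        have : (fun y => Set.indicator {f (0 + 1)} (1 : α → ENNReal) y)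
          = Set.indicator {f (0 + 1)} 1 := rfl
        rw [this, lintegral_indicator_one (measurableSet_singleton _)]
      · simp [Measure.dirac_apply' _ (measurableSet_singleton _), hx]
    | succ n ih =>
      intro x f
      rw [walkLaw_pathCylinder_succ, ih, mul_assoc]
      congr 1
      rw [Measure.bind_apply (measurableSet_pathCylinder _ _) Measurable.of_discrete.aemeasurable,
        Measure.bind_apply (measurableSet_pathCylinder _ _) Measurable.of_discrete.aemeasurable,
        ← lintegral_mul_const _ Measurable.of_discrete]
      refine lintegral_congr fun y => ?_
      rw [walkLaw_pathCylinder_succ]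
  have := hp2 x
  refine ext_of_pathCylinder fun n f => ?_
  cases n with
  | zero =>
    rw [walkLaw_pathCylinder_zero, Measure.bind_apply (measurableSet_pathCylinder _ _)
      (hm x).aemeasurable]
    have : ∀ y, (walkLaw Γ y).map (consPath x) (pathCylinder 0 f) = Measure.dirac x {f 0} := by
      intro y
      rw [Measure.map_apply (measurable_consPath x) (measurableSet_pathCylinder _ _)]
      by_cases hx : x = f 0
      · have : consPath x ⁻¹' pathCylinder 0 f = Set.univ := by
          ext ω; simp [pathCylinder, hx]
        rw [this]; simp [hx]
      · have : consPath x ⁻¹' pathCylinder 0 f = ∅ := by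
          ext ω; simp [pathCylinder, hx]
        rw [this]; simp [hx, Measure.dirac_apply' _ (measurableSet_singleton _)]
    simp [this]
  | succ n => rw [key, key2]

end Law

/-! ### Markov property and successive returns -/

/-- The event `A` is determined by the trajectory up to time `n`. -/
def DeterminedBy {α : Type*} (n : ℕ) (A : Set (ℕ → α)) : Prop :=
  ∀ ω ω' : ℕ → α, (∀ i ≤ n, ω i = ω' i) → ω ∈ A → ω' ∈ A

lemma entranceAfter_le_iff {α : Type*} {U : Set α} {σ : ℕ∞} {ω : ℕ → α} {m : ℕ} :
    entranceAfter U σ ω ≤ m ↔ ∃ n ≤ m, σ ≤ (n : ℕ∞) ∧ ω n ∈ U := by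
  unfold entranceAfter
  constructor
  · intro h
    have hne : {t : ℕ∞ | ∃ n : ℕ, t = n ∧ σ ≤ n ∧ ω n ∈ U}.Nonempty := by
      by_contra hcon
      rw [Set.not_nonempty_iff_eq_empty] at hcon
      rw [hcon, sInf_empty] at h
      exact absurd h (by simp)
    obtain ⟨n, hn, h1, h2⟩ := csInf_mem hne
    rw [hn] at h
    exact ⟨n, by exact_mod_cast h, h1, h2⟩
  · rintro ⟨n, hn, h1, h2⟩
    exact le_trans (sInf_le (show (n : ℕ∞) ∈ {t : ℕ∞ | ∃ n : ℕ, t = n ∧ σ ≤ n ∧ ω n ∈ U} from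
      ⟨n, rfl, h1, h2⟩)) (by exact_mod_cast hn)

lemma entranceAfter_lt_iff {α : Type*} {U : Set α} {σ : ℕ∞} {ω : ℕ → α} {m : ℕ} :
    entranceAfter U σ ω < m ↔ ∃ n < m, σ ≤ (n : ℕ∞) ∧ ω n ∈ U := by
  unfold entranceAfter
  rw [sInf_lt_iff]
  constructor
  · rintro ⟨t, ⟨n, rfl, h1, h2⟩, h3⟩
    exact ⟨n, by exact_mod_cast h3, h1, h2⟩
  · rintro ⟨n, h3, h1, h2⟩
    exact ⟨n, ⟨n, rfl, h1, h2⟩, by exact_mod_cast h3⟩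

lemma mem_of_entranceAfter_eq {α : Type*} {U : Set α} {σ : ℕ∞} {ω : ℕ → α} {m : ℕ}
    (h : entranceAfter U σ ω = m) : σ ≤ m ∧ ω m ∈ U := by
  obtain ⟨n, hn, h1, h2⟩ := entranceAfter_le_iff.1 h.le
  have : (m : ℕ∞) ≤ n := by
    rw [← h]; exact entranceAfter_le_iff.2 ⟨n, le_rfl, h1, h2⟩
  have : n = m := le_antisymm hn (by exact_mod_cast this)
  subst this
  exact ⟨h1, h2⟩

lemma le_entranceAfter {α : Type*} (U : Set α) (σ : ℕ∞) (ω : ℕ → α) :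
    σ ≤ entranceAfter U σ ω := by
  refine le_sInf ?_
  rintro t ⟨n, rfl, h, -⟩
  exact h

/-- Stopping-time property in a form that iterates: the starting times need to agree only in
comparisons with times up to `m`, and the conclusion has the shape of the hypothesis. -/
lemma entranceAfter_le_congr {α : Type*} {U : Set α} {σ σ' : ℕ∞} {ω ω' : ℕ → α} {m : ℕ}
    (hω : ∀ i ≤ m, ω i = ω' i) (hσ : ∀ i ≤ m, σ ≤ (i : ℕ∞) ↔ σ' ≤ (i : ℕ∞)) :
    ∀ i ≤ m, entranceAfter U σ ω ≤ (i : ℕ∞) ↔ entranceAfter U σ' ω' ≤ (i : ℕ∞) := by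
  intro i hi
  rw [entranceAfter_le_iff, entranceAfter_le_iff]
  refine exists_congr fun n => and_congr_right fun hn => ?_
  rw [hσ n (hn.trans hi), hω n (hn.trans hi)]

lemma departureTime_le_congr {α : Type*} {C B : Set α} {ω ω' : ℕ → α} {m : ℕ}
    (hω : ∀ i ≤ m, ω i = ω' i) (k : ℕ) :
    ∀ i ≤ m, departureTime C B ω k ≤ (i : ℕ∞) ↔ departureTime C B ω' k ≤ (i : ℕ∞) := by
  induction k with
  | zero => simp [departureTime]
  | succ k ih => exact entranceAfter_le_congr hω (entranceAfter_le_congr hω ih)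

lemma determinedBy_departureTime_eq {α : Type*} (C B : Set α) (k m : ℕ) :
    DeterminedBy m {ω | departureTime C B ω k = m} := by
  intro ω ω' h hA
  have key := departureTime_le_congr (C := C) (B := B) h k
  rw [Set.mem_ofPred_eq] at hA ⊢
  refine le_antisymm ((key m le_rfl).1 hA.le) ?_
  by_contra hlt
  rw [not_le] at hlt
  obtain ⟨j, hj⟩ := ENat.ne_top_iff_exists.1 hlt.ne_top
  rw [← hj] at hlt
  have hjm : j < m := by exact_mod_cast hlt
  have := (key j hjm.le).2 hj.symm.le
  rw [hA] at this
  exact absurd (by exact_mod_cast this) (not_le.2 hjm)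

lemma returnTime_monotone {α : Type*} (C B : Set α) (ω : ℕ → α) :
    Monotone (returnTime C B ω) :=
  monotone_nat_of_le_succ fun _ => (le_entranceAfter _ _ _).trans (le_entranceAfter _ _ _)

/-- `returnTime` is indexed from 0, so index `K` is return number `K + 1`. If it came too late,
monotonicity would leave only the `K` indices below it. -/
lemma returnTime_lt_of_lt_numExcursions {α : Type*} {C B : Set α} {t : ℝ} {ω : ℕ → α} {K : ℕ}
    (h : (K : ℕ∞) < numExcursions C B t ω) : returnTime C B ω K < ⌈t⌉₊ := by
  by_contra hcon
  have hsub : {k : ℕ | ∃ n : ℕ, returnTime C B ω k = n ∧ (n : ℝ) < t} ⊆ Finset.range K := by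
    rintro k ⟨n, hn, hlt⟩
    by_contra hk
    have hKk : K ≤ k := by simpa using hk
    have h1 := returnTime_monotone C B ω hKk
    rw [hn] at h1
    refine hcon (lt_of_le_of_lt h1 ?_)
    exact_mod_cast Nat.lt_ceil.2 hlt
  have := Set.encard_le_encard hsub
  rw [Set.encard_coe_eq_coe_finsetCard, Finset.card_range] at this
  exact absurd h (not_lt.2 this)

section Law

variable {α : Type*} [MeasurableSpace α] [Countable α] [MeasurableSingletonClass α]

/-- There are countably many initial segments of length `n + 1`, so every set of them is measurable.
-/
lemma DeterminedBy.measurableSet {n : ℕ} {A : Set (ℕ → α)} (h : DeterminedBy n A) :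
    MeasurableSet A := by
  have : A = (Preorder.frestrictLe (π := fun _ => α) n) ⁻¹'
      ((Preorder.frestrictLe (π := fun _ => α) n) '' A) := by
    refine Set.Subset.antisymm (Set.subset_preimage_image _ _) ?_
    rintro ω ⟨ω', h1, h2⟩
    refine h ω' ω (fun i hi => ?_) h1
    exact congrFun h2 ⟨i, Finset.mem_Iic.2 hi⟩
  rw [this]
  have hd : MeasurableSet ((Preorder.frestrictLe (π := fun _ => α) n) '' A) :=
    (Set.to_countable _).measurableSet
  exact (by fun_prop : Measurable (Preorder.frestrictLe (π := fun _ => α) n)) hd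

lemma walkLaw_apply_eq_lintegral (Γ : SimpleGraph α) (x : α) {B : Set (ℕ → α)}
    (hB : MeasurableSet B) :
    walkLaw Γ x B = ∫⁻ y, walkLaw Γ y (consPath x ⁻¹' B) ∂(stepKernel Γ x) := by
  conv_lhs => rw [walkLaw_eq_bind]
  rw [Measure.bind_apply hB Measurable.of_discrete.aemeasurable]
  exact lintegral_congr fun y => Measure.map_apply (measurable_consPath x) hB

lemma walkLaw_start (Γ : SimpleGraph α) (x : α) : walkLaw Γ x {ω | ω 0 = x} = 1 := by
  have := walkLaw_pathCylinder_zero Γ x (fun _ => x)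
  rw [Measure.dirac_apply' _ (measurableSet_singleton _)] at this
  simpa [pathCylinder] using this

lemma walkLaw_eq_zero_of_start (Γ : SimpleGraph α) (x : α) {A : Set (ℕ → α)}
    (hA : ∀ ω ∈ A, ω 0 ≠ x) : walkLaw Γ x A = 0 := by
  have hm : MeasurableSet {ω : ℕ → α | ω 0 = x} :=
    (measurable_pi_apply 0 : Measurable fun ω : ℕ → α => ω 0) (measurableSet_singleton x)
  have := prob_compl_eq_zero_iff (μ := walkLaw Γ x) hm |>.2 (walkLaw_start Γ x)
  exact measure_mono_null (fun ω hω => hA ω hω) this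

lemma walkLaw_eq_one_of_start (Γ : SimpleGraph α) (x : α) {A : Set (ℕ → α)}
    (hA : ∀ ω : ℕ → α, ω 0 = x → ω ∈ A) : walkLaw Γ x A = 1 :=
  le_antisymm prob_le_one ((walkLaw_start Γ x).symm.le.trans (measure_mono fun ω hω => hA ω hω))

/-- The Markov property at a fixed time, as an inequality. -/
lemma walkLaw_inter_shift_le (Γ : SimpleGraph α) {B : Set (ℕ → α)} (hB : MeasurableSet B)
    (p : ENNReal) (m : ℕ) : ∀ (A : Set (ℕ → α)), DeterminedBy m A →
    (∀ ω ∈ A, walkLaw Γ (ω m) B ≤ p) → ∀ x,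
    walkLaw Γ x (A ∩ {ω | (fun n => ω (m + n)) ∈ B}) ≤ p * walkLaw Γ x A := by
  induction m with
  | zero =>
    intro A hA hp x
    -- An event determined at time 0 is almost surely true or null, according to the starting point.
    by_cases hx : ∃ ω ∈ A, ω 0 = x
    · obtain ⟨ω, hω, rfl⟩ := hx
      have h1 : walkLaw Γ (ω 0) A = 1 := walkLaw_eq_one_of_start Γ _ fun ω' hω' =>
        hA ω ω' (fun i hi => by rw [Nat.le_zero.1 hi, hω']) hω
      rw [h1, mul_one]
      refine (measure_mono ?_).trans (hp ω hω)
      rintro ω' ⟨-, h⟩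
      simpa using h
    · push Not at hx
      rw [walkLaw_eq_zero_of_start Γ x (fun ω hω => hx ω hω.1)]
      exact zero_le
  | succ m ih =>
    intro A hA hp x
    have hsh : Measurable fun ω : ℕ → α => fun n => ω (m + 1 + n) :=
      measurable_pi_lambda _ fun n => measurable_pi_apply _
    have hsB : MeasurableSet {ω : ℕ → α | (fun n => ω (m + 1 + n)) ∈ B} := hsh hB
    rw [walkLaw_apply_eq_lintegral Γ x (hA.measurableSet.inter hsB),
      walkLaw_apply_eq_lintegral Γ x hA.measurableSet,
      ← lintegral_const_mul _ Measurable.of_discrete]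
    refine lintegral_mono fun y => ?_
    have hA' : DeterminedBy m (consPath x ⁻¹' A) := by
      intro ω ω' h hω
      refine hA (consPath x ω) (consPath x ω') (fun i hi => ?_) hω
      cases i with
      | zero => rfl
      | succ i => exact h i (by omega)
    have := ih (consPath x ⁻¹' A) hA' (fun ω hω => hp (consPath x ω) hω) y
    refine le_trans (measure_mono ?_) this
    rintro ω ⟨h1, h2⟩
    refine ⟨h1, ?_⟩
    have e : (fun n => consPath x ω (m + 1 + n)) = fun n => ω (m + n) := by
      funext n
      rw [show m + 1 + n = (m + n) + 1 by omega, consPath_succ]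
    rw [Set.mem_ofPred_eq, e] at h2
    exact h2

lemma determinedBy_hit (C : Set α) (T : ℕ) :
    DeterminedBy T {ω : ℕ → α | ∃ n < T, ω n ∈ C} := by
  rintro ω ω' h ⟨n, hn, hC⟩
  exact ⟨n, hn, h n hn.le ▸ hC⟩

/-- If hitting `C` before time `T` from outside `B` has probability at most `p`, then the
`(k+1)`-st return to `C` happens before `T` with probability at most `p ^ k`. -/
theorem walkLaw_returnTime_lt_le (Γ : SimpleGraph α) (C B : Set α) (T : ℕ) (p : ENNReal)
    (hp : ∀ y ∉ B, walkLaw Γ y {ω | ∃ n < T, ω n ∈ C} ≤ p) (x : α) (k : ℕ) :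
    walkLaw Γ x {ω | returnTime C B ω k < T} ≤ p ^ k := by
  induction k with
  | zero => simpa using prob_le_one
  | succ k ih =>
    -- Splitting over the value `m` of the last departure reduces the strong Markov property to
    -- fixed times; at time `m` the walk is outside `B`, and only `m < T` matters.
    set E : ℕ → Set (ℕ → α) := fun m => {ω | departureTime C B ω (k + 1) = m} with hE
    have hEm : ∀ m, MeasurableSet (E m) :=
      fun m => (determinedBy_departureTime_eq C B (k + 1) m).measurableSet
    have hdisj : Pairwise (Function.onFun Disjoint E) := by
      intro i j hij
      refine Set.disjoint_left.2 fun ω h1 h2 => hij ?_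
      have := h1.symm.trans h2
      exact_mod_cast this
    calc walkLaw Γ x {ω | returnTime C B ω (k + 1) < T}
        ≤ walkLaw Γ x (⋃ m ∈ Finset.range T, (E m ∩ {ω | (fun n => ω (m + n)) ∈
            {ω : ℕ → α | ∃ n < T, ω n ∈ C}})) := by
          refine measure_mono fun ω hω => ?_
          obtain ⟨n, hn, h1, h2⟩ := entranceAfter_lt_iff.1 hω
          obtain ⟨m, hm⟩ := ENat.ne_top_iff_exists.1 (ne_top_of_le_ne_top (ENat.natCast_ne_top n) h1)
          rw [← hm] at h1
          have hmn : m ≤ n := by exact_mod_cast h1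
          simp only [Set.mem_iUnion]
          refine ⟨m, Finset.mem_range.2 (by omega), hm.symm, n - m, by omega, ?_⟩
          simpa [show m + (n - m) = n by omega] using h2
      _ ≤ ∑ m ∈ Finset.range T, walkLaw Γ x (E m ∩ {ω | (fun n => ω (m + n)) ∈
            {ω : ℕ → α | ∃ n < T, ω n ∈ C}}) := measure_biUnion_finset_le _ _
      _ ≤ ∑ m ∈ Finset.range T, p * walkLaw Γ x (E m) := by
          refine Finset.sum_le_sum fun m _ => ?_
          exact walkLaw_inter_shift_le Γ (determinedBy_hit C T).measurableSet p m (E m)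
            (determinedBy_departureTime_eq C B (k + 1) m)
            (fun ω hω => hp _ (mem_of_entranceAfter_eq hω).2) x
      _ = p * walkLaw Γ x (⋃ m ∈ Finset.range T, E m) := by
          rw [← Finset.mul_sum, measure_biUnion_finset (fun i _ j _ hij => hdisj hij)
            (fun m _ => hEm m)]
      _ ≤ p * p ^ k := by
          refine mul_le_mul_right ((measure_mono ?_).trans ih) p
          intro ω hω
          simp only [Set.mem_iUnion] at hω
          obtain ⟨m, hm, hω⟩ := hω
          -- A departure before `T` is preceded by a return before `T`, which is the event of the
          -- induction hypothesis.
          refine lt_of_le_of_lt (le_entranceAfter Bᶜ _ ω) ?_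
          change departureTime C B ω (k + 1) < T
          rw [show departureTime C B ω (k + 1) = m from hω]
          exact_mod_cast Finset.mem_range.1 hm
      _ = p ^ (k + 1) := by rw [pow_succ, mul_comm]

end Law

/-! ### Recursions for hitting probabilities -/

section Hitting

variable {α : Type*}

/-- The trajectories which enter `C` before time `n`, without having left `B`. -/
def hitWithin (C B : Set α) (n : ℕ) : Set (ℕ → α) :=
  {ω | ∃ m < n, ω m ∈ C ∧ ∀ j ≤ m, ω j ∈ B}

lemma determinedBy_hitWithin (C B : Set α) (n : ℕ) : DeterminedBy n (hitWithin C B n) := by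
  rintro ω ω' h ⟨m, hm, hC, hB⟩
  exact ⟨m, hm, h m hm.le ▸ hC, fun j hj => h j (hj.trans hm.le) ▸ hB j hj⟩

lemma lt_exitTime_iff {B : Set α} {ω : ℕ → α} {m : ℕ} :
    (m : ℕ∞) < exitTime B ω ↔ ∀ j ≤ m, ω j ∈ B := by
  rw [← not_le, exitTime, entranceAfter_le_iff]
  simp

lemma entranceTime_lt_exitTime_eq (C B : Set α) :
    {ω : ℕ → α | entranceTime C ω < exitTime B ω} = ⋃ n, hitWithin C B n := by
  ext ω
  simp only [Set.mem_ofPred_eq, Set.mem_iUnion, hitWithin]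
  constructor
  · intro h
    obtain ⟨m, hm⟩ := ENat.ne_top_iff_exists.1 h.ne_top
    rw [← hm, lt_exitTime_iff] at h
    exact ⟨m + 1, m, by omega, (mem_of_entranceAfter_eq hm.symm).2, h⟩
  · rintro ⟨n, m, hm, hC, hB⟩
    exact lt_of_le_of_lt (entranceAfter_le_iff.2 ⟨m, le_rfl, by simp, hC⟩) (lt_exitTime_iff.2 hB)

lemma hitWithin_mono (C B : Set α) : Monotone (hitWithin C B) := by
  rintro n n' h ω ⟨m, hm, h'⟩
  exact ⟨m, hm.trans_le h, h'⟩

lemma consPath_mem_hitWithin {C B : Set α} {x : α} (hxB : x ∈ B) (hxC : x ∉ C) (n : ℕ) :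
    consPath x ⁻¹' hitWithin C B (n + 1) = hitWithin C B n := by
  ext ω
  constructor
  · rintro ⟨m, hm, hC, hB⟩
    cases m with
    | zero => exact absurd hC hxC
    | succ m => exact ⟨m, by omega, hC, fun j hj => hB (j + 1) (by omega)⟩
  · rintro ⟨m, hm, hC, hB⟩
    refine ⟨m + 1, by omega, hC, fun j hj => ?_⟩
    cases j with
    | zero => exact hxB
    | succ j => exact hB j (by omega)

variable [MeasurableSpace α] [Countable α] [MeasurableSingletonClass α]

lemma measurableSet_hitWithin (C B : Set α) (n : ℕ) : MeasurableSet (hitWithin C B n) :=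
  (determinedBy_hitWithin C B n).measurableSet

lemma tendsto_walkLaw_hitWithin (Γ : SimpleGraph α) (C B : Set α) (x : α) :
    Filter.Tendsto (fun n => (walkLaw Γ x).real (hitWithin C B n)) Filter.atTop
      (nhds ((walkLaw Γ x).real {ω | entranceTime C ω < exitTime B ω})) := by
  rw [entranceTime_lt_exitTime_eq]
  exact (ENNReal.tendsto_toReal (measure_ne_top _ _)).comp
    (tendsto_measure_iUnion_atTop (hitWithin_mono C B))

lemma walkLaw_hitWithin_eq_one (Γ : SimpleGraph α) {C B : Set α} {x : α} (hC : x ∈ C)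
    (hB : x ∈ B) (n : ℕ) : (walkLaw Γ x).real (hitWithin C B (n + 1)) = 1 := by
  rw [measureReal_def, walkLaw_eq_one_of_start Γ x, ENNReal.toReal_one]
  intro ω h
  refine ⟨0, by omega, h ▸ hC, fun j hj => ?_⟩
  rw [Nat.le_zero.1 hj, h]
  exact hB

lemma walkLaw_hitWithin_eq_zero (Γ : SimpleGraph α) {C B : Set α} {x : α} (hB : x ∉ B) (n : ℕ) :
    (walkLaw Γ x).real (hitWithin C B n) = 0 := by
  rw [measureReal_def, walkLaw_eq_zero_of_start Γ x, ENNReal.toReal_zero]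
  rintro ω ⟨m, _, _, h⟩ h0
  exact hB (h0 ▸ h 0 (Nat.zero_le _))

open Classical in
lemma stepKernel_singleton (Γ : SimpleGraph α) (x : α) {nb : Finset α}
    (hnb : ∀ y, y ∈ nb ↔ Γ.Adj x y) (hne : nb.Nonempty) (y : α) :
    stepKernel Γ x {y} = if y ∈ nb then (nb.card : ENNReal)⁻¹ else 0 := by
  change (stepPMF Γ x).toMeasure {y} = _
  rw [PMF.toMeasure_apply_singleton _ _ (measurableSet_singleton y)]
  have hf : (Γ.neighborSet x).Finite := by
    have : Γ.neighborSet x = nb := by ext y; simp [hnb]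
    rw [this]; exact nb.finite_toSet
  have hft : hf.toFinset = nb := by ext y; simp [hnb]
  have hex : ∃ hf : (Γ.neighborSet x).Finite, hf.toFinset.Nonempty := ⟨hf, hft ▸ hne⟩
  have hcT : hex.choose.toFinset = nb := hft
  rw [stepPMF, dif_pos hex, PMF.uniformOfFinset_apply]
  simp only [hcT]

lemma walkLaw_real_mul_card (Γ : SimpleGraph α) (x : α) {nb : Finset α}
    (hnb : ∀ y, y ∈ nb ↔ Γ.Adj x y) (hne : nb.Nonempty) {B : Set (ℕ → α)}
    (hB : MeasurableSet B) :
    (walkLaw Γ x).real B * nb.card = ∑ y ∈ nb, (walkLaw Γ y).real (consPath x ⁻¹' B) := by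
  classical
  rw [measureReal_def, walkLaw_apply_eq_lintegral Γ x hB, lintegral_countable']
  · simp_rw [stepKernel_singleton Γ x hnb hne]
    rw [tsum_eq_sum (s := nb) (fun y hy => by simp [hy]), ENNReal.toReal_sum
      (fun y hy => by
        simp only [hy, if_true]
        exact ENNReal.mul_ne_top (measure_ne_top _ _) (by simp [hne.ne_empty])), Finset.sum_mul]
    refine Finset.sum_congr rfl fun y hy => ?_
    have : (nb.card : ℝ) ≠ 0 := by simpa using hne.ne_empty
    simp [hy, measureReal_def, this]

end Hitting

/-! ### Neighbor sums on the base and the cylinder, and hitting probabilities as harmonic functions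
-/

noncomputable section Cylinder

variable {S : Type*} [Fintype S]

open Classical in
/-- The sum of `f` over the neighbors of `g`. -/
def nbSum (G : SimpleGraph S) (f : S → ℝ) (g : S) : ℝ := ∑ g', if G.Adj g g' then f g' else 0

/-- The degree of `g`, as a real number. -/
def degR (G : SimpleGraph S) (g : S) : ℝ := nbSum G (fun _ => 1) g

/-- The sum of `f` over the neighbors of `x` in the cylinder. -/
def cylSum (G : SimpleGraph S) (f : S × ℤ → ℝ) (x : S × ℤ) : ℝ :=
  nbSum G (fun g => f (g, x.2)) x.1 + f (x.1, x.2 + 1) + f (x.1, x.2 - 1)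

lemma nbSum_mono (G : SimpleGraph S) {f f' : S → ℝ} {g : S}
    (h : ∀ g', G.Adj g g' → f g' ≤ f' g') : nbSum G f g ≤ nbSum G f' g := by
  refine Finset.sum_le_sum fun g' _ => ?_
  split_ifs with hadj
  · exact h g' hadj
  · exact le_rfl

lemma nbSum_add (G : SimpleGraph S) (f f' : S → ℝ) (g : S) :
    nbSum G (fun g => f g + f' g) g = nbSum G f g + nbSum G f' g := by
  simp only [nbSum, ← Finset.sum_add_distrib]
  refine Finset.sum_congr rfl fun g' _ => ?_
  split_ifs <;> simp

lemma nbSum_sub (G : SimpleGraph S) (f f' : S → ℝ) (g : S) :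
    nbSum G (fun g => f g - f' g) g = nbSum G f g - nbSum G f' g := by
  simp only [nbSum, ← Finset.sum_sub_distrib]
  refine Finset.sum_congr rfl fun g' _ => ?_
  split_ifs <;> simp

lemma nbSum_const_mul (G : SimpleGraph S) (c : ℝ) (f : S → ℝ) (g : S) :
    nbSum G (fun g => c * f g) g = c * nbSum G f g := by
  simp only [nbSum, Finset.mul_sum]
  refine Finset.sum_congr rfl fun g' _ => ?_
  split_ifs <;> simp

lemma nbSum_const (G : SimpleGraph S) (c : ℝ) (g : S) :
    nbSum G (fun _ => c) g = c * degR G g := by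
  rw [degR, ← nbSum_const_mul]; simp

lemma nbSum_nonneg (G : SimpleGraph S) {f : S → ℝ} (h : ∀ g, 0 ≤ f g) (g : S) :
    0 ≤ nbSum G f g :=
  Finset.sum_nonneg fun g' _ => by split_ifs; exacts [h g', le_rfl]

lemma degR_nonneg (G : SimpleGraph S) (g : S) : 0 ≤ degR G g := nbSum_nonneg G (by simp) g

lemma nbSum_finset_sum {ι : Type*} (G : SimpleGraph S) (I : Finset ι) (f : ι → S → ℝ) (g : S) :
    nbSum G (fun g => ∑ i ∈ I, f i g) g = ∑ i ∈ I, nbSum G (f i) g := by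
  simp only [nbSum]
  rw [Finset.sum_comm]
  refine Finset.sum_congr rfl fun g' _ => ?_
  split_ifs <;> simp

/-- Reversibility: the adjacency operator is symmetric. -/
lemma sum_nbSum_mul (G : SimpleGraph S) (f f' : S → ℝ) :
    ∑ g, nbSum G f g * f' g = ∑ g, f g * nbSum G f' g := by
  simp only [nbSum, Finset.sum_mul, Finset.mul_sum]
  rw [Finset.sum_comm]
  refine Finset.sum_congr rfl fun g _ => Finset.sum_congr rfl fun g' _ => ?_
  rw [G.adj_comm]
  split_ifs <;> simp

lemma cylSum_mono (G : SimpleGraph S) {f f' : S × ℤ → ℝ} {x : S × ℤ}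
    (h : ∀ y, f y ≤ f' y) : cylSum G f x ≤ cylSum G f' x := by
  have := nbSum_mono G (g := x.1) fun g' _ => h (g', x.2)
  have := h (x.1, x.2 + 1)
  have := h (x.1, x.2 - 1)
  unfold cylSum
  linarith

lemma cylSum_const_mul (G : SimpleGraph S) (c : ℝ) (f : S × ℤ → ℝ) (x : S × ℤ) :
    cylSum G (fun y => c * f y) x = c * cylSum G f x := by
  simp only [cylSum, nbSum_const_mul]; ring

lemma cylSum_nonneg (G : SimpleGraph S) {f : S × ℤ → ℝ} (h : ∀ y, 0 ≤ f y) (x : S × ℤ) :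
    0 ≤ cylSum G f x := by
  have := nbSum_nonneg G (fun g => h (g, x.2)) x.1
  have := h (x.1, x.2 + 1)
  have := h (x.1, x.2 - 1)
  unfold cylSum
  linarith

variable [MeasurableSpace S] [MeasurableSingletonClass S]

/-- Multiplying by the degree instead of dividing also covers an isolated vertex, where both sides
vanish. -/
lemma walkLaw_base_mul_degR (G : SimpleGraph S) (g : S) {B : Set (ℕ → S)}
    (hB : MeasurableSet B) :
    (walkLaw G g).real B * degR G g
      = nbSum G (fun g' => (walkLaw G g').real (consPath g ⁻¹' B)) g := by
  classical
  have hd : degR G g = (Finset.univ.filter (G.Adj g)).card := by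
    simp [degR, nbSum]
  by_cases hne : (Finset.univ.filter (G.Adj g)).Nonempty
  · rw [hd, walkLaw_real_mul_card G g (by simp) hne hB, nbSum, Finset.sum_filter]
  · rw [Finset.not_nonempty_iff_eq_empty] at hne
    rw [hd, hne, nbSum, ← Finset.sum_filter, hne]
    simp

lemma walkLaw_cylinder_mul (G : SimpleGraph S) (x : S × ℤ) {B : Set (ℕ → S × ℤ)}
    (hB : MeasurableSet B) :
    (walkLaw (cylinderGraph G) x).real B * (degR G x.1 + 2)
      = cylSum G (fun y => (walkLaw (cylinderGraph G) y).real (consPath x ⁻¹' B)) x := by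
  classical
  obtain ⟨g, z⟩ := x
  set N₁ : Finset (S × ℤ) := (Finset.univ.filter (G.Adj g)).map
    (Function.Embedding.sectL S z) with hN₁
  set N₂ : Finset (S × ℤ) := {(g, z + 1), (g, z - 1)} with hN₂
  have hdisj : Disjoint N₁ N₂ := by
    rw [Finset.disjoint_left]
    rintro ⟨g', z'⟩ h1 h2
    simp only [hN₁, hN₂, Finset.mem_map, Function.Embedding.sectL_apply, Prod.mk.injEq,
      Finset.mem_insert, Finset.mem_singleton] at h1 h2
    obtain ⟨a, -, -, h⟩ := h1
    omega
  have hne : ((g, z + 1) : S × ℤ) ≠ (g, z - 1) := by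
    simp only [ne_eq, Prod.mk.injEq, true_and]; omega
  have hcov : ∀ a b : ℤ, a ⋖ b ↔ b = a + 1 := fun a b => by
    rw [← Order.succ_eq_iff_covBy, Int.succ_eq_succ, Int.succ, eq_comm]
  have hmem : ∀ y, y ∈ N₁ ∪ N₂ ↔ (cylinderGraph G).Adj (g, z) y := by
    rintro ⟨g', z'⟩
    simp only [hN₁, hN₂, cylinderGraph, SimpleGraph.boxProd_adj, SimpleGraph.hasse_adj,
      Finset.mem_union, Finset.mem_map, Finset.mem_filter, Finset.mem_univ, true_and,
      Function.Embedding.sectL_apply, Prod.mk.injEq, Finset.mem_insert, Finset.mem_singleton,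
      hcov]
    constructor
    · rintro (⟨a, h, ha, h'⟩ | ⟨h, h'⟩ | ⟨h, h'⟩)
      · exact Or.inl ⟨ha ▸ h, h'⟩
      · exact Or.inr ⟨Or.inl h', h.symm⟩
      · exact Or.inr ⟨Or.inr (by omega), h.symm⟩
    · rintro (⟨h, h'⟩ | ⟨h | h, h'⟩)
      · exact Or.inl ⟨_, h, rfl, h'⟩
      · exact Or.inr (Or.inl ⟨h'.symm, h⟩)
      · exact Or.inr (Or.inr ⟨h'.symm, by omega⟩)
  have hcard : ((N₁ ∪ N₂).card : ℝ) = degR G g + 2 := by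
    rw [Finset.card_union_of_disjoint hdisj, hN₁, Finset.card_map, hN₂, Finset.card_pair hne]
    simp [degR, nbSum]
  rw [← hcard, walkLaw_real_mul_card _ _ hmem ⟨(g, z + 1), by simp [hN₂]⟩ hB,
    Finset.sum_union hdisj, hN₁, Finset.sum_map, hN₂, Finset.sum_pair hne, Finset.sum_filter]
  simp only [cylSum, nbSum, Function.Embedding.sectL_apply]
  ring

/-- Comparison of (discounted) hitting probabilities with superharmonic functions. -/
lemma pow_mul_walkLaw_hitWithin_le (G : SimpleGraph S) {C B : Set (S × ℤ)} {r : ℝ} (hr : 0 ≤ r)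
    (hr1 : r ≤ 1) {w : S × ℤ → ℝ} (h0 : ∀ x, 0 ≤ w x) (h1 : ∀ x ∈ C, x ∈ B → 1 ≤ w x)
    (hw : ∀ x ∈ B, x ∉ C → r * cylSum G w x ≤ w x * (degR G x.1 + 2)) (n : ℕ) (x : S × ℤ) :
    r ^ n * (walkLaw (cylinderGraph G) x).real (hitWithin C B n) ≤ w x := by
  induction n generalizing x with
  | zero => simpa [hitWithin] using h0 x
  | succ n ih =>
    by_cases hB : x ∈ B
    · by_cases hC : x ∈ C
      · rw [walkLaw_hitWithin_eq_one _ hC hB, mul_one]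
        exact (pow_le_one₀ hr hr1).trans (h1 x hC hB)
      · have hd : 0 < degR G x.1 + 2 := by linarith [degR_nonneg G x.1]
        refine le_of_mul_le_mul_right ?_ hd
        rw [mul_assoc, walkLaw_cylinder_mul G x (measurableSet_hitWithin C B _),
          consPath_mem_hitWithin hB hC, pow_succ', mul_assoc, ← cylSum_const_mul]
        exact (mul_le_mul_of_nonneg_left (cylSum_mono G ih) hr).trans (hw x hB hC)
    · rw [walkLaw_hitWithin_eq_zero _ hB, mul_zero]
      exact h0 x

/-- The probability to enter `C` before leaving `B`. -/
def hitProb (G : SimpleGraph S) (C B : Set (S × ℤ)) (x : S × ℤ) : ℝ :=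
  (walkLaw (cylinderGraph G) x).real {ω | entranceTime C ω < exitTime B ω}

lemma hitProb_nonneg (G : SimpleGraph S) (C B : Set (S × ℤ)) (x : S × ℤ) : 0 ≤ hitProb G C B x :=
  measureReal_nonneg

lemma hitProb_le_one (G : SimpleGraph S) (C B : Set (S × ℤ)) (x : S × ℤ) : hitProb G C B x ≤ 1 :=
  measureReal_le_one

lemma hitProb_eq_one (G : SimpleGraph S) {C B : Set (S × ℤ)} {x : S × ℤ} (hC : x ∈ C)
    (hB : x ∈ B) : hitProb G C B x = 1 := by
  refine tendsto_nhds_unique (tendsto_walkLaw_hitWithin _ C B x) ?_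
  rw [← Filter.tendsto_add_atTop_iff_nat 1]
  simp [walkLaw_hitWithin_eq_one _ hC hB]

lemma hitProb_eq_zero (G : SimpleGraph S) {C B : Set (S × ℤ)} {x : S × ℤ} (hB : x ∉ B) :
    hitProb G C B x = 0 := by
  refine tendsto_nhds_unique (tendsto_walkLaw_hitWithin _ C B x) ?_
  simp [walkLaw_hitWithin_eq_zero _ hB]

lemma hitProb_harmonic (G : SimpleGraph S) {C B : Set (S × ℤ)} {x : S × ℤ} (hC : x ∉ C)
    (hB : x ∈ B) : cylSum G (hitProb G C B) x = hitProb G C B x * (degR G x.1 + 2) := by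
  have hl := ((tendsto_walkLaw_hitWithin (cylinderGraph G) C B x).comp
    (Filter.tendsto_add_atTop_nat 1)).mul_const (degR G x.1 + 2)
  have hr : Filter.Tendsto (fun n => cylSum G (fun y =>
      (walkLaw (cylinderGraph G) y).real (hitWithin C B n)) x) Filter.atTop
      (nhds (cylSum G (hitProb G C B) x)) := by
    unfold cylSum nbSum
    refine ((tendsto_finsetSum _ fun g' _ => ?_).add (tendsto_walkLaw_hitWithin _ C B _)).add
      (tendsto_walkLaw_hitWithin _ C B _)
    split_ifs
    · exact tendsto_walkLaw_hitWithin _ C B _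
    · exact tendsto_const_nhds
  refine tendsto_nhds_unique hr (hl.congr fun n => ?_)
  rw [Function.comp_apply, walkLaw_cylinder_mul G x (measurableSet_hitWithin C B _),
    consPath_mem_hitWithin hB hC]

/-- Minimality of the hitting probability among nonnegative superharmonic functions that are at
least 1 on the target: the undiscounted comparison, with the horizon sent to infinity. -/
lemma hitProb_le (G : SimpleGraph S) {C B : Set (S × ℤ)} {w : S × ℤ → ℝ} (h0 : ∀ x, 0 ≤ w x)
    (h1 : ∀ x ∈ C, x ∈ B → 1 ≤ w x)
    (hw : ∀ x ∈ B, x ∉ C → cylSum G w x ≤ w x * (degR G x.1 + 2)) (x : S × ℤ) :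
    hitProb G C B x ≤ w x := by
  refine le_of_tendsto (tendsto_walkLaw_hitWithin _ C B x) (Filter.Eventually.of_forall fun n => ?_)
  simpa using pow_mul_walkLaw_hitWithin_le G zero_le_one le_rfl h0 h1 (by simpa using hw) n x

open Classical in
/-- The probability that the walk on the base started at `g` is at `g'` at time `n` and has not
left `A`. -/
def killedKernel (G : SimpleGraph S) (A : Finset S) (g' : S) : ℕ → S → ℝ
  | 0, g => if g = g' ∧ g ∈ A then 1 else 0
  | n + 1, g => if g ∈ A then nbSum G (killedKernel G A g' n) g / degR G g else 0

/-- Turns the heat kernel hypothesis, stated for the law of the walk, into one on a recursively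
defined kernel. -/
lemma walkLaw_killed_eq (G : SimpleGraph S) (hd : ∀ g, 0 < degR G g) (A : Finset S) (g' : S)
    (n : ℕ) (g : S) :
    (walkLaw G g).real {ω | ω n = g' ∧ (n : ℕ∞) < exitTime (A : Set S) ω}
      = killedKernel G A g' n g := by
  have hset : ∀ n : ℕ, {ω : ℕ → S | ω n = g' ∧ (n : ℕ∞) < exitTime (A : Set S) ω}
      = {ω | ω n = g' ∧ ∀ j ≤ n, ω j ∈ A} := by
    intro n; ext ω; simp [lt_exitTime_iff]
  rw [hset]
  induction n generalizing g with
  | zero =>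
    rw [killedKernel, measureReal_def]
    split_ifs with h
    · rw [walkLaw_eq_one_of_start, ENNReal.toReal_one]
      intro ω hω
      exact ⟨hω.trans h.1, fun j hj => by rw [Nat.le_zero.1 hj, hω]; exact h.2⟩
    · rw [walkLaw_eq_zero_of_start, ENNReal.toReal_zero]
      rintro ω ⟨h1, h2⟩ rfl
      exact h ⟨h1, h2 0 le_rfl⟩
  | succ n ih =>
    rw [killedKernel]
    split_ifs with h
    · have hdet : DeterminedBy (n + 1) {ω : ℕ → S | ω (n + 1) = g' ∧ ∀ j ≤ n + 1, ω j ∈ A} := by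
        rintro ω ω' hω ⟨h1, h2⟩
        exact ⟨hω (n + 1) le_rfl ▸ h1, fun j hj => hω j hj ▸ h2 j hj⟩
      rw [eq_div_iff (hd g).ne', walkLaw_base_mul_degR G g hdet.measurableSet]
      congr 1
      funext y
      rw [← ih]
      congr 1
      ext ω
      constructor
      · rintro ⟨h1, h2⟩
        exact ⟨h1, fun j hj => h2 (j + 1) (by omega)⟩
      · rintro ⟨h1, h2⟩
        refine ⟨h1, fun j hj => ?_⟩
        cases j with
        | zero => exact h
        | succ j => exact h2 j (by omega)
    · rw [measureReal_def, walkLaw_eq_zero_of_start, ENNReal.toReal_zero]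
      rintro ω ⟨h1, h2⟩ rfl
      exact h (h2 0 (by omega))

end Cylinder

noncomputable section

/-! ### Lazy walks and potentials -/

/-- The transition operator of the lazy walk on `ℤ` which jumps to each neighbor with
probability `1 / M`. -/
def lazyZ (M : ℝ) : Module.End ℝ (ℤ → ℝ) where
  toFun r z := r z * (1 - 2 / M) + (r (z + 1) + r (z - 1)) / M
  map_add' r r' := by ext z; simp; ring
  map_smul' c r := by ext z; simp; ring

lemma lazyZ_apply (M : ℝ) (r : ℤ → ℝ) (z : ℤ) :
    lazyZ M r z = r z * (1 - 2 / M) + (r (z + 1) + r (z - 1)) / M := rfl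

/-- If `φ + s T r ≤ r` for a positive operator `T`, then `r` bounds the partial sums of the
potential of `φ`. -/
lemma potential_partial_le {X : Type*} (T : Module.End ℝ (X → ℝ))
    (hT : ∀ f : X → ℝ, (∀ x, 0 ≤ f x) → ∀ x, 0 ≤ T f x) {s : ℝ} (hs : 0 ≤ s) {φ r : X → ℝ}
    (hr : ∀ x, 0 ≤ r x) (h : ∀ x, φ x + s * T r x ≤ r x) (J : ℕ) (x : X) :
    ∑ n ∈ Finset.range J, s ^ n * (T ^ n) φ x ≤ r x := by
  have hTn : ∀ n, ∀ f : X → ℝ, (∀ x, 0 ≤ f x) → ∀ x, 0 ≤ (T ^ n) f x := by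
    intro n
    induction n with
    | zero => intro f hf x; simpa using hf x
    | succ n ih => intro f hf x; rw [pow_succ', Module.End.mul_apply]; exact hT _ (ih f hf) x
  have key : ∀ J, ∑ n ∈ Finset.range J, s ^ n * (T ^ n) φ x + s ^ J * (T ^ J) r x ≤ r x := by
    intro J
    induction J with
    | zero => simp
    | succ J ih =>
      rw [Finset.sum_range_succ]
      have h1 : 0 ≤ (T ^ J) (r - φ - s • T r) x :=
        hTn J _ (fun y => by simpa using by linarith [h y]) x
      rw [map_sub, map_sub, map_smul, ← Module.End.mul_apply, ← pow_succ] at h1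
      simp only [Pi.sub_apply, Pi.smul_apply, smul_eq_mul] at h1
      have := mul_nonneg (pow_nonneg hs J) h1
      rw [pow_succ]
      linarith
  have := mul_nonneg (pow_nonneg hs J) (hTn J r hr x)
  linarith [key J]

lemma lazyZ_nonneg {M : ℝ} (hM : 2 ≤ M) (f : ℤ → ℝ) (hf : ∀ x, 0 ≤ f x) (z : ℤ) :
    0 ≤ lazyZ M f z := by
  rw [lazyZ_apply]
  have : 2 / M ≤ 1 := (div_le_one (by linarith)).2 hM
  have := mul_nonneg (hf z) (by linarith : (0 : ℝ) ≤ 1 - 2 / M)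
  have := div_nonneg (add_nonneg (hf (z + 1)) (hf (z - 1))) (by linarith : (0 : ℝ) ≤ M)
  linarith

/-- The indicator function of `{z₀}`. -/
def delta (z₀ : ℤ) : ℤ → ℝ := fun z => if z = z₀ then 1 else 0

/-- The geometric profile is a supersolution: decay at rate `ε` in space matches killing at rate `ε
^ 2` in time, and the peak `M / ε` pays for the unit charge at `z₀`. -/
lemma lazyZ_potential_le {M ε : ℝ} (hM : 4 ≤ M) (hε : 0 < ε) (hε2 : ε ≤ 1 / 2) (z₀ : ℤ)
    (J : ℕ) (z : ℤ) :
    ∑ n ∈ Finset.range J, (1 - ε ^ 2) ^ n * (lazyZ M ^ n) (delta z₀) z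
      ≤ M / ε * (1 - ε) ^ (z - z₀).natAbs := by
  have hM0 : 0 < M := by linarith
  have hs : (3 : ℝ) / 4 ≤ 1 - ε ^ 2 := by nlinarith
  refine potential_partial_le (lazyZ M) (lazyZ_nonneg (by linarith)) (by linarith)
    (r := fun z => M / ε * (1 - ε) ^ (z - z₀).natAbs)
    (fun z => mul_nonneg (by positivity) (pow_nonneg (by linarith) _)) (fun z => ?_) J z
  rw [lazyZ_apply, delta]
  split_ifs with h
  · subst h
    rw [show z - z = 0 by ring, show z + 1 - z = 1 by ring, show z - 1 - z = -1 by ring]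
    simp only [Int.natAbs_zero, Int.natAbs_one, Int.natAbs_neg, pow_zero, pow_one]
    have : M / ε * 1 - (1 + (1 - ε ^ 2) * (M / ε * 1 * (1 - 2 / M) +
        (M / ε * (1 - ε) + M / ε * (1 - ε)) / M)) = M * ε + 2 * (1 - ε ^ 2) - 1 := by
      field_simp
      ring
    nlinarith [mul_pos hM0 hε]
  · obtain ⟨k, hk⟩ : ∃ k, (z - z₀).natAbs = k + 1 :=
      ⟨(z - z₀).natAbs - 1, by have : z - z₀ ≠ 0 := sub_ne_zero.2 h; omega⟩
    have hsum : M / ε * (1 - ε) ^ (z + 1 - z₀).natAbs + M / ε * (1 - ε) ^ (z - 1 - z₀).natAbs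
        = M / ε * ((1 - ε) ^ (k + 2) + (1 - ε) ^ k) := by
      rcases lt_or_gt_of_ne h with h' | h'
      · rw [show (z + 1 - z₀).natAbs = k by omega, show (z - 1 - z₀).natAbs = k + 2 by omega]; ring
      · rw [show (z + 1 - z₀).natAbs = k + 2 by omega, show (z - 1 - z₀).natAbs = k by omega]; ring
    rw [hk, hsum]
    have hpk : 0 ≤ (1 - ε) ^ k := pow_nonneg (by linarith) _
    have : M / ε * (1 - ε) ^ (k + 1) - (0 + (1 - ε ^ 2) * (M / ε * (1 - ε) ^ (k + 1) * (1 - 2 / M)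
        + M / ε * ((1 - ε) ^ (k + 2) + (1 - ε) ^ k) / M))
        = (1 - ε) ^ k * ε * (M * (1 - ε) - (1 - ε ^ 2)) := by
      field_simp
      ring
    have h2 : 0 ≤ M * (1 - ε) - (1 - ε ^ 2) := by nlinarith
    have := mul_nonneg (mul_nonneg hpk hε.le) h2
    linarith

/-! ### The lazy walk on the cylinder: Laplacian of the base, contraction, potential of a level -/

variable {S : Type*} [Fintype S]

/-- The transition operator of the lazy walk on the cylinder which jumps to each neighbor with
probability `1 / M`. -/
def lazyOp (G : SimpleGraph S) (M : ℝ) : Module.End ℝ (S × ℤ → ℝ) where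
  toFun f x := f x * (1 - (degR G x.1 + 2) / M) + cylSum G f x / M
  map_add' f f' := by ext x; simp only [cylSum, Pi.add_apply, nbSum_add]; ring
  map_smul' c f := by
    ext x
    simp only [cylSum, Pi.smul_apply, smul_eq_mul, nbSum_const_mul, RingHom.id_apply]
    ring

lemma lazyOp_apply (G : SimpleGraph S) (M : ℝ) (f : S × ℤ → ℝ) (x : S × ℤ) :
    lazyOp G M f x = f x * (1 - (degR G x.1 + 2) / M) + cylSum G f x / M := rfl

/-- The combinatorial Laplacian of the base. -/
def lapl (G : SimpleGraph S) (f : S → ℝ) (g : S) : ℝ := degR G g * f g - nbSum G f g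

lemma lapl_eq_nbSum (G : SimpleGraph S) (f : S → ℝ) (g : S) :
    lapl G f g = nbSum G (fun g' => f g - f g') g := by
  rw [nbSum_sub, nbSum_const, lapl]; ring

lemma sum_lapl (G : SimpleGraph S) (f : S → ℝ) : ∑ g, lapl G f g = 0 := by
  have := sum_nbSum_mul G f (fun _ => 1)
  simp only [mul_one] at this
  simp only [lapl, Finset.sum_sub_distrib, this, degR, mul_comm, sub_self]

lemma sum_sq_diff (G : SimpleGraph S) (f : S → ℝ) :
    ∑ g, nbSum G (fun g' => (f g' - f g) ^ 2) g = 2 * ∑ g, f g * lapl G f g := by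
  have h1 : ∀ g, nbSum G (fun g' => (f g' - f g) ^ 2) g
      = nbSum G (fun g' => f g' ^ 2) g * 1 - 2 * (f g * nbSum G f g) + f g ^ 2 * degR G g := by
    intro g
    rw [show (fun g' => (f g' - f g) ^ 2) = fun g' => (f g' ^ 2 - (2 * f g) * f g') + f g ^ 2 by
      funext g'; ring]
    rw [nbSum_add, nbSum_sub, nbSum_const_mul, nbSum_const]
    ring
  simp only [h1, Finset.sum_add_distrib, Finset.sum_sub_distrib, lapl]
  rw [sum_nbSum_mul G (fun g => f g ^ 2) (fun _ => 1), Finset.mul_sum, ← Finset.sum_sub_distrib,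
    ← Finset.sum_add_distrib]
  refine Finset.sum_congr rfl fun g _ => ?_
  rw [degR]; ring

lemma sq_nbSum_le (G : SimpleGraph S) (f : S → ℝ) (g : S) :
    nbSum G f g ^ 2 ≤ degR G g * nbSum G (fun g' => f g' ^ 2) g := by
  classical
  simp only [nbSum, degR, ← Finset.sum_filter]
  have := Finset.sum_mul_sq_le_sq_mul_sq (Finset.univ.filter (G.Adj g)) (fun _ => (1 : ℝ)) f
  simpa using this

/-- Cauchy–Schwarz at each vertex reduces this to squared differences along edges. It encodes that
the eigenvalues of the Laplacian are at most `2 * d`, and spares a diagonalization. -/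
lemma sum_lapl_sq_le (G : SimpleGraph S) {d : ℝ} (hd : ∀ g, degR G g ≤ d) (f : S → ℝ) :
    ∑ g, lapl G f g ^ 2 ≤ 2 * d * ∑ g, f g * lapl G f g := by
  rw [mul_comm 2 d, mul_assoc, ← sum_sq_diff, Finset.mul_sum]
  refine Finset.sum_le_sum fun g _ => ?_
  rw [lapl_eq_nbSum]
  refine (sq_nbSum_le G _ g).trans ?_
  have : (fun g' => (f g - f g') ^ 2) = fun g' => (f g' - f g) ^ 2 := by funext g'; ring
  rw [this]
  exact mul_le_mul_of_nonneg_right (hd g) (nbSum_nonneg G (fun g' => sq_nonneg _) g)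

/-- The `ℓ²` norm on functions on the base. -/
def l2norm (f : S → ℝ) : ℝ := ‖WithLp.toLp 2 f‖

lemma l2norm_sq (f : S → ℝ) : l2norm f ^ 2 = ∑ g, f g ^ 2 := by
  rw [l2norm, EuclideanSpace.norm_sq_eq]; simp

lemma l2norm_nonneg (f : S → ℝ) : 0 ≤ l2norm f := norm_nonneg _

lemma l2norm_add_le (f f' : S → ℝ) : l2norm (fun g => f g + f' g) ≤ l2norm f + l2norm f' :=
  norm_add_le (WithLp.toLp 2 f) (WithLp.toLp 2 f')

lemma l2norm_div (f : S → ℝ) {c : ℝ} (hc : 0 < c) :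
    l2norm (fun g => f g / c) = l2norm f / c := by
  have h : (WithLp.toLp 2 fun g => f g / c) = c⁻¹ • WithLp.toLp 2 f := by
    ext g; simp [div_eq_inv_mul]
  rw [l2norm, h, norm_smul, l2norm, Real.norm_of_nonneg (by positivity)]
  ring

lemma abs_le_l2norm (f : S → ℝ) (g : S) : |f g| ≤ l2norm f := by
  refine abs_le_of_sq_le_sq ?_ (l2norm_nonneg f)
  rw [l2norm_sq]
  exact Finset.single_le_sum (f := fun g => f g ^ 2) (fun g _ => sq_nonneg _) (Finset.mem_univ g)

/-- The function supported on level `z₀` where it is given by `f`. -/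
def levelFun (f : S → ℝ) (z₀ : ℤ) : S × ℤ → ℝ := fun x => f x.1 * delta z₀ x.2

lemma lazyOp_nonneg {G : SimpleGraph S} {M : ℝ} (hM0 : 0 < M)
    (hM : ∀ g, degR G g + 2 ≤ M) (f : S × ℤ → ℝ) (hf : ∀ x, 0 ≤ f x) (x : S × ℤ) :
    0 ≤ lazyOp G M f x := by
  rw [lazyOp_apply]
  have h1 : (degR G x.1 + 2) / M ≤ 1 := (div_le_one hM0).2 (hM _)
  have := mul_nonneg (hf x) (by linarith : (0 : ℝ) ≤ 1 - (degR G x.1 + 2) / M)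
  have := div_nonneg (cylSum_nonneg G hf x) hM0.le
  linarith

lemma lazyOp_pow_mono {G : SimpleGraph S} {M : ℝ} (hM0 : 0 < M)
    (hM : ∀ g, degR G g + 2 ≤ M) {f f' : S × ℤ → ℝ} (h : ∀ x, f x ≤ f' x) (n : ℕ) (x : S × ℤ) :
    (lazyOp G M ^ n) f x ≤ (lazyOp G M ^ n) f' x := by
  induction n generalizing x with
  | zero => simpa using h x
  | succ n ih =>
    simp only [pow_succ', Module.End.mul_apply]
    have := lazyOp_nonneg hM0 hM ((lazyOp G M ^ n) f' - (lazyOp G M ^ n) f)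
      (fun y => by simpa using ih y) x
    rw [map_sub] at this
    simpa using this

/-- On functions of the height only, the lazy walk on the cylinder acts as the one on `ℤ`. -/
lemma lazyOp_pow_height (G : SimpleGraph S) {M : ℝ} (hM0 : 0 < M) (r : ℤ → ℝ) (n : ℕ)
    (x : S × ℤ) : (lazyOp G M ^ n) (fun x => r x.2) x = (lazyZ M ^ n) r x.2 := by
  induction n generalizing x with
  | zero => simp
  | succ n ih =>
    simp only [pow_succ', Module.End.mul_apply]
    rw [show (lazyOp G M ^ n) (fun x => r x.2) = fun x => (lazyZ M ^ n) r x.2 from funext ih,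
      lazyOp_apply, lazyZ_apply, cylSum]
    simp only [nbSum_const]
    field_simp
    ring

/-- Contraction of functions which have mean zero on every level. -/
lemma lazyOp_pow_meanZero {G : SimpleGraph S} {d M lam : ℝ}
    (hd : ∀ g, degR G g ≤ d) (hd0 : 0 ≤ d) (hM : 2 * (d + 2) ≤ M) (hlam : 0 ≤ lam)
    (hlamM : lam ≤ M)
    (hgap : ∀ f : S → ℝ, ∑ g, f g = 0 → lam * ∑ g, f g ^ 2 ≤ ∑ g, f g * lapl G f g)
    {φ : S × ℤ → ℝ} {R : ℝ} (hφ : ∀ z, ∑ g, φ (g, z) = 0)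
    (hR : ∀ z, l2norm (fun g => φ (g, z)) ≤ R) (n : ℕ) :
    (∀ z, ∑ g, (lazyOp G M ^ n) φ (g, z) = 0) ∧
      ∀ z, l2norm (fun g => (lazyOp G M ^ n) φ (g, z)) ≤ (1 - lam / (2 * M)) ^ n * R := by
  have hM0 : 0 < M := by linarith
  induction n with
  | zero => simpa using ⟨hφ, hR⟩
  | succ n ih =>
    obtain ⟨ih1, ih2⟩ := ih
    set ψ := (lazyOp G M ^ n) φ with hψ
    have hstep : ∀ z g, (lazyOp G M ^ (n + 1)) φ (g, z) =
        (ψ (g, z) * (1 - 2 / M) - lapl G (fun g => ψ (g, z)) g / M)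
          + ((ψ (g, z + 1) / M) + ψ (g, z - 1) / M) := by
      intro z g
      rw [pow_succ', Module.End.mul_apply, lazyOp_apply, cylSum, lapl]
      field_simp
      ring
    have hx : lam / (2 * M) ≤ 1 / 2 := by
      rw [div_le_div_iff₀ (by positivity) (by norm_num)]; linarith
    have hx0 : 0 ≤ lam / (2 * M) := by positivity
    have hα : 2 / M ≤ 1 / 2 := by
      rw [div_le_div_iff₀ (by positivity) (by norm_num)]; linarith
    refine ⟨fun z => ?_, fun z => ?_⟩
    · simp only [hstep, Finset.sum_add_distrib, Finset.sum_sub_distrib, ← Finset.sum_mul,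
        ← Finset.sum_div, ih1, sum_lapl]
      simp
    -- The part that stays on the level contracts by the spectral gap; the moves up and down, of
    -- total weight `2 / M`, only carry over the induction bound.
    · have hmid : l2norm (fun g => ψ (g, z) * (1 - 2 / M) - lapl G (fun g => ψ (g, z)) g / M)
          ≤ (1 - 2 / M - lam / (2 * M)) * l2norm (fun g => ψ (g, z)) := by
        refine le_of_sq_le_sq ?_ (mul_nonneg (by linarith) (l2norm_nonneg _))
        rw [mul_pow, l2norm_sq, l2norm_sq]
        set f : S → ℝ := fun g => ψ (g, z) with hf
        have e : ∑ g, (f g * (1 - 2 / M) - lapl G f g / M) ^ 2 = (1 - 2 / M) ^ 2 * ∑ g, f g ^ 2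
            - 2 * (1 - 2 / M) / M * ∑ g, f g * lapl G f g + (∑ g, lapl G f g ^ 2) / M ^ 2 := by
          rw [Finset.mul_sum, Finset.mul_sum, Finset.sum_div, ← Finset.sum_sub_distrib,
            ← Finset.sum_add_distrib]
          refine Finset.sum_congr rfl fun g _ => ?_
          ring
        change ∑ g, (f g * (1 - 2 / M) - lapl G f g / M) ^ 2 ≤ _
        rw [e]
        have h1 := sum_lapl_sq_le G hd f
        have h2 := hgap f (ih1 z)
        have h0 : 0 ≤ ∑ g, f g ^ 2 := Finset.sum_nonneg fun g _ => sq_nonneg _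
        have h3 : 0 ≤ ∑ g, f g * lapl G f g := le_trans (mul_nonneg hlam h0) h2
        have h4 : (∑ g, lapl G f g ^ 2) / M ^ 2 ≤ 2 * d / M ^ 2 * ∑ g, f g * lapl G f g := by
          rw [div_mul_eq_mul_div]; gcongr
        -- Laziness, `M ≥ 2 * (d + 2)`, keeps half of the first-order gain `2 / M` after paying for
        -- the quadratic term.
        have h5 : 1 / M ≤ 2 * (1 - 2 / M) / M - 2 * d / M ^ 2 := by
          have : 2 * (1 - 2 / M) / M - 2 * d / M ^ 2 - 1 / M = (M - 2 * (d + 2)) / M ^ 2 := by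
            field_simp
            ring
          have := div_nonneg (by linarith : 0 ≤ M - 2 * (d + 2)) (by positivity : 0 ≤ M ^ 2)
          linarith
        have h6 : 1 / M * ∑ g, f g * lapl G f g ≤
            (2 * (1 - 2 / M) / M - 2 * d / M ^ 2) * ∑ g, f g * lapl G f g :=
          mul_le_mul_of_nonneg_right h5 h3
        have h7 : 1 / M * (lam * ∑ g, f g ^ 2) ≤ 1 / M * ∑ g, f g * lapl G f g :=
          mul_le_mul_of_nonneg_left h2 (by positivity)
        have h8 : ((1 - 2 / M) ^ 2 - lam / M) * ∑ g, f g ^ 2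
            ≤ (1 - 2 / M - lam / (2 * M)) ^ 2 * ∑ g, f g ^ 2 := by
          refine mul_le_mul_of_nonneg_right ?_ h0
          have : lam / M = 2 * (lam / (2 * M)) := by field_simp
          rw [this]
          have : 0 ≤ 2 / M := by positivity
          nlinarith
        have h9 : 1 / M * (lam * ∑ g, f g ^ 2) = lam / M * ∑ g, f g ^ 2 := by ring
        nlinarith
      simp only [hstep]
      refine (l2norm_add_le _ _).trans ?_
      have hside := l2norm_add_le (fun g => ψ (g, z + 1) / M) (fun g => ψ (g, z - 1) / M)
      rw [l2norm_div _ hM0, l2norm_div _ hM0] at hside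
      have hp := ih2 (z + 1)
      have hm := ih2 (z - 1)
      have h0 := ih2 z
      set X := (1 - lam / (2 * M)) ^ n * R
      have hp' := div_le_div_of_nonneg_right hp hM0.le
      have hm' := div_le_div_of_nonneg_right hm hM0.le
      have h0' := mul_le_mul_of_nonneg_left h0
        (by linarith : (0 : ℝ) ≤ 1 - 2 / M - lam / (2 * M))
      rw [pow_succ, mul_right_comm]
      change _ ≤ X * _
      have : X * (1 - lam / (2 * M)) = (1 - 2 / M - lam / (2 * M)) * X + (X / M + X / M) := by
        field_simp; ring
      linarith

lemma lazyZ_pow_delta_nonneg {M : ℝ} (hM : 2 ≤ M) (z₀ : ℤ) (n : ℕ) (z : ℤ) :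
    0 ≤ (lazyZ M ^ n) (delta z₀) z := by
  induction n generalizing z with
  | zero => simp only [pow_zero, Module.End.one_apply, delta]; split_ifs <;> norm_num
  | succ n ih => rw [pow_succ', Module.End.mul_apply]; exact lazyZ_nonneg hM _ ih z

lemma lazyOp_pow_levelFun_const (G : SimpleGraph S) {M : ℝ} (hM0 : 0 < M) (c : ℝ) (z₀ : ℤ)
    (n : ℕ) (x : S × ℤ) :
    (lazyOp G M ^ n) (levelFun (fun _ => c) z₀) x = c * (lazyZ M ^ n) (delta z₀) x.2 := by
  have : (levelFun (fun _ => c) z₀ : S × ℤ → ℝ) = c • fun x : S × ℤ => delta z₀ x.2 := rfl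
  rw [this, map_smul, Pi.smul_apply, lazyOp_pow_height G hM0, smul_eq_mul]

/-- Centering does not increase the `ℓ²` norm, and `ℓ²` is at most `ℓ¹`. -/
lemma l2norm_sub_mean_le [Nonempty S] {f : S → ℝ} (hf : ∀ g, 0 ≤ f g) :
    l2norm (fun g => f g - uniformMean f) ≤ ∑ g, f g := by
  have hN : (0 : ℝ) < Fintype.card S := by exact_mod_cast Fintype.card_pos
  refine le_of_sq_le_sq ?_ (Finset.sum_nonneg fun g _ => hf g)
  rw [l2norm_sq]
  have e : ∑ g, (f g - uniformMean f) ^ 2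
      = ∑ g, f g ^ 2 - uniformMean f * ∑ g, f g := by
    have h1 : ∑ g, f g = Fintype.card S * uniformMean f := by rw [uniformMean]; field_simp
    have : ∑ g, (f g - uniformMean f) ^ 2 = ∑ g, f g ^ 2 - 2 * uniformMean f * ∑ g, f g
        + Fintype.card S * uniformMean f ^ 2 := by
      rw [Finset.mul_sum, ← Finset.sum_sub_distrib, ← nsmul_eq_mul, Fintype.card,
        ← Finset.sum_const, ← Finset.sum_add_distrib]
      exact Finset.sum_congr rfl fun g _ => by ring
    rw [this, h1]; ring
  rw [e]
  have h2 : 0 ≤ uniformMean f := div_nonneg (Finset.sum_nonneg fun g _ => hf g) hN.le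
  have h3 := mul_nonneg h2 (Finset.sum_nonneg fun g (_ : g ∈ Finset.univ) => hf g)
  have h4 := Finset.sum_sq_le_sq_sum_of_nonneg (s := Finset.univ) (f := f) fun g _ => hf g
  linarith

lemma sum_geometric_tail_le {τ : ℝ} (h0 : 0 ≤ τ) (h1 : τ < 1) (n₀ J : ℕ) :
    ∑ n ∈ Finset.range J, (if n₀ ≤ n then τ ^ n else 0) ≤ τ ^ n₀ / (1 - τ) := by
  rw [le_div_iff₀ (by linarith)]
  have key : (∑ n ∈ Finset.range J, (if n₀ ≤ n then τ ^ n else 0)) * (1 - τ)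
      + (if n₀ ≤ J then τ ^ J else τ ^ n₀) ≤ τ ^ n₀ := by
    induction J with
    | zero =>
      split_ifs with h
      · simp [Nat.le_zero.1 h]
      · simp
    | succ J ih =>
      rw [Finset.sum_range_succ, add_mul]
      by_cases h : n₀ ≤ J
      · rw [if_pos h] at ih ⊢
        rw [if_pos (h.trans (Nat.le_succ J)), pow_succ]
        linarith
      · rw [if_neg h] at ih ⊢
        split_ifs with h'
        · rw [show J + 1 = n₀ by omega]; linarith
        · linarith
  have : 0 ≤ (if n₀ ≤ J then τ ^ J else τ ^ n₀) := by split_ifs <;> positivity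
  linarith

/-- Upper bound on the potential of a charge carried by one level of the cylinder: the first term
bounds the time before mixing of the base component, the others the time after it. -/
theorem levelFun_potential_partial_le [Nonempty S] {G : SimpleGraph S} {d M lam : ℝ}
    (hd : ∀ g, degR G g ≤ d) (hd0 : 0 ≤ d) (hM : 2 * (d + 2) ≤ M) (hlam : 0 < lam)
    (hlamM : lam ≤ M)
    (hgap : ∀ f : S → ℝ, ∑ g, f g = 0 → lam * ∑ g, f g ^ 2 ≤ ∑ g, f g * lapl G f g)
    {f : S → ℝ} {F : ℝ} (hf : ∀ g, 0 ≤ f g) (hF : ∀ g, f g ≤ F) {ε ε₀ : ℝ} {n₀ : ℕ}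
    (hε : 0 < ε) (hε2 : ε ≤ 1 / 2) (hε₀ : 0 < ε₀) (hε₀2 : ε₀ ≤ 1 / 2)
    (hn₀ : n₀ * ε₀ ^ 2 ≤ 1 / 2) (z₀ : ℤ) (J : ℕ) (x : S × ℤ) :
    ∑ n ∈ Finset.range J, (1 - ε ^ 2) ^ n * (lazyOp G M ^ n) (levelFun f z₀) x
      ≤ 2 * F * (M / ε₀ * (1 - ε₀) ^ (x.2 - z₀).natAbs)
        + uniformMean f * (M / ε)
        + (∑ g, f g) * ((1 - lam / (2 * M)) ^ n₀ * (2 * M / lam)) := by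
  have hM0 : 0 < M := by linarith
  have hM4 : 4 ≤ M := by linarith
  have hdM : ∀ g, degR G g + 2 ≤ M := fun g => by linarith [hd g]
  have hN : (0 : ℝ) < Fintype.card S := by exact_mod_cast Fintype.card_pos
  have hS : 0 ≤ ∑ g, f g := Finset.sum_nonneg fun g _ => hf g
  have hF0 : 0 ≤ F := (hf (Classical.arbitrary S)).trans (hF _)
  have hm : 0 ≤ uniformMean f := div_nonneg hS hN.le
  have hs0 : 0 ≤ 1 - ε ^ 2 := by nlinarith
  have hs1 : 1 - ε ^ 2 ≤ 1 := by nlinarith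
  have hs00 : 0 ≤ 1 - ε₀ ^ 2 := by nlinarith
  have hx : lam / (2 * M) ≤ 1 / 2 := by
    rw [div_le_div_iff₀ (by positivity) (by norm_num)]; linarith
  have hx0 : 0 < lam / (2 * M) := by positivity
  -- Before `n₀` the base is forgotten: `f` is replaced by `F` and only the height is followed. From
  -- `n₀` on, `f` is replaced by its mean, and the centered part is paid for by contraction.
  have hterm : ∀ n, (1 - ε ^ 2) ^ n * (lazyOp G M ^ n) (levelFun f z₀) x
      ≤ 2 * F * ((1 - ε₀ ^ 2) ^ n * (lazyZ M ^ n) (delta z₀) x.2)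
        + uniformMean f * ((1 - ε ^ 2) ^ n * (lazyZ M ^ n) (delta z₀) x.2)
        + (∑ g, f g) * (if n₀ ≤ n then (1 - lam / (2 * M)) ^ n else 0) := by
    intro n
    have hδ := lazyZ_pow_delta_nonneg (by linarith : 2 ≤ M) z₀ n x.2
    have hsn : (1 - ε ^ 2) ^ n ≤ 1 := pow_le_one₀ hs0 hs1
    have hsn0 : 0 ≤ (1 - ε ^ 2) ^ n := pow_nonneg hs0 n
    have hA : 0 ≤ 2 * F * ((1 - ε₀ ^ 2) ^ n * (lazyZ M ^ n) (delta z₀) x.2) := by positivity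
    have hB : 0 ≤ uniformMean f * ((1 - ε ^ 2) ^ n * (lazyZ M ^ n) (delta z₀) x.2) := by
      positivity
    split_ifs with hn
    · have hdec : levelFun f z₀ = levelFun (fun _ => uniformMean f) z₀
          + levelFun (fun g => f g - uniformMean f) z₀ := by
        ext y; simp [levelFun]; ring
      have hsum0 : ∑ g, (f g - uniformMean f) = 0 := by
        rw [Finset.sum_sub_distrib, Finset.sum_const, Finset.card_univ, nsmul_eq_mul, uniformMean]
        field_simp
        ring
      have hc := (lazyOp_pow_meanZero hd hd0 hM hlam.le hlamM hgap
        (φ := levelFun (fun g => f g - uniformMean f) z₀) (R := ∑ g, f g)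
        (fun z => by simp only [levelFun, ← Finset.sum_mul, hsum0, zero_mul])
        (fun z => by
          by_cases hz : z = z₀
          · simpa [levelFun, delta, hz] using l2norm_sub_mean_le hf
          · have : l2norm (fun _ : S => (0 : ℝ)) = 0 := by
              simpa using l2norm_sq (fun _ : S => (0 : ℝ))
            simpa [levelFun, delta, hz, this] using hS) n).2 x.2
      have hc' := (le_abs_self _).trans ((abs_le_l2norm _ x.1).trans hc)
      rw [hdec, map_add, Pi.add_apply, lazyOp_pow_levelFun_const G hM0]
      have h0 : 0 ≤ (1 - lam / (2 * M)) ^ n * ∑ g, f g :=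
        mul_nonneg (pow_nonneg (by linarith) n) hS
      have h1 : (1 - ε ^ 2) ^ n * (lazyOp G M ^ n) (levelFun (fun g => f g - uniformMean f) z₀) x
          ≤ (1 - lam / (2 * M)) ^ n * ∑ g, f g :=
        (mul_le_mul_of_nonneg_left hc' hsn0).trans (mul_le_of_le_one_left h0 hsn)
      linarith
    · have h1 : (lazyOp G M ^ n) (levelFun f z₀) x
          ≤ F * (lazyZ M ^ n) (delta z₀) x.2 := by
        rw [← lazyOp_pow_levelFun_const G hM0]
        refine lazyOp_pow_mono hM0 hdM (fun y => ?_) n x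
        unfold levelFun delta
        split_ifs
        · simpa using hF y.1
        · simp
      -- By Bernoulli's inequality, introducing killing at rate `ε₀ ^ 2` up to time `n₀` costs a
      -- factor 2, whence `2 * F`; it lets the short-time sum be bounded by a resolvent with
      -- parameter `ε₀`.
      have h2 : (1 : ℝ) / 2 ≤ (1 - ε₀ ^ 2) ^ n := by
        have hb := one_add_mul_le_pow (a := -ε₀ ^ 2) (by nlinarith) n
        have hnn : (n : ℝ) ≤ n₀ := by exact_mod_cast (not_le.1 hn).le
        have := mul_le_mul_of_nonneg_right hnn (sq_nonneg ε₀)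
        rw [← sub_eq_add_neg] at hb
        calc (1 : ℝ) / 2 ≤ 1 + n * -ε₀ ^ 2 := by linarith
          _ ≤ _ := by convert hb using 2
      have h3 := mul_le_mul_of_nonneg_left h1 hsn0
      have h4 : 0 ≤ F * (lazyZ M ^ n) (delta z₀) x.2 := by positivity
      have h5 := mul_le_of_le_one_left h4 hsn
      have h6 := mul_le_mul_of_nonneg_right h2 h4
      linarith
  refine (Finset.sum_le_sum fun n _ => hterm n).trans ?_
  rw [Finset.sum_add_distrib, Finset.sum_add_distrib, ← Finset.mul_sum, ← Finset.mul_sum,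
    ← Finset.mul_sum]
  have e1 := lazyZ_potential_le hM4 hε₀ hε₀2 z₀ J x.2
  have e2 := lazyZ_potential_le hM4 hε hε2 z₀ J x.2
  have e3 := sum_geometric_tail_le (τ := 1 - lam / (2 * M)) (by linarith) (by linarith) n₀ J
  have e4 : (1 - ε) ^ (x.2 - z₀).natAbs ≤ 1 := pow_le_one₀ (by linarith) (by linarith)
  have e5 : M / ε * (1 - ε) ^ (x.2 - z₀).natAbs ≤ M / ε :=
    mul_le_of_le_one_right (by positivity) e4
  have e6 : (1 - lam / (2 * M)) ^ n₀ / (1 - (1 - lam / (2 * M)))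
      = (1 - lam / (2 * M)) ^ n₀ * (2 * M / lam) := by
    rw [sub_sub_cancel, div_eq_mul_inv, inv_div]
  rw [e6] at e3
  gcongr
  exact e2.trans e5

/-! ### Hitting probabilities in terms of potentials -/

variable {S : Type*} [Fintype S]

/-- The potential `∑ sⁿ Qⁿ φ` of the charge `φ` for the lazy walk killed at rate `1 - s`. -/
def potential (G : SimpleGraph S) (M s : ℝ) (φ : S × ℤ → ℝ) (x : S × ℤ) : ℝ :=
  ∑' n, s ^ n * (lazyOp G M ^ n) φ x

section Potential

variable {G : SimpleGraph S} {M s : ℝ} {φ β : S × ℤ → ℝ} (hM0 : 0 < M)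
  (hM : ∀ g, degR G g + 2 ≤ M) (hs : 0 ≤ s) (hφ : ∀ x, 0 ≤ φ x)
  (hβ : ∀ J x, ∑ n ∈ Finset.range J, s ^ n * (lazyOp G M ^ n) φ x ≤ β x)

include hM0 hM hs hφ

lemma potential_term_nonneg (x : S × ℤ) (n : ℕ) : 0 ≤ s ^ n * (lazyOp G M ^ n) φ x := by
  have := lazyOp_pow_mono hM0 hM (f := 0) (f' := φ) hφ n x
  rw [map_zero] at this
  exact mul_nonneg (pow_nonneg hs n) this

lemma potential_nonneg (x : S × ℤ) : 0 ≤ potential G M s φ x :=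
  tsum_nonneg (potential_term_nonneg hM0 hM hs hφ x)

include hβ

lemma potential_le (x : S × ℤ) : potential G M s φ x ≤ β x :=
  Real.tsum_le_of_sum_range_le (potential_term_nonneg hM0 hM hs hφ x) fun J => hβ J x

lemma hasSum_potential (x : S × ℤ) :
    HasSum (fun n => s ^ n * (lazyOp G M ^ n) φ x) (potential G M s φ x) :=
  (summable_of_sum_range_le (potential_term_nonneg hM0 hM hs hφ x) fun J => hβ J x).hasSum

/-- The resolvent equation, by shifting the summation index; it makes potentials of nonnegative
charges supersolutions. -/
lemma potential_eq (x : S × ℤ) :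
    potential G M s φ x = φ x + s * lazyOp G M (potential G M s φ) x := by
  have hh := hasSum_potential hM0 hM hs hφ hβ
  have h1 : HasSum (fun n => lazyOp G M (fun y => s ^ n * (lazyOp G M ^ n) φ y) x)
      (lazyOp G M (potential G M s φ) x) := by
    simp only [lazyOp_apply, cylSum, nbSum]
    refine ((hh _).mul_right _).add ((((hasSum_sum fun g' _ => ?_).add (hh _)).add
      (hh _)).div_const _)
    split_ifs
    · exact hh _
    · exact hasSum_zero
  have h2 : HasSum (fun n => s ^ (n + 1) * (lazyOp G M ^ (n + 1)) φ x)
      (s * lazyOp G M (potential G M s φ) x) := by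
    refine (h1.mul_left s).congr_fun fun n => ?_
    have : (fun y => s ^ n * (lazyOp G M ^ n) φ y) = s ^ n • (lazyOp G M ^ n) φ := rfl
    rw [this, map_smul, Pi.smul_apply, smul_eq_mul, ← Module.End.mul_apply, ← pow_succ', pow_succ']
    ring
  have h3 := (hasSum_nat_add_iff (f := fun n => s ^ n * (lazyOp G M ^ n) φ x) 1).1 h2
  rw [(hh x).unique h3]
  simp [add_comm]

end Potential

variable [MeasurableSpace S] [MeasurableSingletonClass S]

/-- A function which is superharmonic for the killed lazy walk bounds the probability to hit `C`
before time `T`. -/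
lemma walkLaw_hit_le {G : SimpleGraph S} {M ε : ℝ} {T : ℕ} (hM0 : 0 < M)
    (hε2 : ε ≤ 1 / 2) (hε : 0 ≤ ε) (hT : T * (2 * M * ε ^ 2) ≤ 1 / 2) (hT1 : 1 ≤ T)
    {C : Set (S × ℤ)} {Ψ : S × ℤ → ℝ}
    (h0 : ∀ x, 0 ≤ Ψ x) (h1 : ∀ x ∈ C, 1 ≤ Ψ x)
    (hΨ : ∀ x ∉ C, (1 - ε ^ 2) * lazyOp G M Ψ x ≤ Ψ x) (x : S × ℤ) :
    (walkLaw (cylinderGraph G) x).real {ω | ∃ n < T, ω n ∈ C} ≤ 2 * Ψ x := by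
  -- Killing at rate `ε ^ 2` per lazy step is dominated by discounting at rate `κ` per step of the
  -- walk, and `T * κ ≤ 1 / 2` limits the total discount to a factor 2.
  set κ := 2 * M * ε ^ 2 with hκ
  have hκ0 : 0 ≤ κ := by positivity
  have hT1' : (1 : ℝ) ≤ T := by exact_mod_cast hT1
  have hκ1 : κ ≤ 1 / 2 := by nlinarith
  have key := pow_mul_walkLaw_hitWithin_le G (C := C) (B := Set.univ) (r := 1 - κ) (by linarith)
    (by linarith) h0 (fun x hx _ => h1 x hx) (fun x _ hx => ?_) T x
  · have hset : {ω : ℕ → S × ℤ | ∃ n < T, ω n ∈ C} = hitWithin C Set.univ T := by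
      ext ω; simp [hitWithin]
    rw [hset]
    have hb := one_add_mul_le_pow (a := -κ) (by linarith) T
    rw [← sub_eq_add_neg] at hb
    have h2 : (1 : ℝ) / 2 ≤ (1 - κ) ^ T := by linarith
    have := mul_le_mul_of_nonneg_right h2
      (measureReal_nonneg (μ := walkLaw (cylinderGraph G) x) (s := hitWithin C Set.univ T))
    linarith
  · have h := hΨ x hx
    rw [lazyOp_apply] at h
    have hs : (3 : ℝ) / 4 ≤ 1 - ε ^ 2 := by nlinarith
    have hd := degR_nonneg G x.1
    have hc := cylSum_nonneg G h0 x
    have hΨx := h0 x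
    set c := cylSum G Ψ x
    set D := degR G x.1 + 2
    have hD : 2 ≤ D := by simp only [D]; linarith
    have e1 : (1 - ε ^ 2) * (Ψ x * (1 - D / M) + c / M) * M
        = (1 - ε ^ 2) * (Ψ x * (M - D) + c) := by field_simp
    have h' : (1 - ε ^ 2) * (Ψ x * (M - D) + c) ≤ Ψ x * M := by
      rw [← e1]; exact mul_le_mul_of_nonneg_right h hM0.le
    have h2 : (1 - ε ^ 2) * (c - Ψ x * D) ≤ M * ε ^ 2 * Ψ x := by linarith
    have h3 : c ≤ Ψ x * (D + κ) := by
      by_contra hcon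
      rw [not_le] at hcon
      have h4 : Ψ x * κ < c - Ψ x * D := by linarith
      have h5 : (1 : ℝ) / 2 * (Ψ x * κ) ≤ (1 - ε ^ 2) * (Ψ x * κ) :=
        mul_le_mul_of_nonneg_right (by linarith) (by positivity)
      have h6 := mul_lt_mul_of_pos_left h4 (by linarith : (0 : ℝ) < 1 - ε ^ 2)
      have h7 : (1 : ℝ) / 2 * (Ψ x * κ) = M * ε ^ 2 * Ψ x := by rw [hκ]; ring
      linarith
    calc (1 - κ) * c ≤ (1 - κ) * (Ψ x * (D + κ)) :=
          mul_le_mul_of_nonneg_left h3 (by linarith)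
      _ = Ψ x * (D - κ * (D - 1 + κ)) := by ring
      _ ≤ Ψ x * D := by
          refine mul_le_mul_of_nonneg_left ?_ hΨx
          have := mul_nonneg hκ0 (by linarith : 0 ≤ D - 1 + κ)
          linarith

lemma levelFun_nonneg {f : S → ℝ} (hf : ∀ g, 0 ≤ f g) (z₀ : ℤ) (x : S × ℤ) :
    0 ≤ levelFun f z₀ x := by
  unfold levelFun delta
  split_ifs
  · simpa using hf x.1
  · simp

/-- Spectral data on the base, and time scales, used to bound potentials. -/
structure MixingData (G : SimpleGraph S) (d M lam ε ε₀ : ℝ) (n₀ T : ℕ) : Prop where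
  deg_le : ∀ g, degR G g ≤ d
  d_nonneg : 0 ≤ d
  le_M : 2 * (d + 2) ≤ M
  lam_pos : 0 < lam
  lam_le : lam ≤ M
  gap : ∀ f : S → ℝ, ∑ g, f g = 0 → lam * ∑ g, f g ^ 2 ≤ ∑ g, f g * lapl G f g
  eps_pos : 0 < ε
  eps_le : ε ≤ 1 / 2
  eps₀_pos : 0 < ε₀
  eps₀_le : ε₀ ≤ 1 / 2
  n₀_le : n₀ * ε₀ ^ 2 ≤ 1 / 2
  T_le : T * (2 * M * ε ^ 2) ≤ 1 / 2
  one_le_T : 1 ≤ T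

namespace MixingData

variable {G : SimpleGraph S} {d M lam ε ε₀ : ℝ} {n₀ T : ℕ} (D : MixingData G d M lam ε ε₀ n₀ T)

include D

lemma M_pos : 0 < M := by linarith [D.le_M, D.d_nonneg]

lemma deg_le_M (g : S) : degR G g + 2 ≤ M := by linarith [D.deg_le g, D.le_M, D.d_nonneg]

lemma s_nonneg : 0 ≤ 1 - ε ^ 2 := by nlinarith [D.eps_pos, D.eps_le]

lemma levelFun_potential_le [Nonempty S] {f : S → ℝ} {F : ℝ} (hf : ∀ g, 0 ≤ f g)
    (hF : ∀ g, f g ≤ F) (z₀ : ℤ) (x : S × ℤ) :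
    potential G M (1 - ε ^ 2) (levelFun f z₀) x
      ≤ 2 * F * (M / ε₀ * (1 - ε₀) ^ (x.2 - z₀).natAbs)
        + uniformMean f * (M / ε)
        + (∑ g, f g) * ((1 - lam / (2 * M)) ^ n₀ * (2 * M / lam)) :=
  potential_le D.M_pos D.deg_le_M D.s_nonneg (levelFun_nonneg hf z₀)
    (fun J x => levelFun_potential_partial_le D.deg_le D.d_nonneg D.le_M D.lam_pos D.lam_le D.gap
      hf hF D.eps_pos D.eps_le D.eps₀_pos D.eps₀_le D.n₀_le z₀ J x) x

lemma levelFun_potential_eq [Nonempty S] {f : S → ℝ} {F : ℝ} (hf : ∀ g, 0 ≤ f g)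
    (hF : ∀ g, f g ≤ F) (z₀ : ℤ) (x : S × ℤ) :
    potential G M (1 - ε ^ 2) (levelFun f z₀) x = levelFun f z₀ x + (1 - ε ^ 2) *
      lazyOp G M (potential G M (1 - ε ^ 2) (levelFun f z₀)) x :=
  potential_eq D.M_pos D.deg_le_M D.s_nonneg (levelFun_nonneg hf z₀)
    (fun J x => levelFun_potential_partial_le D.deg_le D.d_nonneg D.le_M D.lam_pos D.lam_le D.gap
      hf hF D.eps_pos D.eps_le D.eps₀_pos D.eps₀_le D.n₀_le z₀ J x) x

lemma levelFun_potential_nonneg {f : S → ℝ} (hf : ∀ g, 0 ≤ f g) (z₀ : ℤ) (x : S × ℤ) :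
    0 ≤ potential G M (1 - ε ^ 2) (levelFun f z₀) x :=
  potential_nonneg D.M_pos D.deg_le_M D.s_nonneg (levelFun_nonneg hf z₀) x

/-- Hitting a box from a large vertical distance. -/
theorem walkLaw_hit_box_le [Nonempty S] (V : Finset S) (v : ℕ) (u : ℤ) (l : ℕ) (y : S × ℤ)
    (hy : v + l ≤ (y.2 - u).natAbs) :
    (walkLaw (cylinderGraph G) y).real {ω | ∃ n < T, ω n ∈ box V v u}
      ≤ 2 * ((2 * v + 1) * (2 * (M / ε₀ * (1 - ε₀) ^ l) + V.card / Fintype.card S * (M / ε)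
        + V.card * ((1 - lam / (2 * M)) ^ n₀ * (2 * M / lam)))) := by
  classical
  set f : S → ℝ := fun g => if g ∈ V then 1 else 0 with hf
  have hf0 : ∀ g, 0 ≤ f g := fun g => by simp only [hf]; split_ifs <;> norm_num
  have hf1 : ∀ g, f g ≤ 1 := fun g => by simp only [hf]; split_ifs <;> norm_num
  have hfs : ∑ g, f g = V.card := by simp [hf]
  set I := Finset.Icc (u - v) (u + v) with hI
  set U : ℤ → S × ℤ → ℝ := fun z₀ => potential G M (1 - ε ^ 2) (levelFun f z₀) with hU
  -- A unit charge at each point of the box: its potential dominates the charge, hence is at least 1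
  -- on the box, and is a supersolution everywhere.
  set Ψ : S × ℤ → ℝ := ∑ z₀ ∈ I, U z₀ with hΨ
  have hΨx : ∀ x, Ψ x = ∑ z₀ ∈ I, U z₀ x := fun x => by rw [hΨ, Finset.sum_apply]
  have hU0 : ∀ z₀ x, 0 ≤ U z₀ x := fun z₀ x => D.levelFun_potential_nonneg hf0 z₀ x
  have heq : ∀ z₀ x, U z₀ x = levelFun f z₀ x + (1 - ε ^ 2) * lazyOp G M (U z₀) x :=
    fun z₀ x => D.levelFun_potential_eq hf0 hf1 z₀ x
  have hUl : ∀ z₀ x, levelFun f z₀ x ≤ U z₀ x := by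
    intro z₀ x
    have := mul_nonneg D.s_nonneg (lazyOp_nonneg D.M_pos D.deg_le_M (U z₀) (hU0 z₀) x)
    linarith [heq z₀ x]
  refine (walkLaw_hit_le D.M_pos D.eps_le D.eps_pos.le D.T_le D.one_le_T (Ψ := Ψ)
    (fun x => ?_) (fun x hx => ?_) (fun x _ => ?_) y).trans ?_
  · rw [hΨx]; exact Finset.sum_nonneg fun z₀ _ => hU0 z₀ x
  · rw [hΨx]
    obtain ⟨hx1, hx2⟩ := hx
    have hmem : x.2 ∈ I := by
      rw [hI, Finset.mem_Icc]; rw [abs_le] at hx2; omega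
    refine le_trans ?_ (Finset.single_le_sum (fun z₀ _ => hU0 z₀ x) hmem)
    refine le_trans ?_ (hUl x.2 x)
    simp [levelFun, delta, hf, hx1]
  · rw [hΨ, map_sum, Finset.sum_apply, Finset.sum_apply, Finset.mul_sum]
    refine Finset.sum_le_sum fun z₀ _ => ?_
    linarith [heq z₀ x, levelFun_nonneg hf0 z₀ x]
  · refine mul_le_mul_of_nonneg_left ?_ (by norm_num)
    rw [hΨx]
    have hc : (I.card : ℝ) = 2 * v + 1 := by
      rw [hI, Int.card_Icc]
      have : (u + v + 1 - (u - v)).toNat = 2 * v + 1 := by omega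
      rw [this]; push_cast; ring
    rw [← hc, ← nsmul_eq_mul]
    refine Finset.sum_le_card_nsmul _ _ _ fun z₀ hz₀ => ?_
    rw [hI, Finset.mem_Icc] at hz₀
    have hl : l ≤ (y.2 - z₀).natAbs := by omega
    refine (D.levelFun_potential_le hf0 hf1 z₀ y).trans ?_
    rw [uniformMean, hfs]
    have : (1 - ε₀) ^ (y.2 - z₀).natAbs ≤ (1 - ε₀) ^ l :=
      pow_le_pow_of_le_one (by linarith [D.eps₀_le]) (by linarith [D.eps₀_pos]) hl
    have hpos : 0 ≤ M / ε₀ := div_nonneg D.M_pos.le D.eps₀_pos.le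
    have := mul_le_mul_of_nonneg_left this hpos
    linarith

end MixingData

/-! ### Hitting the box through excursions in the slab -/

variable {S : Type*} [Fintype S]

lemma cylSum_shift (G : SimpleGraph S) (f : S × ℤ → ℝ) (u : ℤ) (x : S × ℤ) :
    cylSum G (fun y => f (y.1, y.2 - u)) x = cylSum G f (x.1, x.2 - u) := by
  simp only [cylSum]
  rw [show x.2 + 1 - u = x.2 - u + 1 by ring, show x.2 - 1 - u = x.2 - u - 1 by ring]

variable [MeasurableSpace S] [MeasurableSingletonClass S]

/-- The probability to enter the box before leaving the slab, both centered at height `0`. -/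
def slabProb (G : SimpleGraph S) (V : Finset S) (v h' : ℕ) : S × ℤ → ℝ :=
  hitProb G (box V v 0) (slab S h' 0)

section SlabProb

variable {G : SimpleGraph S} {V : Finset S} {v h' : ℕ}

lemma mem_box_zero {x : S × ℤ} : x ∈ box V v 0 ↔ x.1 ∈ V ∧ x.2.natAbs ≤ v := by
  change x.1 ∈ V ∧ |x.2 - 0| ≤ (v : ℤ) ↔ _
  rw [sub_zero, Int.abs_eq_natAbs]; norm_cast

lemma mem_slab_zero {x : S × ℤ} : x ∈ slab S h' 0 ↔ x.2.natAbs < 2 * h' := by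
  change |x.2 - 0| ≤ 2 * (h' : ℤ) - 1 ↔ _
  rw [sub_zero, Int.abs_eq_natAbs]; omega

lemma slabProb_nonneg (x : S × ℤ) : 0 ≤ slabProb G V v h' x := hitProb_nonneg _ _ _ _

lemma slabProb_le_one (x : S × ℤ) : slabProb G V v h' x ≤ 1 := hitProb_le_one _ _ _ _

lemma slabProb_of_le {x : S × ℤ} (hx : 2 * h' ≤ x.2.natAbs) : slabProb G V v h' x = 0 :=
  hitProb_eq_zero G (by rw [mem_slab_zero]; omega)

lemma slabProb_harmonic {x : S × ℤ} (hC : x ∉ box V v 0) (hx : x.2.natAbs < 2 * h') :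
    cylSum G (slabProb G V v h') x = slabProb G V v h' x * (degR G x.1 + 2) :=
  hitProb_harmonic G hC (mem_slab_zero.2 hx)

/-- The total flux through one end of the slab is bounded by the capacity of the box. -/
lemma sum_slabProb_end_le {d : ℝ} (hd : ∀ g, degR G g ≤ d) (hd0 : 0 ≤ d)
    (hv : v < h') :
    ∑ g, slabProb G V v h' (g, 2 * h' - 1) ≤ (d + 2) * V.card * (2 * v + 1) ∧
      ∑ g, slabProb G V v h' (g, -(2 * h' - 1)) ≤ (d + 2) * V.card * (2 * v + 1) := by
  classical
  set q := slabProb G V v h' with hq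
  set Qs : ℤ → ℝ := fun z => ∑ g, q (g, z) with hQs
  have hQ0 : ∀ z, 0 ≤ Qs z := fun z => Finset.sum_nonneg fun g _ => slabProb_nonneg _
  set κ := (d + 2) * (V.card : ℝ) with hκ
  have hκ0 : 0 ≤ κ := by positivity
  -- Inside the slab, `q` has sources only in the box, of strength at most `d + 2` because `0 ≤ q ≤
  -- 1`.
  have hpt : ∀ g z, z.natAbs < 2 * h' → q (g, z) * (degR G g + 2) - cylSum G q (g, z)
      ≤ if g ∈ V ∧ z.natAbs ≤ v then d + 2 else 0 := by
    intro g z hz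
    split_ifs with h
    · have h1 := slabProb_le_one (G := G) (V := V) (v := v) (h' := h') (g, z)
      have h2 := cylSum_nonneg G (slabProb_nonneg (G := G) (V := V) (v := v) (h' := h')) (g, z)
      have := hd g
      have h3 := mul_le_mul_of_nonneg_right h1 (by linarith [degR_nonneg G g] : 0 ≤ degR G g + 2)
      change q (g, z) * _ ≤ _ at h3
      change 0 ≤ cylSum G q (g, z) at h2
      linarith
    · rw [slabProb_harmonic (fun hc => h (mem_box_zero.1 hc)) hz]
      simp [hq]
  -- Summing over a level removes the Laplacian of the base and leaves the second difference of `Qs`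
  -- in the height.
  have hlev : ∀ z : ℤ, z.natAbs < 2 * h' →
      2 * Qs z - Qs (z + 1) - Qs (z - 1) ≤ if z.natAbs ≤ v then κ else 0 := by
    intro z hz
    have h1 := Finset.sum_le_sum fun g (_ : g ∈ Finset.univ) => hpt g z hz
    have h2 : ∑ g, (q (g, z) * (degR G g + 2) - cylSum G q (g, z))
        = ∑ g, lapl G (fun g => q (g, z)) g + (2 * Qs z - Qs (z + 1) - Qs (z - 1)) := by
      simp only [hQs, Finset.mul_sum, ← Finset.sum_sub_distrib, ← Finset.sum_add_distrib]
      refine Finset.sum_congr rfl fun g _ => ?_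
      simp only [cylSum, lapl]; ring
    rw [h2, sum_lapl, zero_add] at h1
    refine h1.trans ?_
    by_cases hz' : z.natAbs ≤ v
    · exact le_of_eq (by simp [hz', hκ]; ring)
    · simp [hz']
  set m := 4 * h' - 1 with hm
  -- Slopes of `Qs`, telescoped over the `4 * h' - 1` levels of the slab. As `Qs` vanishes at
  -- heights `± 2 * h'`, the two extreme slopes are, up to sign, the end sums to be bounded.
  set Δ : ℕ → ℝ := fun n => Qs ((n : ℤ) - (2 * h' - 1)) - Qs ((n : ℤ) - (2 * h' - 1) - 1) with hΔ
  have hstep : ∀ n ∈ Finset.range m, -(if ((n : ℤ) - (2 * h' - 1)).natAbs ≤ v then κ else 0)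
      ≤ Δ (n + 1) - Δ n := by
    intro n hn
    rw [Finset.mem_range] at hn
    have := hlev ((n : ℤ) - (2 * h' - 1)) (by omega)
    simp only [hΔ]
    rw [show (((n + 1 : ℕ) : ℤ) - (2 * h' - 1)) = (n : ℤ) - (2 * h' - 1) + 1 by push_cast; ring]
    rw [show (n : ℤ) - (2 * h' - 1) + 1 - 1 = (n : ℤ) - (2 * h' - 1) by ring]
    linarith
  have hsum := Finset.sum_le_sum hstep
  rw [Finset.sum_range_sub, Finset.sum_neg_distrib] at hsum
  have hcount : ∑ n ∈ Finset.range m, (if ((n : ℤ) - (2 * h' - 1)).natAbs ≤ v then κ else 0)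
      ≤ κ * (2 * v + 1) := by
    rw [← Finset.sum_filter, Finset.sum_const, nsmul_eq_mul, mul_comm]
    refine mul_le_mul_of_nonneg_left ?_ hκ0
    have hcard : (Finset.filter (fun n : ℕ => ((n : ℤ) - (2 * h' - 1)).natAbs ≤ v)
        (Finset.range m)).card ≤ (Finset.Icc (2 * h' - 1 - v) (2 * h' - 1 + v)).card := by
      refine Finset.card_le_card fun n hn => ?_
      rw [Finset.mem_filter] at hn
      rw [Finset.mem_Icc]
      omega
    rw [Nat.card_Icc] at hcard
    have : (Finset.filter (fun n : ℕ => ((n : ℤ) - (2 * h' - 1)).natAbs ≤ v)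
        (Finset.range m)).card ≤ 2 * v + 1 := by omega
    exact_mod_cast this
  have hz1 : Qs (2 * h') = 0 := Finset.sum_eq_zero fun g _ => slabProb_of_le (by simp; omega)
  have hz2 : Qs (-(2 * h')) = 0 := Finset.sum_eq_zero fun g _ => slabProb_of_le (by simp; omega)
  have e1 : Δ m = -Qs (2 * h' - 1) := by
    simp only [hΔ]
    rw [show ((m : ℤ) - (2 * h' - 1)) = 2 * h' by omega, hz1]; ring
  have e2 : Δ 0 = Qs (-(2 * h' - 1)) := by
    simp only [hΔ]
    rw [show (((0 : ℕ) : ℤ) - (2 * h' - 1) - 1) = -(2 * h') by push_cast; ring, hz2,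
      show (((0 : ℕ) : ℤ) - (2 * h' - 1)) = -(2 * h' - 1) by push_cast; ring]
    ring
  rw [e1, e2] at hsum
  have h1 := hQ0 (2 * h' - 1)
  have h2 := hQ0 (-(2 * h' - 1))
  exact ⟨by linarith, by linarith⟩

/-- Linear decay of the hitting probability between heights `h'` and `2 h'`. -/
lemma slabProb_end_le {F : ℝ} (hv : v < h')
    (hF : ∀ g (z : ℤ), z.natAbs = h' → slabProb G V v h' (g, z) ≤ F) (g : S) (z : ℤ)
    (hz : z.natAbs = 2 * h' - 1) : slabProb G V v h' (g, z) ≤ F / h' := by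
  set q := slabProb G V v h' with hq
  have hq0 : ∀ x, 0 ≤ q x := slabProb_nonneg
  have hF0 : 0 ≤ F := (hq0 (g, h')).trans (hF g h' (by simp))
  have hh : (0 : ℝ) < h' := by exact_mod_cast (by omega : 0 < h')
  set lin : S × ℤ → ℝ := fun x => F / h' * (2 * h' - (x.2.natAbs : ℝ)) with hlin
  -- Beyond height `h'`, `q` is capped by the line equal to `F` at `h'` and to 0 at `2 * h'`. The
  -- pasted function is still superharmonic off the box, so minimality gives `q ≤ w`; one level
  -- before the end, the line is worth `F / h'`.
  set w : S × ℤ → ℝ := fun x => if h' < x.2.natAbs ∧ x.2.natAbs < 2 * h' then min (q x) (lin x)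
    else q x with hw
  have hwq : ∀ x, w x ≤ q x := fun x => by
    simp only [hw]; split_ifs; exacts [min_le_left _ _, le_rfl]
  have hwlin : ∀ x : S × ℤ, h' ≤ x.2.natAbs → x.2.natAbs ≤ 2 * h' → w x ≤ lin x := by
    intro x h1 h2
    simp only [hw]
    split_ifs with h
    · exact min_le_right _ _
    · by_cases h3 : x.2.natAbs = h'
      · refine (hF x.1 x.2 h3).trans ?_
        simp only [hlin, h3]
        field_simp
        linarith
      · have h4 : x.2.natAbs = 2 * h' := by omega
        rw [show q x = 0 from slabProb_of_le h4.ge]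
        simp only [hlin, h4]
        push_cast
        simp
  have hmain := hitProb_le G (C := box V v 0) (B := slab S h' 0) (w := w) (fun x => ?_)
    (fun x hx hxB => ?_) (fun x hxB hx => ?_) (g, z)
  · refine hmain.trans ((hwlin (g, z) (by simp only; omega) (by simp only; omega)).trans ?_)
    simp only [hlin, hz]
    rw [Nat.cast_sub (by omega)]
    push_cast
    apply le_of_eq
    ring
  · simp only [hw]
    split_ifs with h
    · refine le_min (hq0 x) (mul_nonneg (div_nonneg hF0 hh.le) ?_)
      have : (x.2.natAbs : ℝ) ≤ 2 * h' := by exact_mod_cast h.2.le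
      linarith
    · exact hq0 x
  · simp only [hw]
    rw [mem_box_zero] at hx
    rw [if_neg (by omega)]
    exact (hitProb_eq_one G (mem_box_zero.2 hx) hxB).ge
  · have hqx := slabProb_harmonic (G := G) hx (mem_slab_zero.1 hxB)
    have hd : 0 ≤ degR G x.1 + 2 := by linarith [degR_nonneg G x.1]
    have hle := (cylSum_mono G hwq (x := x)).trans hqx.le
    rw [mem_slab_zero] at hxB
    by_cases h : h' < x.2.natAbs
    · have hwx : w x = min (q x) (lin x) := by simp only [hw]; rw [if_pos ⟨h, hxB⟩]
      rw [hwx, min_mul_of_nonneg _ _ hd]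
      refine le_min hle ?_
      have h1 : nbSum G (fun g => w (g, x.2)) x.1 ≤ lin x * degR G x.1 := by
        rw [← nbSum_const]
        exact nbSum_mono G fun g' _ => hwlin (g', x.2) h.le hxB.le
      have h2 := hwlin (x.1, x.2 + 1) (by simp only; omega) (by simp only; omega)
      have h3 := hwlin (x.1, x.2 - 1) (by simp only; omega) (by simp only; omega)
      have h4 : lin (x.1, x.2 + 1) + lin (x.1, x.2 - 1) = 2 * lin x := by
        have : (((x.2 + 1).natAbs : ℕ) : ℝ) + ((x.2 - 1).natAbs : ℕ) = 2 * (x.2.natAbs : ℝ) := by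
          have : (x.2 + 1).natAbs + (x.2 - 1).natAbs = 2 * x.2.natAbs := by omega
          exact_mod_cast this
        simp only [hlin]
        rw [← mul_add, show (2 * (h' : ℝ) - ((x.2 + 1).natAbs : ℝ))
          + (2 * h' - ((x.2 - 1).natAbs : ℝ)) = 2 * (2 * h' - (x.2.natAbs : ℝ)) by linarith]
        ring
      simp only [cylSum]
      linarith
    · have hwx : w x = q x := by simp only [hw]; rw [if_neg (by omega)]
      rw [hwx]; exact hle

end SlabProb

/-- Hitting a box from outside of the slab, in terms of bounds on the probability of hitting it
within one excursion. -/
theorem MixingData.walkLaw_hit_box_le_of_slabProb [Nonempty S] {G : SimpleGraph S}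
    {d M lam ε ε₀ : ℝ} {n₀ T : ℕ} (D : MixingData G d M lam ε ε₀ n₀ T) {V : Finset S}
    {v h' : ℕ} {F : ℝ} (hv : v < h')
    (hF : ∀ g (z : ℤ), z.natAbs = h' → slabProb G V v h' (g, z) ≤ F) (u : ℤ) (y : S × ℤ)
    (hy : y ∉ slab S h' u) :
    (walkLaw (cylinderGraph G) y).real {ω | ∃ n < T, ω n ∈ box V v u}
      ≤ 4 * (2 * (F / h') / ε₀ + (d + 2) * V.card * (2 * v + 1) / (Fintype.card S * ε)
        + (d + 2) * V.card * (2 * v + 1) * ((1 - lam / (2 * M)) ^ n₀ * (2 / lam))) := by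
  set q := slabProb G V v h' with hq
  have hq0 : ∀ x, 0 ≤ q x := slabProb_nonneg
  have hM0 := D.M_pos
  have hN : (0 : ℝ) < Fintype.card S := by exact_mod_cast Fintype.card_pos
  -- For `e = ± 1`, the charge to be placed on level `e * (2 * h')`, just outside the slab: the mean
  -- of `q` after one lazy step from there.
  set f : ℤ → S → ℝ := fun e g => q (g, e * (2 * h' - 1)) / M with hf
  have hf0 : ∀ e g, 0 ≤ f e g := fun e g => div_nonneg (hq0 _) hM0.le
  have hend : ∀ e : ℤ, e.natAbs = 1 → ∀ g, q (g, e * (2 * h' - 1)) ≤ F / h' := by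
    intro e he g
    refine slabProb_end_le hv hF g _ ?_
    rw [Int.natAbs_mul, he]; omega
  have hfF : ∀ e : ℤ, e.natAbs = 1 → ∀ g, f e g ≤ F / h' / M := fun e he g =>
    div_le_div_of_nonneg_right (hend e he g) hM0.le
  set K := (d + 2) * V.card * (2 * v + 1) with hK
  have hfs : ∀ e : ℤ, e = 1 ∨ e = -1 → ∑ g, f e g ≤ K / M := by
    intro e he
    rw [← Finset.sum_div]
    refine div_le_div_of_nonneg_right ?_ hM0.le
    have := sum_slabProb_end_le (G := G) (V := V) D.deg_le D.d_nonneg hv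
    rcases he with rfl | rfl
    · simpa using this.1
    · simpa using this.2
  set U : ℤ → S × ℤ → ℝ :=
    fun e => potential G M (1 - ε ^ 2) (levelFun (f e) (e * (2 * h'))) with hU
  have hU0 : ∀ e x, 0 ≤ U e x := fun e x => D.levelFun_potential_nonneg (hf0 e) _ x
  have hUeq : ∀ e : ℤ, e.natAbs = 1 → ∀ x, U e x = levelFun (f e) (e * (2 * h')) x
      + (1 - ε ^ 2) * lazyOp G M (U e) x :=
    fun e he x => D.levelFun_potential_eq (hf0 e) (hfF e he) _ x
  have hUle : ∀ e : ℤ, e = 1 ∨ e = -1 → ∀ x, U e x ≤ 2 * (F / h') / ε₀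
      + K / (Fintype.card S * ε) + K * ((1 - lam / (2 * M)) ^ n₀ * (2 / lam)) := by
    intro e he x
    have he' : e.natAbs = 1 := by rcases he with rfl | rfl <;> rfl
    refine (D.levelFun_potential_le (hf0 e) (hfF e he') _ x).trans ?_
    have hs := hfs e he
    have hε := D.eps_pos
    have hε₀ := D.eps₀_pos
    have hε₀2 := D.eps₀_le
    have hlam := D.lam_pos
    have h1 : (1 - ε₀) ^ (x.2 - e * (2 * h')).natAbs ≤ 1 :=
      pow_le_one₀ (by linarith) (by linarith)
    have hτ : 0 ≤ 1 - lam / (2 * M) := by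
      have : lam / (2 * M) ≤ 1 := by
        rw [div_le_one (by positivity)]; linarith [D.lam_le]
      linarith
    have hF0 : 0 ≤ F := (hq0 (Classical.arbitrary S, h')).trans (hF _ h' (by simp))
    refine add_le_add (add_le_add ?_ ?_) ?_
    · calc 2 * (F / h' / M) * (M / ε₀ * (1 - ε₀) ^ (x.2 - e * (2 * h')).natAbs)
          ≤ 2 * (F / h' / M) * (M / ε₀ * 1) := by gcongr
        _ = 2 * (F / h') / ε₀ := by field_simp
    · calc uniformMean (f e) * (M / ε) ≤ (K / M) / Fintype.card S * (M / ε) := by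
            unfold uniformMean; gcongr
        _ = K / (Fintype.card S * ε) := by field_simp
    · calc (∑ g, f e g) * ((1 - lam / (2 * M)) ^ n₀ * (2 * M / lam))
          ≤ (K / M) * ((1 - lam / (2 * M)) ^ n₀ * (2 * M / lam)) := by gcongr
        _ = K * ((1 - lam / (2 * M)) ^ n₀ * (2 / lam)) := by field_simp
  -- Off the box, `q` fails to be superharmonic only on the two levels bordering the slab, and there
  -- the charges of `U 1` and `U (-1)` make up the defect exactly.
  set Ψ : S × ℤ → ℝ := q + U 1 + U (-1) with hΨ
  have hΨx : ∀ x, Ψ x = q x + U 1 x + U (-1) x := fun x => rfl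
  have hsup : ∀ x ∉ box V v 0, (1 - ε ^ 2) * lazyOp G M Ψ x ≤ Ψ x := by
    intro x hx
    rw [hΨ, map_add, map_add]
    simp only [Pi.add_apply]
    have e1 := hUeq 1 rfl x
    have e2 := hUeq (-1) rfl x
    have hs1 : 1 - ε ^ 2 ≤ 1 := by nlinarith [D.eps_pos]
    have hQq : 0 ≤ lazyOp G M q x := lazyOp_nonneg hM0 D.deg_le_M q hq0 x
    have hφ1 := levelFun_nonneg (hf0 1) (1 * (2 * h')) x
    have hφ2 := levelFun_nonneg (hf0 (-1)) (-1 * (2 * h')) x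
    have key : lazyOp G M q x ≤ q x + levelFun (f 1) (1 * (2 * h')) x
        + levelFun (f (-1)) (-1 * (2 * h')) x := by
      by_cases hxs : x.2.natAbs < 2 * h'
      · have : lazyOp G M q x = q x := by
          rw [lazyOp_apply, slabProb_harmonic hx hxs]
          change q x * _ + q x * _ / M = q x
          field_simp
          ring
        linarith
      · have hz : ∀ g, q (g, x.2) = 0 := fun g => slabProb_of_le (by simp only; omega)
        have hL : lazyOp G M q x = (q (x.1, x.2 + 1) + q (x.1, x.2 - 1)) / M := by
          rw [lazyOp_apply, cylSum, show (fun g => q (g, x.2)) = fun _ => 0 from funext hz,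
            nbSum_const, show q x = 0 from hz x.1]
          ring
        rw [hL]
        by_cases h1 : x.2 = 2 * h'
        · have hp : q (x.1, x.2 + 1) = 0 := slabProb_of_le (by simp only; omega)
          have : levelFun (f 1) (1 * (2 * h')) x = q (x.1, x.2 - 1) / M := by
            simp [levelFun, delta, h1, hf]
          rw [hp, this, zero_add]
          linarith [hq0 x]
        · by_cases h2 : x.2 = -(2 * h')
          · have hp : q (x.1, x.2 - 1) = 0 := slabProb_of_le (by simp only; omega)
            have : levelFun (f (-1)) (-1 * (2 * h')) x = q (x.1, x.2 + 1) / M := by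
              have e : -(2 * (h' : ℤ)) + 1 = -1 * (2 * h' - 1) := by ring
              simp only [levelFun, delta, h2, hf, e]
              simp
            rw [hp, this, add_zero]
            linarith [hq0 x]
          · have hp : q (x.1, x.2 + 1) = 0 := slabProb_of_le (by simp only; omega)
            have hm : q (x.1, x.2 - 1) = 0 := slabProb_of_le (by simp only; omega)
            rw [hp, hm]
            simp only [add_zero, zero_div]
            linarith [hq0 x]
    have := mul_le_of_le_one_left hQq hs1
    linarith
  have hshift : ∀ x : S × ℤ, x ∈ box V v u ↔ (x.1, x.2 - u) ∈ box V v 0 := fun x => by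
    simp [box]
  refine (walkLaw_hit_le hM0 D.eps_le D.eps_pos.le D.T_le D.one_le_T
    (Ψ := fun x => Ψ (x.1, x.2 - u)) (fun x => ?_) (fun x hx => ?_) (fun x hx => ?_) y).trans ?_
  · rw [hΨx]
    have := hq0 (x.1, x.2 - u)
    have := hU0 1 (x.1, x.2 - u)
    have := hU0 (-1) (x.1, x.2 - u)
    linarith
  · rw [hΨx]
    have hx' := (hshift x).1 hx
    have h1 : q (x.1, x.2 - u) = 1 := by
      refine hitProb_eq_one G hx' (mem_slab_zero.2 ?_)
      have := (mem_box_zero.1 hx').2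
      omega
    have := hU0 1 (x.1, x.2 - u)
    have := hU0 (-1) (x.1, x.2 - u)
    linarith
  · have := hsup (x.1, x.2 - u) (fun h => hx ((hshift x).2 h))
    rw [lazyOp_apply] at this ⊢
    rwa [cylSum_shift]
  -- From outside the slab only re-entries count; the factor 4 is the 2 of `walkLaw_hit_le` times
  -- the two ends.
  · have hy0 : q (y.1, y.2 - u) = 0 := by
      refine slabProb_of_le ?_
      change ¬ (|y.2 - u| ≤ 2 * (h' : ℤ) - 1) at hy
      rw [Int.abs_eq_natAbs] at hy
      simp only
      omega
    rw [hΨx, hy0]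
    have h1 := hUle 1 (Or.inl rfl) (y.1, y.2 - u)
    have h2 := hUle (-1) (Or.inr rfl) (y.1, y.2 - u)
    linarith

/-! ### The killed kernel on the base -/

variable {S : Type*} [Fintype S]

section Killed

variable {G : SimpleGraph S} {A : Finset S}

lemma killedKernel_of_notMem {g g' : S} (h : g ∉ A) (n : ℕ) : killedKernel G A g' n g = 0 := by
  cases n <;> simp [killedKernel, h]

lemma killedKernel_nonneg (g' : S) (n : ℕ) (g : S) : 0 ≤ killedKernel G A g' n g := by
  induction n generalizing g with
  | zero => simp only [killedKernel]; split_ifs <;> norm_num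
  | succ n ih =>
    simp only [killedKernel]
    split_ifs
    · exact div_nonneg (nbSum_nonneg G ih g) (degR_nonneg G g)
    · exact le_rfl

/-- Averaging over neighbors cannot raise a uniform bound; this carries estimates from even to odd
times. -/
lemma killedKernel_succ_le {c : ℝ} (hc : 0 ≤ c) {g' : S} {n : ℕ}
    (h : ∀ g, killedKernel G A g' n g ≤ c) (g : S) : killedKernel G A g' (n + 1) g ≤ c := by
  simp only [killedKernel]
  split_ifs
  · refine div_le_of_le_mul₀ (degR_nonneg G g) hc ?_
    rw [← nbSum_const]
    exact nbSum_mono G fun y _ => h y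
  · exact hc

lemma killedKernel_le_one (g' : S) (n : ℕ) (g : S) : killedKernel G A g' n g ≤ 1 := by
  induction n generalizing g with
  | zero => simp only [killedKernel]; split_ifs <;> norm_num
  | succ n ih => exact killedKernel_succ_le zero_le_one ih g

lemma killedKernel_add (g' : S) (m n : ℕ) (g : S) :
    killedKernel G A g' (m + n) g
      = ∑ y, killedKernel G A y m g * killedKernel G A g' n y := by
  classical
  induction m generalizing g with
  | zero =>
    simp only [zero_add, killedKernel]
    by_cases h : g ∈ A
    · simp [h]
    · simp [h, killedKernel_of_notMem h]
  | succ m ih =>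
    rw [show m + 1 + n = (m + n) + 1 by ring]
    simp only [killedKernel]
    split_ifs with h
    · rw [show killedKernel G A g' (m + n)
        = fun g => ∑ y, killedKernel G A g' n y * killedKernel G A y m g from
        funext fun g => by rw [ih]; exact Finset.sum_congr rfl fun y _ => mul_comm _ _,
        nbSum_finset_sum, Finset.sum_div]
      refine Finset.sum_congr rfl fun y _ => ?_
      rw [nbSum_const_mul]
      ring
    · simp

variable (hd : ∀ g, 0 < degR G g)
include hd

lemma degR_mul_killedKernel_one (g g' : S) :
    degR G g * killedKernel G A g' 1 g = degR G g' * killedKernel G A g 1 g' := by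
  classical
  have key : ∀ g g', degR G g * killedKernel G A g' 1 g
      = if G.Adj g g' ∧ g ∈ A ∧ g' ∈ A then 1 else 0 := by
    intro g g'
    simp only [killedKernel]
    by_cases hg : g ∈ A
    · rw [if_pos hg, mul_div_cancel₀ _ (hd g).ne', nbSum]
      by_cases hg' : g' ∈ A
      · rw [Finset.sum_eq_single g']
        · simp [hg, hg']
        · intro b _ hb; simp [hb]
        · simp
      · rw [if_neg (fun h => hg' h.2.2)]
        refine Finset.sum_eq_zero fun y _ => ?_
        split_ifs with h1 h2
        · exact absurd (h2.1 ▸ h2.2) hg'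
        · rfl
        · rfl
    · simp [hg]
  rw [key, key]
  refine if_congr ?_ rfl rfl
  rw [G.adj_comm]
  tauto

/-- Reversibility with respect to the degree. The extra step is split off at the end on one side and
at the start on the other. -/
lemma degR_mul_killedKernel (n : ℕ) (g g' : S) :
    degR G g * killedKernel G A g' n g = degR G g' * killedKernel G A g n g' := by
  induction n generalizing g g' with
  | zero =>
    simp only [killedKernel]
    by_cases h : g = g'
    · subst h; rfl
    · simp [h, Ne.symm h]
  | succ n ih =>
    rw [killedKernel_add, add_comm n 1, killedKernel_add, Finset.mul_sum, Finset.mul_sum]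
    refine Finset.sum_congr rfl fun y _ => ?_
    rw [← mul_assoc, ih, mul_right_comm, degR_mul_killedKernel_one hd]
    ring

/-- Split at half the time and use `x y ≤ (x² + y²) / 2`; by reversibility each sum of squares is a
return probability, up to a ratio of degrees. -/
lemma killedKernel_even_le {d : ℝ} (h1 : ∀ g, 1 ≤ degR G g) (hd' : ∀ g, degR G g ≤ d) {b : ℝ}
    {n : ℕ} (hb0 : 0 ≤ b) (hb : ∀ g ∈ A, killedKernel G A g (n + n) g ≤ b) (g g' : S) :
    killedKernel G A g' (n + n) g ≤ d * b := by
  have hd0 : 0 ≤ d := (degR_nonneg G g).trans (hd' g)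
  have hsym : ∀ g g', killedKernel G A g' n g ≤ d * killedKernel G A g n g' := by
    intro g g'
    have h := degR_mul_killedKernel hd (A := A) n g g'
    have h2 := mul_le_mul_of_nonneg_right (h1 g) (killedKernel_nonneg (G := G) (A := A) g' n g)
    have h3 := mul_le_mul_of_nonneg_right (hd' g') (killedKernel_nonneg (G := G) (A := A) g n g')
    linarith
  have hbA : ∀ g, killedKernel G A g (n + n) g ≤ b := fun g => by
    by_cases hg : g ∈ A
    · exact hb g hg
    · rw [killedKernel_of_notMem hg]; exact hb0
  rw [killedKernel_add]
  have e1 : ∑ y, killedKernel G A y n g ^ 2 ≤ d * b := by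
    refine le_trans ?_ (mul_le_mul_of_nonneg_left (hbA g) hd0)
    rw [killedKernel_add, Finset.mul_sum]
    refine Finset.sum_le_sum fun y _ => ?_
    have := mul_le_mul_of_nonneg_left (hsym g y) (killedKernel_nonneg (G := G) (A := A) y n g)
    rw [sq]; linarith
  have e2 : ∑ y, killedKernel G A g' n y ^ 2 ≤ d * b := by
    refine le_trans ?_ (mul_le_mul_of_nonneg_left (hbA g') hd0)
    rw [killedKernel_add, Finset.mul_sum]
    refine Finset.sum_le_sum fun y _ => ?_
    have := mul_le_mul_of_nonneg_right (hsym y g') (killedKernel_nonneg (G := G) (A := A) g' n y)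
    rw [sq]; linarith
  have e3 : ∑ y, killedKernel G A y n g * killedKernel G A g' n y
      ≤ ∑ y, (killedKernel G A y n g ^ 2 + killedKernel G A g' n y ^ 2) / 2 :=
    Finset.sum_le_sum fun y _ => by
      linarith [two_mul_le_add_sq (killedKernel G A y n g) (killedKernel G A g' n y)]
  rw [← Finset.sum_div, Finset.sum_add_distrib] at e3
  linarith

/-- Off-diagonal heat kernel decay from on-diagonal decay. -/
lemma killedKernel_le {d a γ : ℝ} (h1 : ∀ g, 1 ≤ degR G g) (hd' : ∀ g, degR G g ≤ d)
    (hd0 : 0 ≤ d) (ha : 0 ≤ a) (hγ : 0 ≤ γ)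
    (hb : ∀ g ∈ A, ∀ n : ℕ, 1 ≤ n → killedKernel G A g n g ≤ a / (n : ℝ) ^ γ) (g' : S) (k : ℕ)
    (g : S) : killedKernel G A g' k g ≤ ((d * a + 1) * 4 ^ γ) * ((k : ℝ) + 1) ^ (-γ) := by
  -- The factor `4 ^ γ` serves twice: it makes the trivial bound 1 sufficient for `k ≤ 1`, and later
  -- absorbs the passage from `k + 1` to a nearby even time.
  have hlow : ∀ k : ℕ, k ≤ 1 → killedKernel G A g' k g
      ≤ ((d * a + 1) * 4 ^ γ) * ((k : ℝ) + 1) ^ (-γ) := by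
    intro k hk
    refine (killedKernel_le_one g' k g).trans ?_
    have hk' : (k : ℝ) ≤ 1 := by exact_mod_cast hk
    have e1 : (4 : ℝ) ^ (-γ) ≤ ((k : ℝ) + 1) ^ (-γ) :=
      Real.rpow_le_rpow_of_nonpos (by positivity) (by linarith) (by linarith)
    have e2 : (4 : ℝ) ^ γ * 4 ^ (-γ) = 1 := by
      rw [← Real.rpow_add (by norm_num)]; simp
    have e3 : 1 ≤ d * a + 1 := by nlinarith
    calc (1 : ℝ) = 1 * (4 ^ γ * 4 ^ (-γ)) := by rw [e2, one_mul]
      _ ≤ (d * a + 1) * (4 ^ γ * ((k : ℝ) + 1) ^ (-γ)) := by gcongr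
      _ = _ := by ring
  have hev : ∀ n : ℕ, 1 ≤ n → ∀ g, killedKernel G A g' (n + n) g
      ≤ d * (a / ((n + n : ℕ) : ℝ) ^ γ) := fun n hn g =>
    killedKernel_even_le hd h1 hd' (by positivity) (fun g hg => hb g hg (n + n) (by omega)) g g'
  have hcomp : ∀ n k : ℕ, 1 ≤ n → k + 1 ≤ 4 * (n + n) → d * (a / ((n + n : ℕ) : ℝ) ^ γ)
      ≤ ((d * a + 1) * 4 ^ γ) * ((k : ℝ) + 1) ^ (-γ) := by
    intro n k hn hk
    have hn' : (0 : ℝ) < ((n + n : ℕ) : ℝ) := by exact_mod_cast (by omega : 0 < n + n)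
    have e1 : ((4 : ℝ) * ((n + n : ℕ) : ℝ)) ^ (-γ) ≤ ((k : ℝ) + 1) ^ (-γ) :=
      Real.rpow_le_rpow_of_nonpos (by positivity) (by exact_mod_cast hk) (by linarith)
    rw [Real.mul_rpow (by norm_num) hn'.le] at e1
    have e2 : (4 : ℝ) ^ γ * 4 ^ (-γ) = 1 := by
      rw [← Real.rpow_add (by norm_num)]; simp
    have e4 : 0 ≤ ((n + n : ℕ) : ℝ) ^ (-γ) := by positivity
    calc d * (a / ((n + n : ℕ) : ℝ) ^ γ) = d * a * ((n + n : ℕ) : ℝ) ^ (-γ) := by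
          rw [Real.rpow_neg hn'.le]; ring
      _ ≤ (d * a + 1) * ((4 ^ γ * 4 ^ (-γ)) * ((n + n : ℕ) : ℝ) ^ (-γ)) := by
          rw [e2, one_mul]
          exact mul_le_mul_of_nonneg_right (by linarith) e4
      _ = (d * a + 1) * (4 ^ γ * (4 ^ (-γ) * ((n + n : ℕ) : ℝ) ^ (-γ))) := by ring
      _ ≤ (d * a + 1) * (4 ^ γ * ((k : ℝ) + 1) ^ (-γ)) := by gcongr
      _ = _ := by ring
  rcases Nat.even_or_odd' k with ⟨n, rfl | rfl⟩
  · by_cases hn : n = 0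
    · exact hlow _ (by omega)
    · rw [two_mul]
      exact (hev n (by omega) g).trans (hcomp n _ (by omega) (by omega))
  · by_cases hn : n = 0
    · exact hlow _ (by omega)
    · refine (killedKernel_succ_le (c := d * (a / ((n + n : ℕ) : ℝ) ^ γ)) (by positivity) ?_
        g).trans (hcomp n _ (by omega) (by omega))
      rw [two_mul]
      exact hev n (by omega)

end Killed

/-! ### One-dimensional resolvents -/

/-- Minimum principle on `ℤ` with killing. -/
lemma nonneg_of_resolvent_nonneg {d : ℝ} (hd : 0 < d) {F : ℤ → ℝ} (hb : ∃ m, ∀ z, m ≤ F z)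
    (h : ∀ z, 0 ≤ (d + 2) * F z - F (z + 1) - F (z - 1)) (z : ℤ) : 0 ≤ F z := by
  have hbd : BddBelow (Set.range F) := by
    obtain ⟨m, hm⟩ := hb
    exact ⟨m, by rintro _ ⟨z, rfl⟩; exact hm z⟩
  -- The infimum `m`, finite by assumption, satisfies `2 * m ≤ (d + 2) * m`, so `d > 0` forces `m ≥
  -- 0`.
  have h1 : 2 * (⨅ z, F z) / (d + 2) ≤ ⨅ z, F z := by
    refine le_ciInf fun z => ?_
    rw [div_le_iff₀ (by linarith)]
    have := ciInf_le hbd (z + 1)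
    have := ciInf_le hbd (z - 1)
    linarith [h z]
  rw [div_le_iff₀ (by linarith)] at h1
  have h2 : 0 ≤ ⨅ z, F z := by nlinarith
  exact h2.trans (ciInf_le hbd z)

lemma two_mul_cosh_sub_two_le {σ : ℝ} (hσ : |σ| ≤ 1 / 2) : 2 * Real.cosh σ - 2 ≤ 2 * σ ^ 2 := by
  have h1 := Real.cosh_le_exp_half_sq σ
  have hs : σ ^ 2 ≤ 1 / 4 := by
    rw [← sq_abs]; nlinarith [abs_nonneg σ]
  have h2 := Real.abs_exp_sub_one_le (x := σ ^ 2 / 2)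
    (by rw [abs_of_nonneg (by positivity)]; linarith)
  rw [abs_of_nonneg (by positivity : 0 ≤ σ ^ 2 / 2)] at h2
  have := (abs_le.1 h2).2
  linarith

/-- The exponential is an eigenfunction of the vertical operator, with eigenvalue `d + 2 - 2 cosh σ
≥ d - 2 σ²`. Thus one sojourn at a base vertex costs at most a factor `1 + 4 σ²` in exponential
bounds. -/
lemma resolvent_exp_ge {σ d : ℝ} (hσ : |σ| ≤ 1 / 2) (hd : 1 ≤ d) (z : ℤ) :
    d * Real.exp (-σ * z) ≤ (1 + 4 * σ ^ 2) * ((d + 2) * Real.exp (-σ * z)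
      - Real.exp (-σ * (z + 1 : ℤ)) - Real.exp (-σ * (z - 1 : ℤ))) := by
  have e : Real.exp (-σ * (z + 1 : ℤ)) + Real.exp (-σ * (z - 1 : ℤ))
      = 2 * Real.cosh σ * Real.exp (-σ * z) := by
    rw [Real.cosh_eq]
    have e1 : -σ * ((z + 1 : ℤ) : ℝ) = -σ * z + -σ := by push_cast; ring
    have e2 : -σ * ((z - 1 : ℤ) : ℝ) = -σ * z + σ := by push_cast; ring
    rw [e1, e2, Real.exp_add, Real.exp_add]
    ring
  have hc := two_mul_cosh_sub_two_le hσ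
  have hs : σ ^ 2 ≤ 1 / 4 := by
    rw [← sq_abs]; nlinarith [abs_nonneg σ]
  have hE := Real.exp_pos (-σ * z)
  have h2 : d ≤ (1 + 4 * σ ^ 2) * (d + 2 - 2 * Real.cosh σ) := by
    have : (1 + 4 * σ ^ 2) * (d - 2 * σ ^ 2) ≤ (1 + 4 * σ ^ 2) * (d + 2 - 2 * Real.cosh σ) :=
      mul_le_mul_of_nonneg_left (by linarith) (by positivity)
    nlinarith [sq_nonneg σ]
  have h3 := mul_le_mul_of_nonneg_right h2 hE.le
  calc _ ≤ _ := h3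
    _ = (1 + 4 * σ ^ 2) * ((d + 2) * Real.exp (-σ * z)
      - (Real.exp (-σ * (z + 1 : ℤ)) + Real.exp (-σ * (z - 1 : ℤ)))) := by rw [e]; ring
    _ = _ := by ring

lemma integral_cos_int_mul {z : ℤ} (hz : z ≠ 0) :
    ∫ θ in (-Real.pi)..Real.pi, Real.cos (θ * z) = 0 := by
  have hz' : (z : ℝ) ≠ 0 := by exact_mod_cast hz
  rw [intervalIntegral.integral_comp_mul_right (fun x => Real.cos x) hz', integral_cos]
  have h1 : Real.sin (Real.pi * z) = 0 := by rw [mul_comm]; exact Real.sin_int_mul_pi z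
  have h2 : Real.sin (-Real.pi * z) = 0 := by rw [neg_mul, Real.sin_neg, h1, neg_zero]
  rw [h1, h2]; simp

/-- Decay of the return probabilities of the walk on `ℤ` observed at geometric times. -/
lemma integral_inv_pow_le {d : ℝ} (hd : 0 < d) (k : ℕ) :
    ∫ θ in (-Real.pi)..Real.pi, (1 + (2 - 2 * Real.cos θ) / d)⁻¹ ^ (k + 1)
      ≤ 2 * Real.pi * (√d / √((k : ℝ) + 1)) := by
  -- With this scale, `(θ * β) ^ 2` is a lower bound for `(k + 1) (2 - 2 cos θ) / d`, by `1 - cos θ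
  -- ≥ 2 θ² / π²`. Bernoulli's inequality then leaves the integrand of an arctangent.
  set β := (2 / Real.pi) * (√((k : ℝ) + 1) / √d) with hβ
  have hπ := Real.pi_pos
  have hβ0 : 0 < β := by positivity
  have hcont : Continuous fun θ : ℝ => (1 + (2 - 2 * Real.cos θ) / d)⁻¹ ^ (k + 1) := by
    refine Continuous.pow (Continuous.inv₀ (by fun_prop) fun θ => ?_) _
    have : 0 ≤ (2 - 2 * Real.cos θ) / d := div_nonneg (by linarith [Real.cos_le_one θ]) hd.le
    linarith
  have hcont2 : Continuous fun θ : ℝ => (1 + (θ * β) ^ 2)⁻¹ :=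
    Continuous.inv₀ (by fun_prop) fun θ => by positivity
  have hle : ∀ θ ∈ Set.Icc (-Real.pi) Real.pi, (1 + (2 - 2 * Real.cos θ) / d)⁻¹ ^ (k + 1)
      ≤ (1 + (θ * β) ^ 2)⁻¹ := by
    intro θ hθ
    rw [inv_pow]
    refine inv_anti₀ (by positivity) ?_
    have hcos := Real.cos_le_one_sub_mul_cos_sq (abs_le.2 hθ)
    have hl : 0 ≤ (2 - 2 * Real.cos θ) / d := div_nonneg (by linarith [Real.cos_le_one θ]) hd.le
    have hb := one_add_mul_le_pow (a := (2 - 2 * Real.cos θ) / d) (by linarith) (k + 1)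
    refine le_trans ?_ hb
    have hβ2 : β ^ 2 = 4 / Real.pi ^ 2 * (((k : ℝ) + 1) / d) := by
      rw [hβ, mul_pow, div_pow, div_pow, Real.sq_sqrt (by positivity), Real.sq_sqrt hd.le]
      norm_num
    rw [mul_pow, hβ2]
    have h4 : 4 / Real.pi ^ 2 * θ ^ 2 ≤ 2 - 2 * Real.cos θ := by
      have : 4 / Real.pi ^ 2 * θ ^ 2 = 2 * (2 / Real.pi ^ 2 * θ ^ 2) := by ring
      linarith
    have h5 := mul_le_mul_of_nonneg_right h4 (by positivity : 0 ≤ ((k : ℝ) + 1) / d)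
    push_cast
    have h6 : θ ^ 2 * (4 / Real.pi ^ 2 * (((k : ℝ) + 1) / d))
      = 4 / Real.pi ^ 2 * θ ^ 2 * (((k : ℝ) + 1) / d) := by ring
    have h7 : (2 - 2 * Real.cos θ) * (((k : ℝ) + 1) / d)
      = ((k : ℝ) + 1) * ((2 - 2 * Real.cos θ) / d) := by ring
    linarith
  refine (intervalIntegral.integral_mono_on (by linarith) (hcont.intervalIntegrable _ _)
    (hcont2.intervalIntegrable _ _) hle).trans ?_
  rw [intervalIntegral.integral_comp_mul_right (fun x => (1 + x ^ 2)⁻¹) hβ0.ne',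
    integral_inv_one_add_sq, smul_eq_mul]
  have h1 := Real.arctan_lt_pi_div_two (Real.pi * β)
  have h2 := Real.neg_pi_div_two_lt_arctan (-Real.pi * β)
  have h3 : β⁻¹ * (Real.arctan (Real.pi * β) - Real.arctan (-Real.pi * β)) ≤ β⁻¹ * Real.pi :=
    mul_le_mul_of_nonneg_left (by linarith) (by positivity)
  refine h3.trans ?_
  have h4 : β⁻¹ = Real.pi / 2 * (√d / √((k : ℝ) + 1)) := by
    rw [hβ, mul_inv, inv_div, inv_div]
  rw [h4]
  have h5 : 0 ≤ √d / √((k : ℝ) + 1) := by positivity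
  have h6 := Real.pi_lt_four
  have h7 : Real.pi / 2 * Real.pi ≤ 2 * Real.pi := by nlinarith
  calc _ = Real.pi / 2 * Real.pi * (√d / √((k : ℝ) + 1)) := by ring
    _ ≤ _ := mul_le_mul_of_nonneg_right h7 h5

/-! ### Green function of the walk on a cylinder over a pocket -/

variable {S : Type*} [Fintype S]

open Classical in
/-- Fourier transform in the height of the Green function of the walk killed outside of `A × ℤ`,
restricted to the time between the `n`-th and the `(n+1)`-st move of the base component. -/
def sojournFourier (G : SimpleGraph S) (A : Finset S) (g' : S) : ℕ → S → ℝ → ℝ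
  | 0, g, θ => if g = g' ∧ g ∈ A then (1 + (2 - 2 * Real.cos θ) / degR G g)⁻¹ else 0
  | n + 1, g, θ => if g ∈ A then (1 + (2 - 2 * Real.cos θ) / degR G g)⁻¹ *
      (nbSum G (fun y => sojournFourier G A g' n y θ) g / degR G g) else 0

/-- The part of the Green function of the walk killed outside of `A × ℤ` due to the time between
the `n`-th and the `(n+1)`-st move of the base component. -/
def sojournGreen (G : SimpleGraph S) (A : Finset S) (g' : S) (n : ℕ) (g : S) (z : ℤ) : ℝ :=
  (2 * Real.pi)⁻¹ * ∫ θ in (-Real.pi)..Real.pi,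
    Real.cos (θ * z) * sojournFourier G A g' n g θ

section Sojourn

variable {G : SimpleGraph S} {A : Finset S} {d : ℝ} (h1 : ∀ g, 1 ≤ degR G g)
  (hd : ∀ g, degR G g ≤ d)

lemma symbol_nonneg (θ : ℝ) : 0 ≤ 2 - 2 * Real.cos θ := by linarith [Real.cos_le_one θ]

lemma sojournGreen_of_notMem {g g' : S} (h : g ∉ A) (n : ℕ) (z : ℤ) :
    sojournGreen G A g' n g z = 0 := by
  cases n <;> simp [sojournGreen, sojournFourier, h]

include h1

lemma continuous_sojournFourier (g' : S) (n : ℕ) (g : S) :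
    Continuous (sojournFourier G A g' n g) := by
  have hc : ∀ g, Continuous fun θ : ℝ => (1 + (2 - 2 * Real.cos θ) / degR G g)⁻¹ := fun g =>
    Continuous.inv₀ (by fun_prop) fun θ => by
      have := div_nonneg (symbol_nonneg θ) (degR_nonneg G g)
      linarith
  induction n generalizing g with
  | zero =>
    simp only [funext fun θ => sojournFourier.eq_1 G A g' g θ]
    split_ifs
    · exact hc g
    · exact continuous_const
  | succ n ih =>
    simp only [funext fun θ => sojournFourier.eq_2 G A g' g θ n]
    split_ifs
    · refine (hc g).mul (Continuous.div_const ?_ _)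
      unfold nbSum
      refine continuous_finsetSum _ fun y _ => ?_
      split_ifs
      · exact ih y
      · exact continuous_const
    · exact continuous_const

lemma sojournFourier_nonneg (g' : S) (n : ℕ) (g : S) (θ : ℝ) :
    0 ≤ sojournFourier G A g' n g θ := by
  have hs := div_nonneg (symbol_nonneg θ) (degR_nonneg G g)
  induction n generalizing g with
  | zero =>
    unfold sojournFourier
    split_ifs
    · exact inv_nonneg.2 (by linarith)
    · exact le_rfl
  | succ n ih =>
    unfold sojournFourier
    split_ifs
    · refine mul_nonneg (inv_nonneg.2 (by linarith)) (div_nonneg (nbSum_nonneg G (fun y => ?_) g)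
        (degR_nonneg G g))
      exact ih y (div_nonneg (symbol_nonneg θ) (degR_nonneg G y))
    · exact le_rfl

lemma sojournFourier_eq (g' : S) (n : ℕ) {g : S} (hg : g ∈ A) (θ : ℝ) :
    (degR G g + (2 - 2 * Real.cos θ)) * sojournFourier G A g' (n + 1) g θ
      = nbSum G (fun y => sojournFourier G A g' n y θ) g := by
  have hs := symbol_nonneg θ
  have hdg := h1 g
  rw [sojournFourier, if_pos hg]
  generalize 2 - 2 * Real.cos θ = c at hs ⊢
  have h2 : degR G g ≠ 0 := by linarith
  have h3 : degR G g + c ≠ 0 := by linarith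
  field_simp

/-- Under the Fourier transform the negative second difference in the height is multiplication by `2
- 2 cos θ`. The two equations below, linking consecutive `n` and giving the source at `n = 0`,
follow from this. -/
lemma resolvent_sojournGreen (g' : S) (n : ℕ) (g : S) (z : ℤ) :
    (degR G g + 2) * sojournGreen G A g' n g z - sojournGreen G A g' n g (z + 1)
      - sojournGreen G A g' n g (z - 1)
      = (2 * Real.pi)⁻¹ * ∫ θ in (-Real.pi)..Real.pi, Real.cos (θ * z) *
        ((degR G g + (2 - 2 * Real.cos θ)) * sojournFourier G A g' n g θ) := by
  have hc := continuous_sojournFourier (A := A) h1 g' n g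
  have hi : ∀ z : ℤ, IntervalIntegrable
      (fun θ => Real.cos (θ * z) * sojournFourier G A g' n g θ) volume (-Real.pi) Real.pi :=
    fun z => (Continuous.mul (by fun_prop) hc).intervalIntegrable _ _
  simp only [sojournGreen]
  rw [mul_left_comm, ← mul_sub, ← mul_sub, ← intervalIntegral.integral_const_mul,
    ← intervalIntegral.integral_sub ((hi z).const_mul _) (hi _),
    ← intervalIntegral.integral_sub (((hi z).const_mul _).sub (hi _)) (hi _)]
  congr 1
  refine intervalIntegral.integral_congr fun θ _ => ?_
  have e1 : θ * ((z + 1 : ℤ) : ℝ) = θ * z + θ := by push_cast; ring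
  have e2 : θ * ((z - 1 : ℤ) : ℝ) = θ * z - θ := by push_cast; ring
  simp only [e1, e2, Real.cos_add, Real.cos_sub]
  ring

lemma resolvent_sojournGreen_succ (g' : S) (n : ℕ) {g : S} (hg : g ∈ A) (z : ℤ) :
    (degR G g + 2) * sojournGreen G A g' (n + 1) g z - sojournGreen G A g' (n + 1) g (z + 1)
      - sojournGreen G A g' (n + 1) g (z - 1)
      = nbSum G (fun y => sojournGreen G A g' n y z) g := by
  rw [resolvent_sojournGreen h1]
  simp only [sojournFourier_eq h1 g' n hg, sojournGreen, nbSum_const_mul]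
  congr 1
  have hc := continuous_sojournFourier (A := A) h1 g' n
  simp only [nbSum, Finset.mul_sum]
  rw [intervalIntegral.integral_finsetSum]
  · refine Finset.sum_congr rfl fun y _ => ?_
    split_ifs <;> simp
  · intro y _
    split_ifs
    · exact (Continuous.mul (by fun_prop) (hc y)).intervalIntegrable _ _
    · simp

open Classical in
lemma resolvent_sojournGreen_zero (g' : S) (g : S) (z : ℤ) :
    (degR G g + 2) * sojournGreen G A g' 0 g z - sojournGreen G A g' 0 g (z + 1)
      - sojournGreen G A g' 0 g (z - 1) = if g = g' ∧ g ∈ A then degR G g * delta 0 z else 0 := by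
  rw [resolvent_sojournGreen h1]
  have hdg := h1 g
  split_ifs with h
  · have e : ∀ θ : ℝ, (degR G g + (2 - 2 * Real.cos θ)) * sojournFourier G A g' 0 g θ
        = degR G g := by
      intro θ
      have hs := symbol_nonneg θ
      rw [sojournFourier, if_pos h]
      generalize 2 - 2 * Real.cos θ = c at hs ⊢
      have h2 : degR G g ≠ 0 := by linarith
      have h3 : degR G g + c ≠ 0 := by linarith
      field_simp
    simp only [e]
    rw [intervalIntegral.integral_mul_const]
    by_cases hz : z = 0
    · subst hz
      simp only [Int.cast_zero, mul_zero, Real.cos_zero, delta, if_true]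
      rw [intervalIntegral.integral_const, smul_eq_mul]
      have := Real.pi_pos
      field_simp
      ring
    · rw [integral_cos_int_mul hz, delta, if_neg hz]; simp
  · simp [sojournFourier, h]

include hd

/-- Replacing every degree in the vertical factors by the maximum `d` decouples the coordinates: the
base contributes the killed kernel, and each of the `n + 1` sojourns the same factor in `θ`. -/
lemma sojournFourier_le (hd0 : 0 < d) (g' : S) (n : ℕ) (g : S) (θ : ℝ) :
    sojournFourier G A g' n g θ
      ≤ killedKernel G A g' n g * (1 + (2 - 2 * Real.cos θ) / d)⁻¹ ^ (n + 1) := by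
  have hs := symbol_nonneg θ
  have hm : ∀ g, (1 + (2 - 2 * Real.cos θ) / degR G g)⁻¹ ≤ (1 + (2 - 2 * Real.cos θ) / d)⁻¹ := by
    intro g
    have hg : 0 < degR G g := by linarith [h1 g]
    refine inv_anti₀ (by positivity) ?_
    have := div_le_div_of_nonneg_left hs hg (hd g)
    linarith
  have hp : 0 ≤ (1 + (2 - 2 * Real.cos θ) / d)⁻¹ := by positivity
  induction n generalizing g with
  | zero =>
    simp only [sojournFourier, killedKernel]
    split_ifs
    · simpa using hm g
    · simp
  | succ n ih =>
    simp only [sojournFourier, killedKernel]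
    have hg := degR_nonneg G g
    split_ifs
    · have h2 := nbSum_mono G (g := g) fun y _ => ih y
      simp only [mul_comm _ ((1 + (2 - 2 * Real.cos θ) / d)⁻¹ ^ (n + 1)), nbSum_const_mul] at h2
      have h3 := div_le_div_of_nonneg_right h2 hg
      have h0 : 0 ≤ nbSum G (fun y => sojournFourier G A g' n y θ) g / degR G g :=
        div_nonneg (nbSum_nonneg G (fun y => sojournFourier_nonneg h1 g' n y θ) g) hg
      refine (mul_le_mul (hm g) h3 h0 hp).trans (le_of_eq ?_)
      rw [pow_succ _ (n + 1)]
      ring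
    · simp

lemma abs_sojournGreen_le (hd0 : 0 < d) (g' : S) (n : ℕ) (g : S) (z : ℤ) :
    |sojournGreen G A g' n g z| ≤ killedKernel G A g' n g * (√d / √((n : ℝ) + 1)) := by
  have hc := continuous_sojournFourier (A := A) h1 g' n g
  have hπ := Real.pi_pos
  have hk := killedKernel_nonneg (G := G) (A := A) g' n g
  have hcont : Continuous fun θ : ℝ => (1 + (2 - 2 * Real.cos θ) / d)⁻¹ ^ (n + 1) := by
    refine Continuous.pow (Continuous.inv₀ (by fun_prop) fun θ => ?_) _
    have := div_nonneg (symbol_nonneg θ) hd0.le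
    linarith
  have h2 : |∫ θ in (-Real.pi)..Real.pi, Real.cos (θ * z) * sojournFourier G A g' n g θ|
      ≤ ∫ θ in (-Real.pi)..Real.pi,
        killedKernel G A g' n g * (1 + (2 - 2 * Real.cos θ) / d)⁻¹ ^ (n + 1) := by
    refine (intervalIntegral.abs_integral_le_integral_abs (by linarith)).trans ?_
    refine intervalIntegral.integral_mono_on (by linarith)
      ((Continuous.abs (Continuous.mul (by fun_prop) hc)).intervalIntegrable _ _)
      ((continuous_const.mul hcont).intervalIntegrable _ _) fun θ _ => ?_
    have hn := sojournFourier_nonneg (A := A) h1 g' n g θ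
    rw [abs_mul, abs_of_nonneg hn]
    exact (mul_le_of_le_one_left hn (Real.abs_cos_le_one _)).trans
      (sojournFourier_le h1 hd hd0 g' n g θ)
  rw [intervalIntegral.integral_const_mul] at h2
  have h3 := h2.trans (mul_le_mul_of_nonneg_left (integral_inv_pow_le hd0 n) hk)
  rw [sojournGreen, abs_mul, abs_of_pos (by positivity)]
  refine (mul_le_mul_of_nonneg_left h3 (by positivity)).trans (le_of_eq ?_)
  field_simp

lemma sojournGreen_bddBelow (hd0 : 0 < d) (g' : S) (n : ℕ) (g : S) :
    ∃ m, ∀ z, m ≤ sojournGreen G A g' n g z :=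
  ⟨-(killedKernel G A g' n g * (√d / √((n : ℝ) + 1))), fun z =>
    (abs_le.1 (abs_sojournGreen_le h1 hd hd0 g' n g z)).1⟩

/-- The integrand changes sign, so positivity is read off from the equations in `z`, by the minimum
principle and induction on `n`. -/
lemma sojournGreen_nonneg (hd0 : 0 < d) (g' : S) (n : ℕ) (g : S) (z : ℤ) :
    0 ≤ sojournGreen G A g' n g z := by
  classical
  induction n generalizing g z with
  | zero =>
    refine nonneg_of_resolvent_nonneg (d := degR G g) (by linarith [h1 g])
      (sojournGreen_bddBelow h1 hd hd0 g' 0 g) (fun z => ?_) z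
    rw [resolvent_sojournGreen_zero h1]
    have := h1 g
    unfold delta
    split_ifs <;> linarith
  | succ n ih =>
    by_cases hg : g ∈ A
    · refine nonneg_of_resolvent_nonneg (d := degR G g) (by linarith [h1 g])
        (sojournGreen_bddBelow h1 hd hd0 g' (n + 1) g) (fun z => ?_) z
      rw [resolvent_sojournGreen_succ h1 g' n hg]
      exact nbSum_nonneg G (fun y => ih y z) g
    · rw [sojournGreen_of_notMem hg]

/-- The minimum principle applied to the difference of the two sides, which is bounded below since
the Green term is bounded. Both signs of `σ` are allowed, so the bound yields decay in `|z|`. -/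
lemma sojournGreen_le_exp (hd0 : 0 < d) {σ : ℝ} (hσ : |σ| ≤ 1 / 2) (g' : S) (n : ℕ) (g : S)
    (z : ℤ) : sojournGreen G A g' n g z ≤ (1 + 4 * σ ^ 2) ^ (n + 1) * Real.exp (-σ * z) := by
  classical
  have hΘ : 1 ≤ 1 + 4 * σ ^ 2 := by nlinarith [sq_nonneg σ]
  have hbb : ∀ n g, ∃ m, ∀ z : ℤ, m ≤ (1 + 4 * σ ^ 2) ^ (n + 1) * Real.exp (-σ * z)
      - sojournGreen G A g' n g z := fun n g =>
    ⟨-(killedKernel G A g' n g * (√d / √((n : ℝ) + 1))), fun z => by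
      have h2 := (abs_le.1 (abs_sojournGreen_le h1 hd hd0 (A := A) g' n g z)).2
      have h3 : 0 ≤ (1 + 4 * σ ^ 2) ^ (n + 1) * Real.exp (-σ * z) := by positivity
      linarith⟩
  induction n generalizing g z with
  | zero =>
    have := nonneg_of_resolvent_nonneg (d := degR G g) (by linarith [h1 g]) (hbb 0 g)
      (fun z => ?_) z
    · linarith
    · have e1 := resolvent_sojournGreen_zero (A := A) h1 g' g z
      have e2 := resolvent_exp_ge hσ (h1 g) z
      have e3 : (if g = g' ∧ g ∈ A then degR G g * delta 0 z else 0)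
          ≤ degR G g * Real.exp (-σ * z) := by
        have hdg := h1 g
        have : 0 ≤ degR G g * Real.exp (-σ * z) := by positivity
        unfold delta
        split_ifs with _ hz
        · subst hz; simp
        · simpa using this
        · exact this
      rw [zero_add, pow_one]
      linarith
  | succ n ih =>
    by_cases hg : g ∈ A
    · have := nonneg_of_resolvent_nonneg (d := degR G g) (by linarith [h1 g]) (hbb (n + 1) g)
        (fun z => ?_) z
      · linarith
      · have e1 := resolvent_sojournGreen_succ (A := A) h1 g' n hg z
        have e2 := mul_le_mul_of_nonneg_left (resolvent_exp_ge hσ (h1 g) z)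
          (by positivity : 0 ≤ (1 + 4 * σ ^ 2) ^ (n + 1))
        have e3 := nbSum_mono G (g := g) fun y _ => ih y z
        rw [nbSum_const] at e3
        rw [pow_succ _ (n + 1)]
        linarith
    · rw [sojournGreen_of_notMem hg]; positivity

end Sojourn

/-- The Green function of the walk killed outside of `A × ℤ`, up to normalization. -/
def pocketGreen (G : SimpleGraph S) (A : Finset S) (g' : S) (g : S) (z : ℤ) : ℝ :=
  ∑' n, sojournGreen G A g' n g z

/-- The constants in the decay of the Green function. -/
structure PocketData (G : SimpleGraph S) (A : Finset S) (d b τ β : ℝ) : Prop where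
  one_le_deg : ∀ g, 1 ≤ degR G g
  deg_le : ∀ g, degR G g ≤ d
  d_pos : 0 < d
  b_nonneg : 0 ≤ b
  τ_pos : 0 < τ
  β_nonneg : 0 ≤ β
  kernel_le : ∀ g' k g, killedKernel G A g' k g * (√d / √((k : ℝ) + 1))
    ≤ b * (((k : ℝ) + 1) ^ (-β) * ((k : ℝ) + 1) ^ (-(1 + τ)))

namespace PocketData

variable {G : SimpleGraph S} {A : Finset S} {d b τ β : ℝ} (D : PocketData G A d b τ β)
include D

lemma summable_aux : Summable fun k : ℕ => ((k : ℝ) + 1) ^ (-(1 + τ)) := by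
  have := (summable_nat_add_iff 1).2 (Real.summable_nat_rpow.2 (by linarith [D.τ_pos] :
    -(1 + τ) < -1))
  simpa using this

lemma sojournGreen_le (g' : S) (n : ℕ) (g : S) (z : ℤ) :
    sojournGreen G A g' n g z ≤ b * (((n : ℝ) + 1) ^ (-β) * ((n : ℝ) + 1) ^ (-(1 + τ))) :=
  ((le_abs_self _).trans (abs_sojournGreen_le D.one_le_deg D.deg_le D.d_pos g' n g z)).trans
    (D.kernel_le g' n g)

lemma summable_sojournGreen (g' g : S) (z : ℤ) :
    Summable fun n => sojournGreen G A g' n g z := by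
  refine Summable.of_nonneg_of_le
    (fun n => sojournGreen_nonneg D.one_le_deg D.deg_le D.d_pos g' n g z)
    (fun n => (D.sojournGreen_le g' n g z).trans ?_) (D.summable_aux.mul_left b)
  refine mul_le_mul_of_nonneg_left ?_ D.b_nonneg
  refine mul_le_of_le_one_left (by positivity) ?_
  exact Real.rpow_le_one_of_one_le_of_nonpos (by linarith [n.cast_nonneg (α := ℝ)])
    (by linarith [D.β_nonneg])

lemma pocketGreen_nonneg (g' g : S) (z : ℤ) : 0 ≤ pocketGreen G A g' g z :=
  tsum_nonneg fun n => sojournGreen_nonneg D.one_le_deg D.deg_le D.d_pos g' n g z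

lemma pocketGreen_of_notMem {g : S} (hg : g ∉ A) (g' : S) (z : ℤ) :
    pocketGreen G A g' g z = 0 := by
  simp [pocketGreen, sojournGreen_of_notMem hg]

/-- The vertical operator at index `n + 1` produces the neighbor sum at index `n`; after summation
only the source at index 0 remains, and it is nonnegative. -/
lemma pocketGreen_superharmonic (g' : S) {g : S} (hg : g ∈ A) (z : ℤ) :
    nbSum G (fun y => pocketGreen G A g' y z) g + pocketGreen G A g' g (z + 1)
      + pocketGreen G A g' g (z - 1) ≤ pocketGreen G A g' g z * (degR G g + 2) := by
  classical
  have hs := fun y z => (D.summable_sojournGreen g' y z).hasSum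
  have hr : HasSum (fun n => (degR G g + 2) * sojournGreen G A g' n g z
      - sojournGreen G A g' n g (z + 1) - sojournGreen G A g' n g (z - 1))
      ((degR G g + 2) * pocketGreen G A g' g z - pocketGreen G A g' g (z + 1)
      - pocketGreen G A g' g (z - 1)) :=
    (((hs g z).mul_left _).sub (hs g (z + 1))).sub (hs g (z - 1))
  have hl : HasSum (fun n => nbSum G (fun y => sojournGreen G A g' n y z) g)
      (nbSum G (fun y => pocketGreen G A g' y z) g) := by
    unfold nbSum
    refine hasSum_sum fun y _ => ?_
    split_ifs
    · exact hs y z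
    · exact hasSum_zero
  have h2 : ∀ n, nbSum G (fun y => sojournGreen G A g' n y z) g
      = (degR G g + 2) * sojournGreen G A g' (n + 1) g z
      - sojournGreen G A g' (n + 1) g (z + 1) - sojournGreen G A g' (n + 1) g (z - 1) :=
    fun n => (resolvent_sojournGreen_succ D.one_le_deg g' n hg z).symm
  have h3 := (hasSum_nat_add_iff (f := fun n => (degR G g + 2) * sojournGreen G A g' n g z
      - sojournGreen G A g' n g (z + 1) - sojournGreen G A g' n g (z - 1)) 1).1
      (hl.congr_fun fun n => (h2 n).symm)
  have h4 := hr.unique h3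
  rw [Finset.sum_range_one, resolvent_sojournGreen_zero D.one_le_deg] at h4
  have h5 : 0 ≤ if g = g' ∧ g ∈ A then degR G g * delta 0 z else 0 := by
    have := D.one_le_deg g
    unfold delta
    split_ifs <;> linarith
  linarith

/-- The first sojourn alone contributes at least `deg / (deg + 2) ≥ 1 / 3`. -/
lemma one_le_three_mul_pocketGreen {g : S} (hg : g ∈ A) : 1 ≤ 3 * pocketGreen G A g g 0 := by
  classical
  have h0 := resolvent_sojournGreen_zero (A := A) D.one_le_deg g g 0
  rw [if_pos ⟨rfl, hg⟩] at h0
  have hn := fun z => sojournGreen_nonneg (A := A) D.one_le_deg D.deg_le D.d_pos g 0 g z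
  have hd := D.one_le_deg g
  have h1 : degR G g ≤ (degR G g + 2) * sojournGreen G A g 0 g 0 := by
    have := hn (0 + 1)
    have := hn (0 - 1)
    simp only [delta, if_true, mul_one] at h0
    linarith
  have h2 : sojournGreen G A g 0 g 0 ≤ pocketGreen G A g g 0 :=
    (D.summable_sojournGreen g g 0).le_tsum 0
      fun n _ => sojournGreen_nonneg D.one_le_deg D.deg_le D.d_pos g n g 0
  have h3 : 1 ≤ 3 * sojournGreen G A g 0 g 0 := by
    by_contra hcon
    rw [not_le] at hcon
    have := mul_lt_mul_of_pos_left hcon (by linarith : 0 < degR G g + 2)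
    linarith
  linarith

/-- During the first `k₀` sojourns a displacement `l` is exponentially unlikely, with `σ` taken with
the sign of `z`; the later ones are bounded by the decay of the kernel. -/
lemma pocketGreen_le {σ : ℝ} (hσ0 : 0 ≤ σ) (hσ : σ ≤ 1 / 2) (k₀ l : ℕ) (g' g : S) {z : ℤ}
    (hz : l ≤ z.natAbs) :
    pocketGreen G A g' g z ≤ k₀ * ((1 + 4 * σ ^ 2) ^ k₀ * Real.exp (-σ * l))
      + b * (((k₀ : ℝ) + 1) ^ (-β) * ∑' k : ℕ, ((k : ℝ) + 1) ^ (-(1 + τ))) := by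
  have hΘ : 1 ≤ 1 + 4 * σ ^ 2 := by nlinarith [sq_nonneg σ]
  rw [pocketGreen, ← (D.summable_sojournGreen g' g z).sum_add_tsum_nat_add k₀]
  refine add_le_add ?_ ?_
  · have : ∀ n ∈ Finset.range k₀, sojournGreen G A g' n g z
        ≤ (1 + 4 * σ ^ 2) ^ k₀ * Real.exp (-σ * l) := by
      intro n hn
      rw [Finset.mem_range] at hn
      have hzabs : (l : ℝ) ≤ |(z : ℝ)| := by
        rw [← Int.cast_abs, Int.abs_eq_natAbs]; exact_mod_cast hz
      have hp : (1 + 4 * σ ^ 2) ^ (n + 1) ≤ (1 + 4 * σ ^ 2) ^ k₀ :=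
        pow_le_pow_right₀ hΘ (by omega)
      rcases le_total 0 (z : ℝ) with h | h
      · rw [abs_of_nonneg h] at hzabs
        refine (sojournGreen_le_exp D.one_le_deg D.deg_le D.d_pos
          (by rwa [abs_of_nonneg hσ0]) g' n g z).trans ?_
        gcongr ?_ * Real.exp ?_
        nlinarith
      · rw [abs_of_nonpos h] at hzabs
        refine (sojournGreen_le_exp D.one_le_deg D.deg_le D.d_pos (σ := -σ)
          (by rwa [abs_neg, abs_of_nonneg hσ0]) g' n g z).trans ?_
        rw [neg_sq, neg_neg]
        gcongr ?_ * Real.exp ?_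
        nlinarith
    have := Finset.sum_le_card_nsmul _ _ _ this
    rwa [Finset.card_range, nsmul_eq_mul] at this
  · have hs := D.summable_aux
    have hs2 := (summable_nat_add_iff k₀).2 hs
    have hle : ∀ n : ℕ, sojournGreen G A g' (n + k₀) g z
        ≤ b * (((k₀ : ℝ) + 1) ^ (-β) * (((n + k₀ : ℕ) : ℝ) + 1) ^ (-(1 + τ))) := by
      intro n
      refine (D.sojournGreen_le g' _ g z).trans ?_
      refine mul_le_mul_of_nonneg_left (mul_le_mul_of_nonneg_right ?_ (by positivity)) D.b_nonneg
      refine Real.rpow_le_rpow_of_nonpos (by positivity) ?_ (by linarith [D.β_nonneg])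
      push_cast
      linarith [n.cast_nonneg (α := ℝ)]
    have h1 : ∑' n : ℕ, (((n + k₀ : ℕ) : ℝ) + 1) ^ (-(1 + τ))
        ≤ ∑' k : ℕ, ((k : ℝ) + 1) ^ (-(1 + τ)) := by
      rw [← hs.sum_add_tsum_nat_add k₀]
      exact le_add_of_nonneg_left (Finset.sum_nonneg fun n _ => by positivity)
    refine (Summable.tsum_le_tsum hle
      ((summable_nat_add_iff k₀).2 (D.summable_sojournGreen g' g z))
      ((hs2.mul_left _).mul_left b)).trans ?_
    rw [tsum_mul_left, tsum_mul_left]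
    exact mul_le_mul_of_nonneg_left (mul_le_mul_of_nonneg_left h1 (by positivity)) D.b_nonneg

variable [MeasurableSpace S] [MeasurableSingletonClass S]

/-- The probability to hit the box within one excursion, started from height `h'`. -/
theorem slabProb_le {V : Finset S} {v h' l k₀ : ℕ} {η σ : ℝ} (hVA : V ⊆ A)
    (hη : ∀ x : S × ℤ, x.1 ∉ A → slabProb G V v h' x ≤ η) (hη0 : 0 ≤ η)
    (hσ0 : 0 ≤ σ) (hσ : σ ≤ 1 / 2) (hl : v + l ≤ h') (g : S) (z : ℤ) (hz : z.natAbs = h') :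
    slabProb G V v h' (g, z) ≤ 3 * ((V.card * (2 * v + 1)) *
      (k₀ * ((1 + 4 * σ ^ 2) ^ k₀ * Real.exp (-σ * l))
      + b * (((k₀ : ℝ) + 1) ^ (-β) * ∑' k : ℕ, ((k : ℝ) + 1) ^ (-(1 + τ))))) + η := by
  classical
  set q := slabProb G V v h' with hq
  have hq0 : ∀ x, 0 ≤ q x := slabProb_nonneg
  set I := Finset.Icc (-(v : ℤ)) v with hI
  set W : S × ℤ → ℝ := fun x => ∑ p ∈ V ×ˢ I, pocketGreen G A p.1 x.1 (x.2 - p.2) with hW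
  have hW0 : ∀ x, 0 ≤ W x := fun x => Finset.sum_nonneg fun p _ => D.pocketGreen_nonneg _ _ _
  have hWA : ∀ x : S × ℤ, x.1 ∉ A → W x = 0 := fun x hx =>
    Finset.sum_eq_zero fun p _ => D.pocketGreen_of_notMem hx _ _
  have hWs : ∀ x : S × ℤ, x.1 ∈ A → cylSum G W x ≤ W x * (degR G x.1 + 2) := by
    intro x hx
    simp only [cylSum, hW, nbSum_finset_sum, ← Finset.sum_add_distrib, Finset.sum_mul]
    refine Finset.sum_le_sum fun p _ => ?_
    have := D.pocketGreen_superharmonic p.1 hx (x.2 - p.2)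
    rwa [show x.2 - p.2 + 1 = x.2 + 1 - p.2 by ring,
      show x.2 - p.2 - 1 = x.2 - 1 - p.2 by ring] at this
  -- On `A` the barrier is `3 * W + η`: the first term is at least 1 on the box, the constant pays
  -- for paths leaving `A`. Off `A`, where `W = 0`, already `q ≤ η`, so pasting with `q` keeps
  -- superharmonicity.
  set w : S × ℤ → ℝ := fun x => if x.1 ∈ A then min (q x) (3 * W x + η) else q x with hw
  have hwq : ∀ x, w x ≤ q x := fun x => by
    simp only [hw]; split_ifs; exacts [min_le_left _ _, le_rfl]
  have hww : ∀ x, w x ≤ 3 * W x + η := fun x => by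
    simp only [hw]
    split_ifs with h
    · exact min_le_right _ _
    · rw [hWA x h]; simpa using hη x h
  have hmain := hitProb_le G (C := box V v 0) (B := slab S h' 0) (w := w) (fun x => ?_)
    (fun x hx hxB => ?_) (fun x hxB hx => ?_) (g, z)
  · refine hmain.trans ((hww _).trans ?_)
    refine add_le_add_left (mul_le_mul_of_nonneg_left ?_ (by norm_num)) _
    have hc : ((V ×ˢ I).card : ℝ) = V.card * (2 * v + 1) := by
      rw [Finset.card_product, hI, Int.card_Icc]
      have : ((v : ℤ) + 1 - -(v : ℤ)).toNat = 2 * v + 1 := by omega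
      rw [this]; push_cast; ring
    rw [← hc, ← nsmul_eq_mul]
    refine Finset.sum_le_card_nsmul _ _ _ fun p hp => ?_
    rw [Finset.mem_product, hI, Finset.mem_Icc] at hp
    refine D.pocketGreen_le hσ0 hσ k₀ l p.1 g ?_
    simp only
    omega
  · simp only [hw]
    split_ifs
    · exact le_min (hq0 x) (by linarith [hW0 x])
    · exact hq0 x
  · have hq1 : q x = 1 := hitProb_eq_one G hx hxB
    simp only [hw]
    rw [mem_box_zero] at hx
    rw [if_pos (hVA hx.1), hq1]
    refine le_min le_rfl ?_
    have hmem : (x.1, x.2) ∈ V ×ˢ I := by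
      rw [Finset.mem_product, hI, Finset.mem_Icc]
      exact ⟨hx.1, by simp only; omega, by simp only; omega⟩
    have h2 := Finset.single_le_sum (f := fun p => pocketGreen G A p.1 x.1 (x.2 - p.2))
      (fun p _ => D.pocketGreen_nonneg _ _ _) hmem
    simp only [sub_self] at h2
    change _ ≤ W x at h2
    linarith [D.one_le_three_mul_pocketGreen (hVA hx.1)]
  · have hqx := slabProb_harmonic (G := G) hx (mem_slab_zero.1 hxB)
    have hd : 0 ≤ degR G x.1 + 2 := by linarith [degR_nonneg G x.1]
    have hle := (cylSum_mono G hwq (x := x)).trans hqx.le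
    by_cases h : x.1 ∈ A
    · have hwx : w x = min (q x) (3 * W x + η) := by simp only [hw]; rw [if_pos h]
      rw [hwx, min_mul_of_nonneg _ _ hd]
      refine le_min hle ((cylSum_mono G hww).trans ?_)
      have h2 : cylSum G (fun y => 3 * W y + η) x = 3 * cylSum G W x + η * (degR G x.1 + 2) := by
        simp only [cylSum, nbSum_add, nbSum_const_mul, nbSum_const]
        ring
      rw [h2]
      linarith [hWs x h]
    · have hwx : w x = q x := by simp only [hw]; rw [if_neg h]
      rw [hwx]; exact hle

end PocketData

/-! ### Degrees and spectral gap of the base -/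

section Base

variable {S : Type*} [Fintype S] {G : SimpleGraph S}

lemma degR_eq_ncard (g : S) : degR G g = (G.neighborSet g).ncard := by
  classical
  have : (G.neighborSet g).toFinset = Finset.univ.filter (G.Adj g) := by ext; simp
  rw [Set.ncard_eq_toFinset_card', this]
  simp [degR, nbSum]

lemma IsBase.degR_le {d₀ : ℕ} (h : IsBase d₀ G) (g : S) : degR G g ≤ d₀ := by
  rw [degR_eq_ncard]
  exact_mod_cast h.degree_le g

lemma IsBase.one_le_degR {d₀ : ℕ} (h : IsBase d₀ G) (g : S) : 1 ≤ degR G g := by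
  classical
  have : Nontrivial S := Fintype.one_lt_card_iff_nontrivial.1 h.two_le_card
  have := h.connected.preconnected.degree_pos_of_nontrivial g
  rw [degR_eq_ncard, Set.ncard_eq_toFinset_card']
  exact_mod_cast this

lemma dirichletForm_eq (f : S → ℝ) :
    dirichletForm G f = (∑ g, f g * lapl G f g) / Fintype.card S := by
  have h := sum_sq_diff G f
  unfold nbSum at h
  unfold dirichletForm
  rw [h]
  ring

lemma uniformVar_nonneg (f : S → ℝ) : 0 ≤ uniformVar f :=
  div_nonneg (Finset.sum_nonneg fun _ _ => sq_nonneg _) (Nat.cast_nonneg _)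

lemma dirichletForm_nonneg (f : S → ℝ) : 0 ≤ dirichletForm G f := by
  unfold dirichletForm
  refine mul_nonneg (by positivity) (Finset.sum_nonneg fun _ _ => Finset.sum_nonneg fun _ _ => ?_)
  split_ifs
  · positivity
  · exact le_rfl

lemma spectralGap_le {f : S → ℝ} (hf : ¬ ∃ c, ∀ g, f g = c) :
    spectralGap G ≤ dirichletForm G f / uniformVar f := by
  refine csInf_le ⟨0, ?_⟩ ⟨f, hf, rfl⟩
  rintro r ⟨f, -, rfl⟩
  exact div_nonneg (dirichletForm_nonneg f) (uniformVar_nonneg f)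

/-- For `f` of mean zero the normalizations of the Dirichlet form and of the variance cancel; only
`f = 0` escapes the variational formula. -/
lemma spectralGap_mul_le [Nonempty S] {f : S → ℝ} (hf : ∑ g, f g = 0) :
    spectralGap G * ∑ g, f g ^ 2 ≤ ∑ g, f g * lapl G f g := by
  have hN : (0 : ℝ) < Fintype.card S := by exact_mod_cast Fintype.card_pos
  have h0 : 0 ≤ ∑ g, f g * lapl G f g := by
    have := dirichletForm_nonneg (G := G) f
    rw [dirichletForm_eq] at this
    by_contra hcon
    exact absurd this (not_le.2 (div_neg_of_neg_of_pos (not_le.1 hcon) hN))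
  have hvar : uniformVar f = (∑ g, f g ^ 2) / Fintype.card S := by
    simp [uniformVar, uniformMean, hf]
  by_cases hz : ∑ g, f g ^ 2 = 0
  · rw [hz, mul_zero]; exact h0
  · have hpos : 0 < ∑ g, f g ^ 2 :=
      lt_of_le_of_ne (Finset.sum_nonneg fun g _ => sq_nonneg _) (Ne.symm hz)
    have hnc : ¬ ∃ c, ∀ g, f g = c := by
      rintro ⟨c, hc⟩
      have : c = 0 := by
        simp only [hc, Finset.sum_const, Finset.card_univ, nsmul_eq_mul] at hf
        rcases mul_eq_zero.1 hf with h | h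
        · exact absurd h hN.ne'
        · exact h
      exact hz (Finset.sum_eq_zero fun g _ => by rw [hc, this]; norm_num)
    have := spectralGap_le (G := G) hnc
    rw [dirichletForm_eq, hvar, div_div_div_cancel_right₀ hN.ne', le_div_iff₀ hpos] at this
    exact this

/-- Test the variational formula with the indicator of a vertex, whose variance is `(1 - 1 / N) / N
≥ 1 / (2 N)`. -/
lemma IsBase.spectralGap_le_two_mul {d₀ : ℕ} (h : IsBase d₀ G) : spectralGap G ≤ 2 * d₀ := by
  classical
  have hne : Nonempty S := h.connected.nonempty
  have : Nontrivial S := Fintype.one_lt_card_iff_nontrivial.1 h.two_le_card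
  obtain ⟨g₀, g₁, hg⟩ := exists_pair_ne S
  set N : ℝ := (Fintype.card S : ℝ) with hN
  have hN2 : 2 ≤ N := by rw [hN]; exact_mod_cast h.two_le_card
  set f : S → ℝ := fun g => if g = g₀ then 1 else 0 with hf
  have hnc : ¬ ∃ c, ∀ g, f g = c := by
    rintro ⟨c, hc⟩
    have h0 := hc g₀
    have h1 := hc g₁
    simp only [hf, if_true, if_neg hg.symm] at h0 h1
    linarith
  have hsum : ∑ g, f g = 1 := by simp [hf]
  have hsq : ∑ g, f g ^ 2 = 1 := by simp [hf]
  have hlapl : ∑ g, f g * lapl G f g = degR G g₀ := by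
    simp only [hf, ite_mul, one_mul, zero_mul, Finset.sum_ite_eq', Finset.mem_univ, if_true]
    rw [lapl, if_pos rfl, mul_one, sub_eq_self]
    unfold nbSum
    refine Finset.sum_eq_zero fun y _ => ?_
    by_cases hy : y = g₀ <;> simp [hy]
  have hvar : uniformVar f = (1 - 1 / N) / N := by
    have hm : uniformMean f = 1 / N := by rw [uniformMean, hsum]
    rw [uniformVar, uniformMean, hm]
    congr 1
    have : ∀ g, (f g - 1 / N) ^ 2 = f g ^ 2 - 2 / N * f g + (1 / N) ^ 2 := fun g => by ring
    simp only [this, Finset.sum_add_distrib, Finset.sum_sub_distrib, ← Finset.mul_sum, hsum, hsq,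
      Finset.sum_const, Finset.card_univ, nsmul_eq_mul]
    rw [← hN]
    field_simp
    ring
  refine (spectralGap_le hnc).trans ?_
  rw [dirichletForm_eq, hlapl, hvar, div_div_div_cancel_right₀ (by positivity)]
  have h3 : (1 : ℝ) / 2 ≤ 1 - 1 / N := by
    have : 1 / N ≤ 1 / 2 := one_div_le_one_div_of_le (by norm_num) hN2
    linarith
  rw [div_le_iff₀ (by linarith)]
  have := h.degR_le g₀
  have h0 : (0 : ℝ) ≤ d₀ := Nat.cast_nonneg _
  nlinarith

end Base

/-! ### Choice of the time scales -/

/-- `n` is large, depending on `κ` and `C`. -/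
structure IsLarge (κ C n : ℝ) : Prop where
  one_lt : 1 < n
  const_le : C ≤ n ^ κ
  log_le : C * Real.log n ≤ n ^ κ
  le_log : C ≤ Real.log n

lemma eventually_isLarge {κ : ℝ} (hκ : 0 < κ) (C : ℝ) :
    ∀ᶠ n : ℕ in Filter.atTop, IsLarge κ C n := by
  have h1 : ∀ᶠ n : ℝ in Filter.atTop, IsLarge κ C n := by
    have hlog : ∀ᶠ n : ℝ in Filter.atTop, C * Real.log n ≤ n ^ κ := by
      have hlo := (isLittleO_log_rpow_atTop hκ).def (c := (|C| + 1)⁻¹) (by positivity)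
      filter_upwards [hlo, Filter.eventually_gt_atTop 1] with n hn hn1
      have hl : 0 ≤ Real.log n := Real.log_nonneg hn1.le
      rw [Real.norm_of_nonneg hl, Real.norm_of_nonneg (by positivity), inv_mul_eq_div,
        le_div_iff₀ (by positivity)] at hn
      nlinarith [le_abs_self C]
    filter_upwards [Filter.eventually_gt_atTop 1, hlog,
      (tendsto_rpow_atTop hκ).eventually_ge_atTop C,
      Real.tendsto_log_atTop.eventually_ge_atTop C] with n a1 a2 a3 a4
    exact ⟨a1, a3, a2, a4⟩
  exact tendsto_natCast_atTop_atTop.eventually h1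

/-! ### Scales -/

lemma one_sub_pow_le_exp {x : ℝ} (hx : x ≤ 1) (k : ℕ) : (1 - x) ^ k ≤ Real.exp (-(x * k)) := by
  have h := Real.add_one_le_exp (-x)
  calc (1 - x) ^ k ≤ Real.exp (-x) ^ k := pow_le_pow_left₀ (by linarith) (by linarith) k
    _ = Real.exp (-(x * k)) := by rw [← Real.exp_nat_mul]; congr 1; ring

lemma exp_neg_mul_log {n : ℝ} (hn : 0 < n) (c : ℝ) : Real.exp (-(c * Real.log n)) = n ^ (-c) := by
  rw [Real.rpow_def_of_pos hn]; congr 1; ring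

lemma sqrt_le_of_one_le {x : ℝ} (hx : 1 ≤ x) : √x ≤ x :=
  Real.sqrt_le_iff.2 ⟨by linarith, by nlinarith⟩

/-- Time scales adapted to the spectral gap of the base and to the horizon `n ^ (2 (1 - δ))`. -/
structure Scales {S : Type*} [Fintype S] (G : SimpleGraph S) (d₀ : ℕ) (δ κ : ℝ) (ε ε₀ : ℝ)
    (n₀ : ℕ) : Prop where
  mixing : MixingData G d₀ (2 * (d₀ + 2)) (spectralGap G) ε ε₀ n₀
    ⌈(Fintype.card S : ℝ) ^ (2 * (1 - δ))⌉₊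
  inv_eps_le : 1 / ε ≤ 4 * (2 * (d₀ + 2)) * (Fintype.card S : ℝ) ^ (1 - δ)
  inv_eps₀_le : 1 / ε₀ ≤ (Fintype.card S : ℝ) ^ κ * spectralGap G ^ (-(1 / 2) : ℝ)
  contraction_le : (1 - spectralGap G / (2 * (2 * (d₀ + 2)))) ^ n₀ ≤ (Fintype.card S : ℝ) ^ (-5 : ℝ)
  inv_gap_le : 1 / spectralGap G ≤ (Fintype.card S : ℝ) ^ (3 : ℝ)
  height_pow_le : (1 - ε₀) ^ height G ≤ (Fintype.card S : ℝ) ^ (-5 : ℝ)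

set_option maxHeartbeats 400000 in
lemma exists_scales {S : Type*} [Fintype S] {G : SimpleGraph S} {d₀ : ℕ} {δ κ C : ℝ}
    (hδ0 : 0 < δ) (hδ : δ < 1 / 2) (hbase : IsBase d₀ G) (hgap : ¬ LowGap δ G)
    (hl : IsLarge κ C (Fintype.card S)) (hC : 400 * (d₀ + 2) ≤ C) :
    ∃ ε ε₀ n₀, Scales G d₀ δ κ ε ε₀ n₀ := by
  have hne : Nonempty S := hbase.connected.nonempty
  set n : ℝ := (Fintype.card S : ℝ) with hn
  set M : ℝ := 2 * (d₀ + 2) with hM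
  set lam := spectralGap G with hlam
  set L := Real.log n with hL
  have hn1 : 1 < n := hl.one_lt
  have hn0 : 0 < n := by linarith
  have hd0 : (0 : ℝ) ≤ d₀ := Nat.cast_nonneg _
  have hM4 : 4 ≤ M := by rw [hM]; linarith
  have hCM : 200 * M ≤ C := by rw [hM]; linarith
  have hLM : 200 * M ≤ L := hCM.trans hl.le_log
  have hL1 : 1 ≤ L := by linarith
  have hgap' : n ^ (-2 * (1 - δ)) * L⁻¹ < lam := not_le.1 hgap
  have hlam0 : 0 < lam := lt_of_le_of_lt (by positivity) hgap'
  have hlamM : lam ≤ M := by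
    have := hbase.spectralGap_le_two_mul
    rw [hM]; linarith
  -- Chosen so that `lam / (2 * M) * X = 5 * log n`: by time `n₀` the contraction reaches `n ^
  -- (-5)`.
  set X := 10 * M * L / lam with hX
  have hX1 : 10 ≤ X := by
    rw [hX, le_div_iff₀ hlam0]
    have := le_mul_of_one_le_right (by linarith : 0 ≤ M) hL1
    linarith
  set n₀ := ⌈X⌉₊ with hn₀
  have hn₀l : X ≤ n₀ := Nat.le_ceil X
  have hn₀u : (n₀ : ℝ) ≤ 2 * X := by
    have := Nat.ceil_lt_add_one (by linarith : 0 ≤ X)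
    linarith
  have hs0 : 0 < √(2 * n₀ : ℝ) := Real.sqrt_pos.2 (by linarith)
  -- Gives equality in `n₀ * ε₀ ^ 2 ≤ 1 / 2`; `1 / ε₀` is the order of the vertical displacement up
  -- to mixing.
  set ε₀ := 1 / √(2 * n₀ : ℝ) with hε₀
  have hε₀0 : 0 < ε₀ := by positivity
  have hε₀sq : ε₀ ^ 2 = 1 / (2 * n₀) := by
    rw [hε₀, div_pow, Real.sq_sqrt (by positivity), one_pow]
  have hε₀2 : ε₀ ≤ 1 / 2 := by
    rw [hε₀]
    refine one_div_le_one_div_of_le (by norm_num) (Real.le_sqrt_of_sq_le ?_)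
    linarith
  have hinv₀ : 1 / ε₀ = √(2 * n₀ : ℝ) := by rw [hε₀, one_div_one_div]
  set t := n ^ (2 * (1 - δ)) with ht
  have ht1 : 1 ≤ t := Real.one_le_rpow hn1.le (by linarith)
  set T := ⌈t⌉₊ with hT
  have hT1 : 1 ≤ T := Nat.one_le_ceil_iff.2 (by linarith)
  have hT1' : (1 : ℝ) ≤ T := by exact_mod_cast hT1
  have hTu : (T : ℝ) ≤ 2 * t := by
    have := Nat.ceil_lt_add_one (by linarith : 0 ≤ t)
    linarith
  have hMT : 1 ≤ M * T := one_le_mul_of_one_le_of_one_le (by linarith) hT1'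
  have hsMT : 1 ≤ √(M * T) := Real.one_le_sqrt.2 hMT
  -- Gives equality in `T * (2 * M * ε ^ 2) ≤ 1 / 2`.
  set ε := 1 / (2 * √(M * T)) with hε
  have hε0 : 0 < ε := by positivity
  have hεsq : ε ^ 2 = 1 / (4 * (M * T)) := by
    rw [hε, div_pow, mul_pow, Real.sq_sqrt (by positivity), one_pow]; norm_num
  have hinvε : 1 / ε = 2 * √(M * T) := by rw [hε, one_div_one_div]
  have hsqrt_le : √(2 * n₀ : ℝ) ≤ √(40 * M) * √(L / lam) := by
    rw [← Real.sqrt_mul (by linarith)]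
    refine Real.sqrt_le_sqrt ?_
    calc (2 * n₀ : ℝ) ≤ 4 * X := by linarith
      _ = 40 * M * (L / lam) := by rw [hX]; ring
  refine ⟨ε, ε₀, n₀, ?_, ?_, ?_, ?_, ?_, ?_⟩
  · refine ⟨hbase.degR_le, hd0, le_rfl, hlam0, hlamM, fun f hf => spectralGap_mul_le hf, hε0, ?_,
      hε₀0, hε₀2, ?_, ?_, hT1⟩
    · rw [hε]
      exact one_div_le_one_div_of_le (by norm_num) (by linarith)
    · rw [hε₀sq]
      have : (n₀ : ℝ) ≠ 0 := by linarith
      apply le_of_eq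
      field_simp
    · change (T : ℝ) * (2 * M * ε ^ 2) ≤ 1 / 2
      rw [hεsq]
      apply le_of_eq
      field_simp
      norm_num
  · rw [hinvε]
    have h1 : √t = n ^ (1 - δ) := by
      rw [ht, Real.sqrt_eq_rpow, ← Real.rpow_mul hn0.le]; congr 1; ring
    have h2 : √(M * T) ≤ √(2 * M) * √t := by
      rw [← Real.sqrt_mul (by linarith)]
      refine Real.sqrt_le_sqrt ?_
      have := mul_le_mul_of_nonneg_left hTu (by linarith : 0 ≤ M)
      linarith
    have h3 : √(2 * M) ≤ 2 * M := sqrt_le_of_one_le (by linarith)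
    rw [h1] at h2
    have h4 : 0 ≤ n ^ (1 - δ) := by positivity
    have := mul_le_mul_of_nonneg_right h3 h4
    linarith
  · rw [hinv₀]
    have h1 : √(L / lam) = √L * lam ^ (-(1 / 2) : ℝ) := by
      rw [Real.sqrt_div' _ hlam0.le, Real.rpow_neg hlam0.le, ← Real.sqrt_eq_rpow,
        div_eq_mul_inv]
    refine hsqrt_le.trans ?_
    rw [h1, ← mul_assoc, ← Real.sqrt_mul (by linarith)]
    refine mul_le_mul_of_nonneg_right ?_ (by positivity)
    have h2 : 1 ≤ 40 * M * L := one_le_mul_of_one_le_of_one_le (by linarith) hL1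
    have h3 : 40 * M * L ≤ C * L := mul_le_mul_of_nonneg_right (by linarith) (by linarith)
    exact (sqrt_le_of_one_le h2).trans (h3.trans hl.log_le)
  · have hx : lam / (2 * M) ≤ 1 := by
      rw [div_le_one (by positivity)]; linarith
    refine (one_sub_pow_le_exp hx n₀).trans ?_
    rw [← exp_neg_mul_log hn0]
    refine Real.exp_le_exp.2 (neg_le_neg ?_)
    calc 5 * Real.log n = lam / (2 * M) * X := by rw [hX]; field_simp; ring
      _ ≤ lam / (2 * M) * n₀ := mul_le_mul_of_nonneg_left hn₀l (by positivity)
  · have h1 : L ≤ n := (Real.log_le_sub_one_of_pos hn0).trans (by linarith)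
    have h2 : n ^ (-2 : ℝ) * n⁻¹ ≤ n ^ (-2 * (1 - δ)) * L⁻¹ := by
      refine mul_le_mul (Real.rpow_le_rpow_of_exponent_le hn1.le (by linarith))
        (inv_anti₀ (by linarith) h1) (by positivity) (by positivity)
    have h3 : n ^ (-3 : ℝ) = n ^ (-2 : ℝ) * n⁻¹ := by
      rw [← Real.rpow_neg_one, ← Real.rpow_add hn0]; norm_num
    rw [div_le_iff₀ hlam0]
    have h4 : n ^ (3 : ℝ) * n ^ (-3 : ℝ) = 1 := by rw [← Real.rpow_add hn0]; norm_num
    rw [← h4]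
    exact mul_le_mul_of_nonneg_left (by rw [h3]; exact h2.trans hgap'.le) (by positivity)
  · refine (one_sub_pow_le_exp (by linarith) _).trans ?_
    rw [← exp_neg_mul_log hn0]
    refine Real.exp_le_exp.2 (neg_le_neg ?_)
    -- The squared logarithm in `height` is what makes the vertical decay negligible: `1 / ε₀ ≤ 40 M
    -- √(L / lam)`, so `ε₀ * height G ≥ L² / (40 M) ≥ 5 L` since `L ≥ 200 M`.
    have hh : √(L / lam) * L ^ 2 ≤ height G := by
      have h1 : √(L / lam) ≤ √(relaxTime G) := by
        refine Real.sqrt_le_sqrt ?_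
        unfold relaxTime
        rw [div_eq_inv_mul]
        exact mul_le_mul_of_nonneg_left (Real.log_le_log hn0 (by linarith)) (by positivity)
      have h2 := Nat.lt_floor_add_one (√(relaxTime G) * L ^ 2)
      have h3 : √(L / lam) * L ^ 2 ≤ √(relaxTime G) * L ^ 2 :=
        mul_le_mul_of_nonneg_right h1 (sq_nonneg _)
      have h4 : (height G : ℝ) = 2 * ((⌊√(relaxTime G) * L ^ 2⌋₊ : ℝ) + 1) := by
        simp only [height]; push_cast; rfl
      rw [h4]
      have : (0 : ℝ) ≤ ⌊√(relaxTime G) * L ^ 2⌋₊ := Nat.cast_nonneg _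
      linarith
    have h40 : √(40 * M) ≤ 40 * M := sqrt_le_of_one_le (by linarith)
    have h5 : 1 ≤ ε₀ * (40 * M * √(L / lam)) := by
      rw [hε₀, div_mul_eq_mul_div, one_mul, le_div_iff₀ hs0, one_mul]
      exact hsqrt_le.trans (mul_le_mul_of_nonneg_right h40 (Real.sqrt_nonneg _))
    have h6 : 5 * L * (40 * M) ≤ L ^ 2 := by
      have := mul_le_mul_of_nonneg_right hLM (by linarith : 0 ≤ L)
      linarith
    have h7 : 5 * L * (40 * M) * 1 ≤ L ^ 2 * (ε₀ * (40 * M * √(L / lam))) :=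
      mul_le_mul h6 h5 (by norm_num) (by positivity)
    have h8 : L ^ 2 * (ε₀ * (40 * M * √(L / lam))) = (ε₀ * (√(L / lam) * L ^ 2)) * (40 * M) := by
      ring
    rw [h8, mul_one] at h7
    have h9 := le_of_mul_le_mul_right h7 (by linarith)
    exact h9.trans (mul_le_mul_of_nonneg_left hh hε₀0.le)

/-! ### Hitting the box from outside a slab of full height -/

lemma IsLarge.pos {κ C n : ℝ} (h : IsLarge κ C n) : 0 < n := by linarith [h.one_lt]

lemma IsLarge.mul_rpow_le {κ C n : ℝ} (h : IsLarge κ C n) {c e e' : ℝ} (hc : c ≤ C)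
    (he : κ + e ≤ e') : c * n ^ e ≤ n ^ e' :=
  calc c * n ^ e ≤ n ^ κ * n ^ e :=
        mul_le_mul_of_nonneg_right (hc.trans h.const_le) (Real.rpow_nonneg h.pos.le _)
    _ = n ^ (κ + e) := (Real.rpow_add h.pos _ _).symm
    _ ≤ n ^ e' := Real.rpow_le_rpow_of_exponent_le h.one_lt.le he

section

variable {S : Type*} [Fintype S] [MeasurableSpace S] [MeasurableSingletonClass S]
  {G : SimpleGraph S} {A V : Finset S} {v d₀ : ℕ} {δ δ' γ a : ℝ}

lemma box_card_le (hV : (V.card : ℝ) ≤ (Fintype.card S : ℝ) ^ (δ / 8)) (hv : v ≤ V.card) :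
    (V.card : ℝ) * (2 * v + 1) ≤ 3 * (Fintype.card S : ℝ) ^ (δ / 4) := by
  have h1 : V.card * (2 * v + 1) ≤ 3 * (V.card * V.card) := by nlinarith
  have h2 : (V.card : ℝ) * (2 * v + 1) ≤ 3 * (V.card * V.card) := by exact_mod_cast h1
  refine h2.trans (mul_le_mul_of_nonneg_left ?_ (by norm_num))
  calc (V.card : ℝ) * V.card
      ≤ (Fintype.card S : ℝ) ^ (δ / 8) * (Fintype.card S : ℝ) ^ (δ / 8) := by gcongr
    _ = (Fintype.card S : ℝ) ^ (δ / 4) := by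
      rw [← Real.mul_rpow (by positivity) (by positivity), ← sq, ← Real.rpow_natCast,
        ← Real.rpow_mul (by positivity)]
      congr 1; push_cast; ring

/-- Hitting probability when the height of the slab exceeds the mixing scale. -/
lemma Scales.hit_le_of_height {κ C ε ε₀ : ℝ} {n₀ : ℕ} (hs : Scales G d₀ δ κ ε ε₀ n₀)
    (hδ0 : 0 < δ) (hδ : δ < 1 / 2) (hκ : κ ≤ δ / 64)
    (hl : IsLarge κ C (Fintype.card S)) (hC : 100 * (d₀ + 2) ^ 2 ≤ C)
    (hne : V.Nonempty) (hV : (V.card : ℝ) ≤ (Fintype.card S : ℝ) ^ (δ / 8)) (hv : v ≤ V.card)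
    (hvh : v ≤ height G) (u : ℤ) (y : S × ℤ) (hy : y ∉ slab S (height G) u) :
    (walkLaw (cylinderGraph G) y).real
      {ω | ∃ n < ⌈(Fintype.card S : ℝ) ^ (2 * (1 - δ))⌉₊, ω n ∈ box V v u}
      ≤ (Fintype.card S : ℝ) ^ (-(δ / 4)) := by
  have : Nonempty S := ⟨hne.choose⟩
  have hn0 := hl.pos
  set n : ℝ := (Fintype.card S : ℝ) with hn
  set M : ℝ := 2 * ((d₀ : ℝ) + 2) with hM
  set lam := spectralGap G with hlam
  have hd0 : (0 : ℝ) ≤ d₀ := Nat.cast_nonneg _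
  have hM4 : 4 ≤ M := by rw [hM]; linarith
  have hCM : 25 * M ^ 2 ≤ C := by
    have : 25 * M ^ 2 = 100 * ((d₀ : ℝ) + 2) ^ 2 := by rw [hM]; ring
    rw [this]; exact hC
  have hMM : M ≤ M ^ 2 := by nlinarith
  have hlam0 : 0 < lam := hs.mixing.lam_pos
  have hε := hs.mixing.eps_pos
  have hε₀ := hs.mixing.eps₀_pos
  -- The slab has half-height `2 * height G - 1` and `v ≤ height G`, so a full `height G` separates
  -- `y` from the box.
  have hdist : v + height G ≤ (y.2 - u).natAbs := by
    change ¬ (|y.2 - u| ≤ 2 * (height G : ℤ) - 1) at hy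
    rw [Int.abs_eq_natAbs] at hy
    omega
  refine (hs.mixing.walkLaw_hit_box_le V v u (height G) y hdist).trans ?_
  have hcard := box_card_le hV hv
  have h2v : (2 * (v : ℝ) + 1) ≤ 3 * n ^ (δ / 4) := by
    refine le_trans ?_ hcard
    have : (1 : ℝ) ≤ V.card := by exact_mod_cast hne.card_pos
    exact le_mul_of_one_le_left (by positivity) this
  have hlam12 : lam ^ (-(1 / 2) : ℝ) ≤ n ^ (3 / 2 : ℝ) := by
    have h1 := Real.rpow_le_rpow (by positivity) hs.inv_gap_le (by norm_num : (0 : ℝ) ≤ 1 / 2)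
    rw [one_div, Real.inv_rpow hlam0.le, ← Real.rpow_neg hlam0.le, ← Real.rpow_mul hn0.le] at h1
    refine h1.trans (le_of_eq ?_)
    norm_num
  have ha : (2 * (v : ℝ) + 1) * (2 * (M / ε₀ * (1 - ε₀) ^ height G)) ≤ n ^ (-(δ / 2)) := by
    calc (2 * (v : ℝ) + 1) * (2 * (M / ε₀ * (1 - ε₀) ^ height G))
        = (2 * (v : ℝ) + 1) * (2 * (M * (1 / ε₀) * (1 - ε₀) ^ height G)) := by ring
      _ ≤ (3 * n ^ (δ / 4)) * (2 * (M * (n ^ κ * n ^ (3 / 2 : ℝ)) * n ^ (-5 : ℝ))) := by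
          have h0 : 0 ≤ 1 - ε₀ := by linarith [hs.mixing.eps₀_le]
          have h1 : 1 / ε₀ ≤ n ^ κ * n ^ (3 / 2 : ℝ) :=
            hs.inv_eps₀_le.trans (mul_le_mul_of_nonneg_left hlam12 (by positivity))
          have h2 := hs.height_pow_le
          gcongr
      _ = (6 * M) * n ^ (δ / 4 + κ + 3 / 2 + -5) := by
          rw [Real.rpow_add hn0, Real.rpow_add hn0, Real.rpow_add hn0]; ring
      _ ≤ n ^ (-(δ / 2)) := hl.mul_rpow_le (by nlinarith) (by linarith)
  -- The leading term, of order `n ^ (δ/4) * n⁻¹ * n ^ (1 - δ)`: the mixed walk meets a box of that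
  -- size.
  have hb : (2 * (v : ℝ) + 1) * (V.card / n * (M / ε)) ≤ n ^ (-(δ / 2)) := by
    calc (2 * (v : ℝ) + 1) * (V.card / n * (M / ε))
        = (V.card * (2 * (v : ℝ) + 1)) * (n⁻¹ * (M * (1 / ε))) := by ring
      _ ≤ (3 * n ^ (δ / 4)) * (n⁻¹ * (M * (4 * M * n ^ (1 - δ)))) := by
          have h1 := hs.inv_eps_le
          gcongr
      _ = (12 * M ^ 2) * n ^ (δ / 4 + -1 + (1 - δ)) := by
          rw [Real.rpow_add hn0, Real.rpow_add hn0, Real.rpow_neg_one]; ring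
      _ ≤ n ^ (-(δ / 2)) := hl.mul_rpow_le (by linarith [sq_nonneg M]) (by linarith)
  have hc : (2 * (v : ℝ) + 1) * (V.card * ((1 - lam / (2 * M)) ^ n₀ * (2 * M / lam)))
      ≤ n ^ (-(δ / 2)) := by
    calc (2 * (v : ℝ) + 1) * (V.card * ((1 - lam / (2 * M)) ^ n₀ * (2 * M / lam)))
        = (V.card * (2 * (v : ℝ) + 1)) * ((1 - lam / (2 * M)) ^ n₀ * (2 * M * (1 / lam))) := by
          ring
      _ ≤ (3 * n ^ (δ / 4)) * (n ^ (-5 : ℝ) * (2 * M * n ^ (3 : ℝ))) := by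
          have h1 := hs.contraction_le
          have h2 := hs.inv_gap_le
          have h3 : 0 ≤ (1 - lam / (2 * M)) ^ n₀ := by
            have : lam / (2 * M) ≤ 1 := by
              rw [div_le_one (by positivity)]; linarith [hs.mixing.lam_le]
            exact pow_nonneg (by linarith) _
          gcongr
      _ = (6 * M) * n ^ (δ / 4 + -5 + 3) := by
          rw [Real.rpow_add hn0, Real.rpow_add hn0]; ring
      _ ≤ n ^ (-(δ / 2)) := hl.mul_rpow_le (by nlinarith) (by linarith)
  have hfin : 6 * n ^ (-(δ / 2)) ≤ n ^ (-(δ / 4)) :=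
    hl.mul_rpow_le (by nlinarith) (by linarith)
  linarith

end

/-! ### Hitting the box from outside a slab of the size of the pocket -/

/-- The escape term of the pocket Green function, for the horizon `k₀ = [(h/2s)²]`. -/
lemma escape_term_le {n s h l : ℝ} (hn : 1 ≤ n) (hs : 15 * Real.log n ≤ s) (hs1 : 1 ≤ s)
    (hh : 2 * s ≤ h) (hhn : h ≤ n) (hl : h / 3 ≤ l) :
    (⌊1 / (4 * (s / h) ^ 2)⌋₊ : ℝ) *
      ((1 + 4 * (s / h) ^ 2) ^ ⌊1 / (4 * (s / h) ^ 2)⌋₊ * Real.exp (-(s / h) * l))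
      ≤ 3 * n ^ (-3 : ℝ) := by
  have hn0 : 0 < n := by linarith
  have hh0 : 0 < h := by linarith
  have hs0 : 0 < s := by linarith
  set σ := s / h with hσ
  have hσ0 : 0 < σ := div_pos hs0 hh0
  set k := ⌊1 / (4 * σ ^ 2)⌋₊ with hk
  have hk1 : (k : ℝ) ≤ 1 / (4 * σ ^ 2) := Nat.floor_le (by positivity)
  -- The horizon `k ≤ 1 / (4 σ²)` is the longest for which the exponential moments of all sojourns
  -- cost only a constant.
  have h1 : (1 + 4 * σ ^ 2) ^ k ≤ 3 := by
    calc (1 + 4 * σ ^ 2) ^ k ≤ Real.exp (4 * σ ^ 2) ^ k := by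
          refine pow_le_pow_left₀ (by positivity) ?_ k
          linarith [Real.add_one_le_exp (4 * σ ^ 2)]
      _ = Real.exp (k * (4 * σ ^ 2)) := by rw [← Real.exp_nat_mul]
      _ ≤ Real.exp 1 := by
          refine Real.exp_le_exp.2 ?_
          rwa [le_div_iff₀ (by positivity)] at hk1
      _ ≤ 3 := by linarith [Real.exp_one_lt_d9]
  have h2 : (k : ℝ) ≤ n ^ (2 : ℝ) := by
    refine hk1.trans ?_
    have h3 : 1 / (4 * σ ^ 2) = h ^ 2 / (4 * s ^ 2) := by rw [hσ]; field_simp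
    rw [h3, Real.rpow_two]
    calc h ^ 2 / (4 * s ^ 2) ≤ h ^ 2 := div_le_self (sq_nonneg _) (by nlinarith)
      _ ≤ n ^ 2 := pow_le_pow_left₀ hh0.le hhn 2
  have h3 : Real.exp (-σ * l) ≤ n ^ (-5 : ℝ) := by
    rw [← exp_neg_mul_log hn0]
    refine Real.exp_le_exp.2 ?_
    have : σ * (h / 3) = s / 3 := by rw [hσ]; field_simp
    have := mul_le_mul_of_nonneg_left hl hσ0.le
    linarith
  calc (k : ℝ) * ((1 + 4 * σ ^ 2) ^ k * Real.exp (-σ * l))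
      ≤ n ^ (2 : ℝ) * (3 * n ^ (-5 : ℝ)) := by gcongr
    _ = 3 * n ^ (2 + -5 : ℝ) := by rw [Real.rpow_add hn0]; ring
    _ = 3 * n ^ (-3 : ℝ) := by norm_num

/-- The tail term of the pocket Green function, for the horizon `k₀ = [(h/2s)²]`. -/
lemma tail_term_le {n s h B γ τ : ℝ} (hs : 0 < s) (hB : 0 < B) (hBh : B / 2 ≤ h) (hhn : h ≤ n)
    (hτ : 0 ≤ τ) (hτγ : τ ≤ γ - 1 / 2) :
    ((⌊1 / (4 * (s / h) ^ 2)⌋₊ : ℝ) + 1) ^ (-(γ - 1 / 2 - τ)) / h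
      ≤ 4 ^ (2 * γ) * s ^ (2 * γ - 1 - 2 * τ) * n ^ (2 * τ) * B ^ (-(2 * γ)) := by
  have hh : 0 < h := by linarith
  have hn : 0 < n := by linarith
  set β := γ - 1 / 2 - τ with hβ
  have hβ0 : 0 ≤ β := by linarith
  have h1 : (h / (2 * s)) ^ (2 : ℝ) ≤ (⌊1 / (4 * (s / h) ^ 2)⌋₊ : ℝ) + 1 := by
    have : (h / (2 * s)) ^ (2 : ℝ) = 1 / (4 * (s / h) ^ 2) := by
      rw [Real.rpow_two]; field_simp; norm_num
    rw [this]
    exact (Nat.lt_floor_add_one _).le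
  have h2 : ((⌊1 / (4 * (s / h) ^ 2)⌋₊ : ℝ) + 1) ^ (-β) ≤ (h / (2 * s)) ^ (-(2 * β)) := by
    refine (Real.rpow_le_rpow_of_nonpos (by positivity) h1 (by linarith)).trans (le_of_eq ?_)
    rw [← Real.rpow_mul (by positivity)]; congr 1; ring
  have h3 : (h / (2 * s)) ^ (-(2 * β)) = h ^ (-(2 * β)) * (2 ^ (2 * β) * s ^ (2 * β)) := by
    rw [Real.rpow_neg (by positivity), Real.div_rpow hh.le (by positivity),
      Real.mul_rpow (by norm_num) hs.le, Real.rpow_neg hh.le]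
    field_simp
  -- Power counting: per unit of height the tail is `h ^ (-2γ)`, up to the loss `h ^ (2τ)`.
  have h4 : h ^ (-(2 * β)) / h = h ^ (2 * τ) * h ^ (-(2 * γ)) := by
    rw [← Real.rpow_sub_one hh.ne', ← Real.rpow_add hh]; congr 1; rw [hβ]; ring
  have h5 : h ^ (-(2 * γ)) ≤ 2 ^ (2 * γ) * B ^ (-(2 * γ)) := by
    refine (Real.rpow_le_rpow_of_nonpos (by positivity) hBh (by linarith)).trans (le_of_eq ?_)
    rw [Real.div_rpow hB.le (by norm_num), Real.rpow_neg (by norm_num : (0 : ℝ) ≤ 2)]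
    field_simp
  have h6 : h ^ (2 * τ) ≤ n ^ (2 * τ) := Real.rpow_le_rpow hh.le hhn (by linarith)
  have h7 : (2 : ℝ) ^ (2 * β) ≤ 2 ^ (2 * γ) :=
    Real.rpow_le_rpow_of_exponent_le (by norm_num) (by linarith)
  have h8 : (4 : ℝ) ^ (2 * γ) = 2 ^ (2 * γ) * 2 ^ (2 * γ) := by
    rw [← Real.mul_rpow (by norm_num) (by norm_num)]; norm_num
  have h9 : 2 * γ - 1 - 2 * τ = 2 * β := by rw [hβ]; ring
  rw [h9]
  calc ((⌊1 / (4 * (s / h) ^ 2)⌋₊ : ℝ) + 1) ^ (-β) / h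
      ≤ (h ^ (-(2 * β)) * (2 ^ (2 * β) * s ^ (2 * β))) / h := by
        rw [← h3]; gcongr
    _ = (h ^ (2 * τ) * h ^ (-(2 * γ))) * (2 ^ (2 * β) * s ^ (2 * β)) := by rw [← h4]; ring
    _ ≤ (n ^ (2 * τ) * (2 ^ (2 * γ) * B ^ (-(2 * γ)))) * (2 ^ (2 * γ) * s ^ (2 * β)) := by
        gcongr
    _ = _ := by rw [h8]; ring

section

variable {S : Type*} [Fintype S] [MeasurableSpace S] [MeasurableSingletonClass S]
  {G : SimpleGraph S} {A V : Finset S} {v d₀ : ℕ} {δ δ' γ a κ C : ℝ}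

/-- The real number whose integer part is compared with the height. -/
def pocketRadius (δ γ : ℝ) (A : Finset S) : ℝ :=
  (√(A.card : ℝ) * (Fintype.card S : ℝ) ^ (-(δ / 8))) ^ (1 / γ)

/-- The exponent `1 / γ` in the radius is made for this: a tail of order `h ^ (-2γ)` becomes
inversely proportional to the volume of the pocket. -/
lemma pocketRadius_rpow (hγ : γ ≠ 0) :
    pocketRadius δ γ A ^ (-(2 * γ)) = (A.card : ℝ)⁻¹ * (Fintype.card S : ℝ) ^ (δ / 4) := by
  rw [pocketRadius, ← Real.rpow_mul (by positivity)]
  have : 1 / γ * -(2 * γ) = -(2 : ℕ) := by push_cast; field_simp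
  rw [this, Real.rpow_neg (by positivity), Real.rpow_natCast, mul_pow,
    Real.sq_sqrt (by positivity), mul_inv, ← Real.rpow_natCast, ← Real.rpow_mul (by positivity),
    ← Real.rpow_neg (by positivity)]
  congr 2; push_cast; ring

lemma pocketRadius_le (hδ : 0 ≤ δ) (hγ : 1 / 2 < γ) (hn : 1 ≤ (Fintype.card S : ℝ)) :
    pocketRadius δ γ A ≤ Fintype.card S := by
  have hn0 : (0 : ℝ) < Fintype.card S := by linarith
  have h1 : √(A.card : ℝ) * (Fintype.card S : ℝ) ^ (-(δ / 8)) ≤ (Fintype.card S : ℝ) ^ (1 / 2 : ℝ) := by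
    have h2 : √(A.card : ℝ) ≤ √(Fintype.card S : ℝ) :=
      Real.sqrt_le_sqrt (by exact_mod_cast A.card_le_univ)
    have h3 : (Fintype.card S : ℝ) ^ (-(δ / 8)) ≤ 1 :=
      Real.rpow_le_one_of_one_le_of_nonpos hn (by linarith)
    rw [← Real.sqrt_eq_rpow]
    calc _ ≤ √(Fintype.card S : ℝ) * 1 := by gcongr
      _ = _ := mul_one _
  calc pocketRadius δ γ A ≤ ((Fintype.card S : ℝ) ^ (1 / 2 : ℝ)) ^ (1 / γ) :=
        Real.rpow_le_rpow (by positivity) h1 (by positivity)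
    _ = (Fintype.card S : ℝ) ^ (1 / 2 * (1 / γ)) := (Real.rpow_mul hn0.le _ _).symm
    _ ≤ (Fintype.card S : ℝ) ^ (1 : ℝ) := by
        refine Real.rpow_le_rpow_of_exponent_le hn ?_
        rw [← mul_one_div, one_mul, div_mul_div_comm, one_mul, div_le_one (by linarith)]
        linarith
    _ = Fintype.card S := Real.rpow_one _

/-- Since `λ ≤ 2 d₀ ≤ n ^ κ`, the condition on `|A|` makes the radius a power of `n`. This leaves
room for the integer part and for a slope `σ = n ^ κ / h ≤ 1 / 2`. -/
lemma IsPocket.four_mul_le_pocketRadius (hp : IsPocket d₀ δ δ' γ a G A V v)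
    (hγ : 1 / 2 < γ) (hlam : 0 < spectralGap G) (hl : IsLarge κ C (Fintype.card S))
    (hC : 4 * (d₀ + 1) ≤ C) (hκ0 : 0 < κ) (hκ : κ ≤ δ / 64) (hκγ : κ * γ ≤ δ / 64) :
    4 * (Fintype.card S : ℝ) ^ κ ≤ pocketRadius δ γ A := by
  have hn0 := hl.pos
  set n : ℝ := (Fintype.card S : ℝ) with hn
  have hd0 : (0 : ℝ) ≤ d₀ := Nat.cast_nonneg _
  have h1 : n ^ (-(κ / 2)) ≤ spectralGap G ^ (-(1 / 2) : ℝ) := by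
    have h2 : spectralGap G ≤ n ^ κ :=
      hp.base.spectralGap_le_two_mul.trans ((by linarith : (2 : ℝ) * d₀ ≤ C).trans hl.const_le)
    refine le_trans (le_of_eq ?_) (Real.rpow_le_rpow_of_nonpos hlam h2 (by norm_num))
    rw [← Real.rpow_mul hn0.le]; congr 1; ring
  have h2 : n ^ (-(κ / 2) + 15 * δ / 16) ≤ A.card := by
    rw [Real.rpow_add hn0]
    exact (mul_le_mul_of_nonneg_right h1 (by positivity)).trans hp.card_pocket
  have h3 : n ^ (δ / 4) ≤ √(A.card : ℝ) * n ^ (-(δ / 8)) := by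
    have h4 : n ^ ((-(κ / 2) + 15 * δ / 16) * (1 / 2)) ≤ √(A.card : ℝ) := by
      rw [Real.sqrt_eq_rpow, Real.rpow_mul hn0.le]
      exact Real.rpow_le_rpow (by positivity) h2 (by norm_num)
    calc n ^ (δ / 4) ≤ n ^ ((-(κ / 2) + 15 * δ / 16) * (1 / 2) + -(δ / 8)) :=
          Real.rpow_le_rpow_of_exponent_le hl.one_lt.le (by linarith)
      _ ≤ _ := by rw [Real.rpow_add hn0]; gcongr
  have h4 : n ^ (2 * κ) ≤ pocketRadius δ γ A := by
    calc n ^ (2 * κ) ≤ n ^ (δ / 4 * (1 / γ)) := by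
          refine Real.rpow_le_rpow_of_exponent_le hl.one_lt.le ?_
          rw [mul_one_div, le_div_iff₀ (by linarith)]
          linarith
      _ = (n ^ (δ / 4)) ^ (1 / γ) := Real.rpow_mul hn0.le _ _
      _ ≤ pocketRadius δ γ A := Real.rpow_le_rpow (by positivity) h3 (by positivity)
  exact (hl.mul_rpow_le (by linarith) (by linarith)).trans h4

/-- The base gives `k ^ (-γ)` and the height `k ^ (-1/2)`. The exponent `γ + 1/2` is split into `1 +
τ`, for summability, and the rest, for smallness of the tail. -/
lemma IsPocket.pocketData (hp : IsPocket d₀ δ δ' γ a G A V v) {τ : ℝ} (hγ : 0 ≤ γ) (ha : 0 ≤ a)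
    (hτ : 0 < τ) (hτγ : τ ≤ γ - 1 / 2) :
    PocketData G A d₀ (((d₀ * a + 1) * 4 ^ γ) * √(d₀ : ℝ)) τ (γ - 1 / 2 - τ) := by
  have hne : Nonempty S := hp.base.connected.nonempty
  have h1 : (1 : ℝ) ≤ d₀ :=
    (hp.base.one_le_degR (Classical.arbitrary S)).trans (hp.base.degR_le _)
  have hpos : ∀ g, 0 < degR G g := fun g => by linarith [hp.base.one_le_degR g]
  have hdiag : ∀ g ∈ A, ∀ n : ℕ, 1 ≤ n → killedKernel G A g n g ≤ a / (n : ℝ) ^ γ := by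
    intro g hg n hn
    rw [← walkLaw_killed_eq G hpos]
    exact hp.heat_kernel g hg n hn
  have hkill := killedKernel_le hpos hp.base.one_le_degR hp.base.degR_le (by linarith) ha hγ hdiag
  refine ⟨hp.base.one_le_degR, hp.base.degR_le, by linarith, by positivity, hτ, by linarith, ?_⟩
  intro g' k g
  have hk : (0 : ℝ) < (k : ℝ) + 1 := by positivity
  calc killedKernel G A g' k g * (√(d₀ : ℝ) / √((k : ℝ) + 1))
      ≤ (((d₀ * a + 1) * 4 ^ γ) * ((k : ℝ) + 1) ^ (-γ)) * (√(d₀ : ℝ) / √((k : ℝ) + 1)) :=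
        mul_le_mul_of_nonneg_right (hkill g' k g) (by positivity)
    _ = (((d₀ * a + 1) * 4 ^ γ) * √(d₀ : ℝ)) * (((k : ℝ) + 1) ^ (-γ) * ((k : ℝ) + 1) ^ (-(1 / 2) : ℝ)) := by
        rw [Real.rpow_neg hk.le (1 / 2), ← Real.sqrt_eq_rpow, div_eq_mul_inv]; ring
    _ = _ := by rw [← Real.rpow_add hk, ← Real.rpow_add hk]; congr 2; ring

end

section

variable {S : Type*} [Fintype S] [MeasurableSpace S] [MeasurableSingletonClass S]
  {G : SimpleGraph S} {A V : Finset S} {v d₀ : ℕ} {δ δ' γ a κ C : ℝ}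

/-- Rounding up is the worse case, hence the `+ 1`. -/
lemma IsPocket.half_height_le (hp : IsPocket d₀ δ δ' γ a G A V v) :
    2 * v ≤ height' δ γ G A + 1 ∧ v ≤ V.card := by
  have h1 : ⌈(height' δ γ G A : ℝ) / 2⌉₊ ≤ (height' δ γ G A + 1) / 2 := by
    refine Nat.ceil_le.2 ?_
    have : height' δ γ G A ≤ 2 * ((height' δ γ G A + 1) / 2) := by omega
    have : (height' δ γ G A : ℝ) ≤ 2 * ((height' δ γ G A + 1) / 2 : ℕ) := by exact_mod_cast this
    linarith
  have h2 := Nat.floor_le_ceil ((height' δ γ G A : ℝ) / 2)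
  rcases hp.half_height with h | h <;> omega

/-- The constant in front of the tail term of the pocket Green function. -/
def tailConst (d₀ : ℕ) (γ a τ : ℝ) : ℝ :=
  9 * ((((d₀ * a + 1) * 4 ^ γ) * √(d₀ : ℝ)) * (∑' k : ℕ, ((k : ℝ) + 1) ^ (-(1 + τ)))) * 4 ^ (2 * γ)

/-- Escape probability from the pocket, per unit of height. -/
lemma IsPocket.slabProb_le_of_radius (hp : IsPocket d₀ δ δ' γ a G A V v) {τ : ℝ}
    (hδ0 : 0 < δ) (hγ : 1 / 2 < γ) (ha : 0 < a) (hτ : 0 < τ) (hτγ : τ ≤ γ - 1 / 2)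
    (hlam : 0 < spectralGap G) (hl : IsLarge κ C (Fintype.card S))
    (hC : 4 * (d₀ + 1) ≤ C) (hC' : 15 ≤ C) (hκ0 : 0 < κ) (hκ : κ ≤ δ / 64)
    (hκγ : κ * γ ≤ δ / 64) (hh : height' δ γ G A = ⌊pocketRadius δ γ A⌋₊)
    (g : S) (z : ℤ) (hz : z.natAbs = height' δ γ G A) :
    slabProb G V v (height' δ γ G A) (g, z) / height' δ γ G A
      ≤ 27 * (Fintype.card S : ℝ) ^ (δ / 4 - 3)
        + tailConst d₀ γ a τ * (Fintype.card S : ℝ) ^ (δ / 2 + 2 * κ * γ + 2 * τ) * (A.card : ℝ)⁻¹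
        + (Fintype.card S : ℝ) ^ (-1 + δ / 8) := by
  have hB := hp.four_mul_le_pocketRadius hγ hlam hl hC hκ0 hκ hκγ
  have hBn := pocketRadius_le (S := S) (A := A) hδ0.le hγ hl.one_lt.le
  have hBγ := pocketRadius_rpow (S := S) (A := A) (δ := δ) (by linarith : γ ≠ 0)
  have hn0 := hl.pos
  obtain ⟨hv2, hvV⟩ := hp.half_height_le
  have hη := hp.localization
  set n : ℝ := (Fintype.card S : ℝ) with hn
  set B := pocketRadius δ γ A with hBdef
  set h := height' δ γ G A with hhdef
  -- With slope `σ = s / h`, the power `s` beats the logarithm required in the escape term and costs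
  -- only `n ^ (2κγ)` in the tail.
  set s : ℝ := n ^ κ with hs
  set Z := ∑' k : ℕ, ((k : ℝ) + 1) ^ (-(1 + τ)) with hZ
  set b := ((d₀ * a + 1) * 4 ^ γ) * √(d₀ : ℝ) with hb
  have hs15 : 15 ≤ s := hC'.trans hl.const_le
  have hslog : 15 * Real.log n ≤ s :=
    le_trans (mul_le_mul_of_nonneg_right hC' (Real.log_nonneg hl.one_lt.le)) hl.log_le
  have hhB : (h : ℝ) ≤ B := by rw [hh]; exact Nat.floor_le (by linarith)
  have hBh : B / 2 ≤ h := by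
    have := Nat.lt_floor_add_one B
    rw [← hh] at this
    linarith
  have hsh : 2 * s ≤ h := by linarith
  have hh0 : (0 : ℝ) < h := by linarith
  have hh30 : 30 ≤ h := by
    have : (30 : ℝ) ≤ h := by linarith
    exact_mod_cast this
  have hvh : v ≤ h := by omega
  have hl3 : (h : ℝ) / 3 ≤ (h - v : ℕ) := by
    rw [Nat.cast_sub hvh]
    have : 3 * v ≤ 2 * h := by omega
    have : 3 * (v : ℝ) ≤ 2 * h := by exact_mod_cast this
    linarith
  have hσ : s / h ≤ 1 / 2 := by rw [div_le_iff₀ hh0]; linarith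
  have hDd := hp.pocketData (by linarith) ha.le hτ hτγ
  have hq : ∀ x : S × ℤ, x.1 ∉ A → slabProb G V v h x ≤ h * n ^ (-1 + δ / 8) := by
    intro x hx
    have h1 : n ^ (1 - δ / 8) / h * slabProb G V v h x ≤ 1 := hη x hx
    have h2 : n ^ (-1 + δ / 8) * n ^ (1 - δ / 8) = 1 := by
      rw [← Real.rpow_add hn0, ← Real.rpow_zero n]; congr 1; ring
    calc slabProb G V v h x
        = h * n ^ (-1 + δ / 8) * (n ^ (1 - δ / 8) / h * slabProb G V v h x) := by
          have : h * n ^ (-1 + δ / 8) * (n ^ (1 - δ / 8) / h * slabProb G V v h x)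
            = (n ^ (-1 + δ / 8) * n ^ (1 - δ / 8)) * (h / h) * slabProb G V v h x := by ring
          rw [this, h2, div_self hh0.ne', one_mul, one_mul]
      _ ≤ h * n ^ (-1 + δ / 8) * 1 := by gcongr
      _ = _ := mul_one _
  have hmain := hDd.slabProb_le (k₀ := ⌊1 / (4 * (s / h) ^ 2)⌋₊) (l := h - v) hp.subset hq
    (by positivity) (by positivity) hσ (by omega) g z hz
  have hesc := escape_term_le hl.one_lt.le hslog (by linarith) hsh (hhB.trans hBn) hl3
  have htail := tail_term_le (γ := γ) (τ := τ) (by linarith : 0 < s) (by linarith : 0 < B) hBh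
    (hhB.trans hBn) hτ.le hτγ
  have hbox := box_card_le hp.card_le hvV
  rw [← hn] at hbox
  set k₀ := ⌊1 / (4 * (s / h) ^ 2)⌋₊ with hk₀
  have hZ0 : 0 ≤ Z := tsum_nonneg fun k => by positivity
  have hb0 : 0 ≤ b := hDd.b_nonneg
  have hsγ : s ^ (2 * γ - 1 - 2 * τ) ≤ n ^ (2 * κ * γ) := by
    rw [hs, ← Real.rpow_mul hn0.le]
    refine Real.rpow_le_rpow_of_exponent_le hl.one_lt.le ?_
    nlinarith
  have htail' : ((k₀ : ℝ) + 1) ^ (-(γ - 1 / 2 - τ)) / h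
      ≤ 4 ^ (2 * γ) * n ^ (2 * κ * γ) * n ^ (2 * τ) * ((A.card : ℝ)⁻¹ * n ^ (δ / 4)) := by
    refine htail.trans ?_
    rw [hBγ]
    gcongr
  have hescdiv : (k₀ : ℝ) * ((1 + 4 * (s / h) ^ 2) ^ k₀ * Real.exp (-(s / h) * (h - v : ℕ))) / h
      ≤ 3 * n ^ (-3 : ℝ) :=
    (div_le_self (by positivity) (by linarith)).trans hesc
  calc slabProb G V v h (g, z) / h
      ≤ (3 * ((V.card * (2 * v + 1)) * (k₀ * ((1 + 4 * (s / h) ^ 2) ^ k₀ *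
          Real.exp (-(s / h) * (h - v : ℕ))) + b * (((k₀ : ℝ) + 1) ^ (-(γ - 1 / 2 - τ)) * Z)))
          + h * n ^ (-1 + δ / 8)) / h := by gcongr
    _ = 3 * ((V.card * (2 * v + 1)) * (k₀ * ((1 + 4 * (s / h) ^ 2) ^ k₀ *
          Real.exp (-(s / h) * (h - v : ℕ))) / h + b * Z * (((k₀ : ℝ) + 1) ^ (-(γ - 1 / 2 - τ)) / h)))
          + h / h * n ^ (-1 + δ / 8) := by ring
    _ ≤ 3 * ((3 * n ^ (δ / 4)) * (3 * n ^ (-3 : ℝ) + b * Z *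
          (4 ^ (2 * γ) * n ^ (2 * κ * γ) * n ^ (2 * τ) * ((A.card : ℝ)⁻¹ * n ^ (δ / 4)))))
          + 1 * n ^ (-1 + δ / 8) := by
        rw [div_self hh0.ne']
        gcongr
    _ = _ := by
        have e1 : n ^ (δ / 4 - 3) = n ^ (δ / 4) * n ^ (-3 : ℝ) := by
          rw [← Real.rpow_add hn0]; congr 1
        have e2 : n ^ (δ / 2 + 2 * κ * γ + 2 * τ)
            = n ^ (δ / 4) * n ^ (δ / 4) * n ^ (2 * κ * γ) * n ^ (2 * τ) := by
          rw [← Real.rpow_add hn0, ← Real.rpow_add hn0, ← Real.rpow_add hn0]; congr 1; ring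
        rw [e1, e2, tailConst]
        ring

/-- Hitting probability when the height of the slab is the radius of the pocket. -/
lemma Scales.hit_le_of_radius {ε ε₀ τ : ℝ} {n₀ : ℕ} (hs : Scales G d₀ δ κ ε ε₀ n₀)
    (hp : IsPocket d₀ δ δ' γ a G A V v)
    (hδ0 : 0 < δ) (hδ : δ < 1 / 2) (hγ : 1 / 2 < γ) (ha : 0 < a) (hτ : 0 < τ)
    (hτδ : τ ≤ δ / 64) (hτγ : τ ≤ γ - 1 / 2) (hκ0 : 0 < κ) (hκ : κ ≤ δ / 64)
    (hκγ : κ * γ ≤ δ / 64) (hl : IsLarge κ C (Fintype.card S)) (hC : 100 * (d₀ + 2) ^ 2 ≤ C)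
    (hC' : tailConst d₀ γ a τ ≤ C) (hh : height' δ γ G A = ⌊pocketRadius δ γ A⌋₊)
    (u : ℤ) (y : S × ℤ) (hy : y ∉ slab S (height' δ γ G A) u) :
    (walkLaw (cylinderGraph G) y).real
      {ω | ∃ n < ⌈(Fintype.card S : ℝ) ^ (2 * (1 - δ))⌉₊, ω n ∈ box V v u}
      ≤ (Fintype.card S : ℝ) ^ (-(δ / 4)) := by
  have : Nonempty S := hp.base.connected.nonempty
  have hlam0 : 0 < spectralGap G := hs.mixing.lam_pos
  have hd0 : (0 : ℝ) ≤ d₀ := Nat.cast_nonneg _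
  have hC4 : 4 * (d₀ + 1) ≤ C := by nlinarith
  have hC15 : 100 ≤ C := by nlinarith
  have hn0 := hl.pos
  obtain ⟨hv2, hvV⟩ := hp.half_height_le
  have hBr := hp.four_mul_le_pocketRadius hγ hlam0 hl hC4 hκ0 hκ hκγ
  have hvh : v < height' δ γ G A := by
    have : 2 ≤ height' δ γ G A := by
      rw [hh]
      refine Nat.le_floor ?_
      have := hl.const_le
      push_cast
      linarith
    omega
  have hh0 : (0 : ℝ) < height' δ γ G A := by
    have : 0 < height' δ γ G A := by omega
    exact_mod_cast this
  set n : ℝ := (Fintype.card S : ℝ) with hn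
  set q : ℝ := 27 * n ^ (δ / 4 - 3)
        + tailConst d₀ γ a τ * n ^ (δ / 2 + 2 * κ * γ + 2 * τ) * (A.card : ℝ)⁻¹
        + n ^ (-1 + δ / 8) with hq
  have hF : ∀ g (z : ℤ), z.natAbs = height' δ γ G A →
      slabProb G V v (height' δ γ G A) (g, z) ≤ q * height' δ γ G A := by
    intro g z hz
    rw [← div_le_iff₀ hh0]
    exact hp.slabProb_le_of_radius hδ0 hγ ha hτ hτγ hlam0 hl hC4 (by linarith) hκ0 hκ hκγ hh g z hz
  refine (hs.mixing.walkLaw_hit_box_le_of_slabProb hvh hF u y hy).trans ?_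
  rw [mul_div_cancel_right₀ _ hh0.ne', ← hn]
  have hbox := box_card_le hp.card_le hvV
  rw [← hn] at hbox
  set M : ℝ := 2 * ((d₀ : ℝ) + 2) with hM
  have hM4 : 4 ≤ M := by rw [hM]; linarith
  have hCM : 25 * M ^ 2 ≤ C := by
    have : 25 * M ^ 2 = 100 * ((d₀ : ℝ) + 2) ^ 2 := by rw [hM]; ring
    rw [this]; exact hC
  have hε := hs.mixing.eps_pos
  have hε₀ := hs.mixing.eps₀_pos
  have hAn : (A.card : ℝ) ≤ n := by rw [hn]; exact_mod_cast A.card_le_univ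
  have hA0 : (0 : ℝ) < A.card := by
    refine lt_of_lt_of_le ?_ hp.card_pocket
    positivity
  -- The size of the pocket trades `λ ^ (-1/2)` for `|A| n ^ (-15δ/16)`; this `|A|` cancels the
  -- `|A|⁻¹` in the tail term of `q`.
  have hinv : 1 / ε₀ ≤ n ^ κ * (A.card * n ^ (-(15 * δ / 16))) := by
    refine hs.inv_eps₀_le.trans (mul_le_mul_of_nonneg_left ?_ (by positivity))
    rw [Real.rpow_neg hn0.le, ← div_eq_mul_inv, le_div_iff₀ (by positivity)]
    exact hp.card_pocket
  have htc : 0 ≤ tailConst d₀ γ a τ := by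
    have : 0 ≤ ∑' k : ℕ, ((k : ℝ) + 1) ^ (-(1 + τ)) := tsum_nonneg fun k => by positivity
    unfold tailConst
    positivity
  have hq0 : 0 ≤ q := by positivity
  have hfirst : q / ε₀ ≤ 3 * n ^ (-(5 * δ / 16)) := by
    calc q / ε₀ = q * (1 / ε₀) := by ring
      _ ≤ q * (n ^ κ * (A.card * n ^ (-(15 * δ / 16)))) := by gcongr
      _ = 27 * n ^ (δ / 4 - 3) * (n ^ κ * (A.card * n ^ (-(15 * δ / 16))))
          + tailConst d₀ γ a τ * n ^ (δ / 2 + 2 * κ * γ + 2 * τ)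
              * (n ^ κ * n ^ (-(15 * δ / 16))) * ((A.card : ℝ)⁻¹ * A.card)
          + n ^ (-1 + δ / 8) * (n ^ κ * (A.card * n ^ (-(15 * δ / 16)))) := by rw [hq]; ring
      _ ≤ 27 * n ^ (δ / 4 - 3) * (n ^ κ * (n * n ^ (-(15 * δ / 16))))
          + tailConst d₀ γ a τ * n ^ (δ / 2 + 2 * κ * γ + 2 * τ)
              * (n ^ κ * n ^ (-(15 * δ / 16))) * 1
          + n ^ (-1 + δ / 8) * (n ^ κ * (n * n ^ (-(15 * δ / 16)))) := by
          rw [inv_mul_cancel₀ hA0.ne']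
          gcongr
      _ = 27 * n ^ (δ / 4 - 3 + κ + 1 + -(15 * δ / 16))
          + tailConst d₀ γ a τ * n ^ (δ / 2 + 2 * κ * γ + 2 * τ + κ + -(15 * δ / 16))
          + 1 * n ^ (-1 + δ / 8 + κ + 1 + -(15 * δ / 16)) := by
          simp only [Real.rpow_add hn0, Real.rpow_one]
          ring
      _ ≤ n ^ (-(5 * δ / 16)) + n ^ (-(5 * δ / 16)) + n ^ (-(5 * δ / 16)) :=
          add_le_add (add_le_add (hl.mul_rpow_le (by linarith) (by linarith))
            (hl.mul_rpow_le hC' (by linarith))) (hl.mul_rpow_le (by linarith) (by linarith))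
      _ = _ := by ring
  -- After mixing only the total charge counts: the capacity of the box, spread over `n` points,
  -- times `1 / ε`.
  have hsecond : ((d₀ : ℝ) + 2) * V.card * (2 * v + 1) / (n * ε) ≤ n ^ (-(5 * δ / 16)) := by
    calc ((d₀ : ℝ) + 2) * V.card * (2 * v + 1) / (n * ε)
        = M / 2 * (V.card * (2 * v + 1)) * (n⁻¹ * (1 / ε)) := by rw [hM]; field_simp
      _ ≤ M / 2 * (3 * n ^ (δ / 4)) * (n⁻¹ * (4 * M * n ^ (1 - δ))) := by
          have h1 := hs.inv_eps_le
          gcongr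
      _ = (6 * M ^ 2) * n ^ (δ / 4 + -1 + (1 - δ)) := by
          rw [Real.rpow_add hn0, Real.rpow_add hn0, Real.rpow_neg_one]; ring
      _ ≤ n ^ (-(5 * δ / 16)) := hl.mul_rpow_le (by linarith [sq_nonneg M]) (by linarith)
  have hthird : ((d₀ : ℝ) + 2) * V.card * (2 * v + 1) *
      ((1 - spectralGap G / (2 * M)) ^ n₀ * (2 / spectralGap G)) ≤ n ^ (-(5 * δ / 16)) := by
    calc ((d₀ : ℝ) + 2) * V.card * (2 * v + 1) *
          ((1 - spectralGap G / (2 * M)) ^ n₀ * (2 / spectralGap G))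
        = M / 2 * (V.card * (2 * v + 1)) *
          ((1 - spectralGap G / (2 * M)) ^ n₀ * (2 * (1 / spectralGap G))) := by rw [hM]; ring
      _ ≤ M / 2 * (3 * n ^ (δ / 4)) * (n ^ (-5 : ℝ) * (2 * n ^ (3 : ℝ))) := by
          have h1 := hs.contraction_le
          have h2 := hs.inv_gap_le
          have h3 : 0 ≤ (1 - spectralGap G / (2 * M)) ^ n₀ := by
            have : spectralGap G / (2 * M) ≤ 1 := by
              rw [div_le_one (by positivity)]; linarith [hs.mixing.lam_le]
            exact pow_nonneg (by linarith) _
          gcongr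
      _ = (3 * M) * n ^ (δ / 4 + -5 + 3) := by
          rw [Real.rpow_add hn0, Real.rpow_add hn0]; ring
      _ ≤ n ^ (-(5 * δ / 16)) := hl.mul_rpow_le (by nlinarith) (by linarith)
  have hfin : 32 * n ^ (-(5 * δ / 16)) ≤ n ^ (-(δ / 4)) :=
    hl.mul_rpow_le (by linarith) (by linarith)
  have : 2 * q / ε₀ = 2 * (q / ε₀) := by ring
  rw [this]
  linarith

end

/-! ### Union bound over the levels -/

section

variable {S : Type*} [Fintype S] [MeasurableSpace S] [MeasurableSingletonClass S]

/-- The walk moves by at most one level per step. -/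
lemma walkLaw_hit_box_eq_zero (G : SimpleGraph S) (V : Finset S) {v T : ℕ} {u : ℤ} {x : S × ℤ}
    (h : v + T < (x.2 - u).natAbs) :
    walkLaw (cylinderGraph G) x {ω | ∃ n < T, ω n ∈ box V v u} = 0 := by
  have hset : {ω : ℕ → S × ℤ | ∃ n < T, ω n ∈ box V v u} = hitWithin (box V v u) Set.univ T := by
    ext ω; simp [hitWithin]
  rw [hset, ← measureReal_eq_zero_iff]
  set P := (walkLaw (cylinderGraph G) x).real (hitWithin (box V v u) Set.univ T) with hP
  -- Discounted comparison with `s` raised to the vertical distance to the box: that distance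
  -- exceeds `T`, so a factor `s` survives the discount `s ^ T`; then `s` tends to 0.
  have key : ∀ s : ℝ, 0 < s → s ≤ 1 → P ≤ s := by
    intro s hs hs1
    have h1 := pow_mul_walkLaw_hitWithin_le G (C := box V v u) (B := Set.univ) hs.le hs1
      (w := fun y => s ^ ((y.2 - u).natAbs - v)) (fun y => by positivity) ?_ ?_ T x
    · have h2 : s ^ ((x.2 - u).natAbs - v) ≤ s ^ (T + 1) :=
        pow_le_pow_of_le_one hs.le hs1 (by omega)
      rw [pow_succ] at h2
      exact le_of_mul_le_mul_left (h1.trans h2) (by positivity)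
    · intro y hy _
      have : (y.2 - u).natAbs - v = 0 := by
        have := hy.2
        rw [Int.abs_eq_natAbs] at this
        omega
      simp [this]
    · rintro ⟨g, z⟩ _ _
      have hstep : ∀ z' : ℤ, (z' - z).natAbs ≤ 1 →
          s * s ^ ((z' - u).natAbs - v) ≤ s ^ ((z - u).natAbs - v) := by
        intro z' hz'
        rw [← pow_succ']
        exact pow_le_pow_of_le_one hs.le hs1 (by omega)
      have h2 := hstep (z + 1) (by omega)
      have h3 := hstep (z - 1) (by omega)
      have h4 := mul_le_mul_of_nonneg_right (hstep z (by omega)) (degR_nonneg G g)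
      have h5 : nbSum G (fun _ => s ^ ((z - u).natAbs - v)) g
          = s ^ ((z - u).natAbs - v) * degR G g := by
        simp only [degR, nbSum, Finset.mul_sum, mul_ite, mul_one, mul_zero]
      simp only [cylSum, h5]
      linarith
  refine le_antisymm (le_of_forall_pos_le_add fun s hs => ?_) measureReal_nonneg
  rw [zero_add]
  exact (key (min s 1) (by positivity) (min_le_right _ _)).trans (min_le_left _ _)

/-- Union bound over the levels which are within reach of the walk. -/
lemma walkLaw_lt_iSup_numExcursions_le (G : SimpleGraph S) (V : Finset S) {v h' : ℕ} {t p : ℝ}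
    (hp0 : 0 ≤ p) (hp : ∀ (u : ℤ) (y : S × ℤ), y ∉ slab S h' u →
      (walkLaw (cylinderGraph G) y).real {ω | ∃ n < ⌈t⌉₊, ω n ∈ box V v u} ≤ p)
    (K : ℕ) (x : S × ℤ) :
    (walkLaw (cylinderGraph G) x).real
      {ω | (K : ℕ∞) < ⨆ u : ℤ, numExcursions (box V v u) (slab S h' u) t ω}
      ≤ (2 * (v + ⌈t⌉₊ : ℕ) + 1) * p ^ K := by
  -- Levels farther than `R` are almost surely not visited in time, so the supremum over all levels
  -- reduces to a finite union.
  set R := v + ⌈t⌉₊ with hR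
  set I := Finset.Icc (x.2 - R) (x.2 + R) with hI
  set μ := walkLaw (cylinderGraph G) x with hμ
  set Q : ℤ → Set (ℕ → S × ℤ) := fun u =>
    {ω | returnTime (box V v u) (slab S h' u) ω K < ⌈t⌉₊} with hQ
  have hsub : {ω | (K : ℕ∞) < ⨆ u : ℤ, numExcursions (box V v u) (slab S h' u) t ω}
      ⊆ (⋃ u ∈ I, Q u) ∪ ⋃ u : {u : ℤ // R < (x.2 - u).natAbs},
        {ω | ∃ n < ⌈t⌉₊, ω n ∈ box V v u} := by
    intro ω hω
    rw [Set.mem_ofPred_eq] at hω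
    obtain ⟨u, hu⟩ := lt_iSup_iff.1 hω
    have hr := returnTime_lt_of_lt_numExcursions hu
    by_cases hf : R < (x.2 - u).natAbs
    · refine Or.inr (Set.mem_iUnion.2 ⟨⟨u, hf⟩, ?_⟩)
      obtain ⟨m, hm, -, hC⟩ := entranceAfter_lt_iff.1 hr
      exact ⟨m, hm, hC⟩
    · refine Or.inl (Set.mem_iUnion₂.2 ⟨u, ?_, hr⟩)
      rw [hI, Finset.mem_Icc]
      omega
  have hfar : μ (⋃ u : {u : ℤ // R < (x.2 - u).natAbs},
      {ω | ∃ n < ⌈t⌉₊, ω n ∈ box V v u}) = 0 :=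
    measure_iUnion_null fun u => walkLaw_hit_box_eq_zero G V u.2
  have hnear : ∀ u, μ (Q u) ≤ ENNReal.ofReal p ^ K := by
    intro u
    refine walkLaw_returnTime_lt_le _ _ _ _ _ (fun y hy => ?_) x K
    exact (ENNReal.le_ofReal_iff_toReal_le (measure_ne_top _ _) hp0).2 (hp u y hy)
  have hcard : I.card = 2 * R + 1 := by
    rw [hI, Int.card_Icc]
    omega
  have hle : μ {ω | (K : ℕ∞) < ⨆ u : ℤ, numExcursions (box V v u) (slab S h' u) t ω}
      ≤ (2 * R + 1 : ℕ) * ENNReal.ofReal p ^ K := by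
    calc _ ≤ μ (⋃ u ∈ I, Q u) + 0 := by
          rw [← hfar]
          exact (measure_mono hsub).trans (measure_union_le _ _)
      _ ≤ ∑ u ∈ I, μ (Q u) := by rw [add_zero]; exact measure_biUnion_finset_le _ _
      _ ≤ I.card • ENNReal.ofReal p ^ K := Finset.sum_le_card_nsmul _ _ _ fun u _ => hnear u
      _ = _ := by rw [nsmul_eq_mul, hcard]
  refine ENNReal.toReal_le_of_le_ofReal (by positivity) (hle.trans (le_of_eq ?_))
  rw [ENNReal.ofReal_mul (by positivity), ENNReal.ofReal_pow hp0]
  congr 1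
  rw [← ENNReal.ofReal_natCast]
  push_cast
  rfl

end

/-- The reachable levels are outnumbered by the smallness of many returns. -/
lemma levels_mul_le {n δ ε v : ℝ} {K : ℕ} (hn : 1 ≤ n) (hδ : 0 < δ) (hδ1 : δ < 1 / 2) (hv : v ≤ n)
    (hK : 12 / δ ≤ K) (hε : 0 < ε) (hnε : 7 / ε ≤ n) :
    (2 * (v + (⌈n ^ (2 * (1 - δ))⌉₊ : ℝ)) + 1) * (n ^ (-(δ / 4))) ^ K ≤ ε := by
  have hn0 : 0 < n := by linarith
  -- `K ≥ 12 / δ` yields `n ^ (-3)`, against at most `7 * n ^ 2` levels.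
  have h1 : (n ^ (-(δ / 4))) ^ K ≤ n ^ (-3 : ℝ) := by
    rw [← Real.rpow_natCast, ← Real.rpow_mul hn0.le]
    refine Real.rpow_le_rpow_of_exponent_le hn ?_
    rw [div_le_iff₀ hδ] at hK
    linarith
  have h2 : (⌈n ^ (2 * (1 - δ))⌉₊ : ℝ) ≤ n ^ 2 + 1 := by
    have h3 := Nat.ceil_lt_add_one (by positivity : 0 ≤ n ^ (2 * (1 - δ)))
    have h4 : n ^ (2 * (1 - δ)) ≤ n ^ (2 : ℝ) :=
      Real.rpow_le_rpow_of_exponent_le hn (by linarith)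
    rw [Real.rpow_two] at h4
    linarith
  have h3 : n ≤ n ^ 2 := by nlinarith
  have h4 : n ^ 2 * n ^ (-3 : ℝ) = n⁻¹ := by
    rw [← Real.rpow_two, ← Real.rpow_add hn0, ← Real.rpow_neg_one]; norm_num
  calc (2 * (v + (⌈n ^ (2 * (1 - δ))⌉₊ : ℝ)) + 1) * (n ^ (-(δ / 4))) ^ K
      ≤ (7 * n ^ 2) * n ^ (-3 : ℝ) := by
        refine mul_le_mul (by nlinarith) h1 (by positivity) (by positivity)
    _ = 7 * n⁻¹ := by rw [mul_assoc, h4]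
    _ ≤ ε := by
        rw [← div_eq_mul_inv, div_le_iff₀ hn0]
        rwa [div_le_iff₀ hε, mul_comm] at hnε

end

end CylinderWalk

/-! ### Choice of the constants and conclusion -/

theorem proposition3p2 (d₀ : ℕ) (hd₀ : 2 ≤ d₀) (δ δ' γ a : ℝ) (hδ : 0 < δ) (hδ2 : δ < 1 / 2)
    (hδ' : 0 < δ') (hδ'2 : δ' < δ / 8) (hγ : 1 / 2 < γ) (ha : 0 < a) :
    ∃ K₀ : ℕ, 0 < K₀ ∧ ∀ ε : ℝ, 0 < ε → ∃ N : ℕ,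
      ∀ (S : Type*) [Fintype S] [MeasurableSpace S] [MeasurableSingletonClass S]
        (G : SimpleGraph S) (A V : Finset S) (v : ℕ),
        N ≤ Fintype.card S → CylinderWalk.IsPocket d₀ δ δ' γ a G A V v →
        ∀ x : S × ℤ,
          (CylinderWalk.walkLaw (CylinderWalk.cylinderGraph G) x).real
            {ω | (K₀ : ℕ∞) < ⨆ u : ℤ,
              CylinderWalk.numExcursions (CylinderWalk.box V v u)
                (CylinderWalk.slab S (CylinderWalk.height' δ γ G A) u)
                ((Fintype.card S : ℝ) ^ (2 * (1 - δ))) ω} ≤ ε := by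
  have hK0 : 0 < ⌈12 / δ⌉₊ := Nat.ceil_pos.2 (by positivity)
  refine ⟨⌈12 / δ⌉₊, hK0, fun ε hε => ?_⟩
  -- `κ` and `τ` are the exponents given away; this value makes both `κ` and `κ * γ` at most `δ /
  -- 64`.
  set κ : ℝ := δ / (64 * (γ + 1)) with hκ
  set τ : ℝ := min (δ / 64) (γ - 1 / 2) with hτ
  set C : ℝ := max (400 * ((d₀ : ℝ) + 2) ^ 2) (CylinderWalk.tailConst d₀ γ a τ) with hC
  have hκ0 : 0 < κ := by positivity
  have hκ1 : κ * (γ + 1) = δ / 64 := by rw [hκ]; field_simp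
  have hτ0 : 0 < τ := lt_min (by positivity) (by linarith)
  have hκγ : κ * γ ≤ δ / 64 := by linarith
  have hκδ : κ ≤ δ / 64 := by nlinarith
  have hC1 : 400 * ((d₀ : ℝ) + 2) ^ 2 ≤ C := le_max_left _ _
  have hC2 : CylinderWalk.tailConst d₀ γ a τ ≤ C := le_max_right _ _
  have hd0 : (0 : ℝ) ≤ d₀ := Nat.cast_nonneg _
  obtain ⟨N, hN⟩ := Filter.eventually_atTop.1 (CylinderWalk.eventually_isLarge hκ0 C)
  refine ⟨max N ⌈7 / ε⌉₊, fun S _ _ _ G A V v hn hp x => ?_⟩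
  have hl := hN _ ((le_max_left _ _).trans hn)
  obtain ⟨η, η₀, n₀, hs⟩ := CylinderWalk.exists_scales hδ hδ2 hp.base hp.not_lowGap hl
    (by nlinarith)
  obtain ⟨hv2, hvV⟩ := hp.half_height_le
  have hne : V.Nonempty := by
    have := hp.connected.nonempty
    exact Finset.coe_nonempty.1 (Set.nonempty_coe_sort.1 this)
  have hbound : ∀ (u : ℤ) (y : S × ℤ), y ∉ CylinderWalk.slab S (CylinderWalk.height' δ γ G A) u →
      (CylinderWalk.walkLaw (CylinderWalk.cylinderGraph G) y).real
        {ω | ∃ n < ⌈(Fintype.card S : ℝ) ^ (2 * (1 - δ))⌉₊, ω n ∈ CylinderWalk.box V v u}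
        ≤ (Fintype.card S : ℝ) ^ (-(δ / 4)) := by
    -- `height'` is a minimum: either the integer part of the radius, or the mixing height `h`.
    rcases min_choice ⌊CylinderWalk.pocketRadius δ γ A⌋₊ (CylinderWalk.height G) with hh | hh
    · exact hs.hit_le_of_radius hp hδ hδ2 hγ ha hτ0 (min_le_left _ _) (min_le_right _ _) hκ0 hκδ
        hκγ hl (by nlinarith) hC2 hh
    · have hh' : CylinderWalk.height' δ γ G A = CylinderWalk.height G := hh
      rw [hh'] at hv2 ⊢
      refine hs.hit_le_of_height hδ hδ2 hκδ hl (by nlinarith) hne hp.card_le hvV ?_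
      have : 2 ≤ CylinderWalk.height G := by rw [CylinderWalk.height]; omega
      omega
  have hmain := CylinderWalk.walkLaw_lt_iSup_numExcursions_le G V (by positivity) hbound
    ⌈12 / δ⌉₊ x
  refine hmain.trans ?_
  push_cast
  refine CylinderWalk.levels_mul_le hl.one_lt.le hδ hδ2 ?_ (Nat.le_ceil _) hε ?_
  · exact_mod_cast hvV.trans V.card_le_univ
  · exact (Nat.le_ceil _).trans (by exact_mod_cast (le_max_right _ _).trans hn)
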